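/- **Setting.** Let $M$ be a compact manifold with corners and let $Y\neq\emptyset$ be a closed embedded hypersurface of $M$ that is a boundary hyperface (or a disjoint union of boundary hyperfaces), called the regular boundary; so near each point of $Y$ there is a chart of $M$ in $[0,\infty)^{n+1}$ in which $Y=\{x_0=0\}$, and $Y$ is itself a manifold with corners. The boundary hyperfaces not contained in $Y$ are called singular, $\partial_{s}M$ denotes their union, and $Y_0=Y\setminus\partial_sM$ is the interior of $Y$. A *Lie manifold with boundary* $Y$ is such a pair together with a smooth vector bundle $\mathcal A\to M$ and a smooth bundle map $\varrho\colon\mathcal A\to TM$ (the anchor) such that * $\mathcal V=\varrho(\Gamma(\mathcal A))$ is a Lie algebra of vector fields, all of them tangent to every singular hyperface; * $\varrho_p\colon\mathcal A_p\to T_pM$ is an isomorphism for $p\in M\setminus\partial_sM$; * $Y$ is transverse: $T_pM=\varrho(\mathcal A_p)+T_pY$ for $p\in Y\cap\partial_sM$. Put $\mathcal B_y=\{a\in\mathcal A_y:\varrho(a)\in T_yY\}$ for $y\in Y$. This is the Lie subalgebroid $\mathcal B\subset\mathcal A_{|Y}$ with $\Gamma(\mathcal B)\cong\mathcal W=\{V_{|Y}:V\in\mathcal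 V,\ V_{|Y}\text{ tangent to }Y\}$. An $\mathcal A$-metric is a smooth euclidean structure $g$ on $\mathcal A$. Its volume density is $\mu_g(a_0,\dots,a_n)=\sqrt{\det(g(a_i,a_j))}$. The Lie manifold is *measured* by a one-density $\mu$ if $\mu=\mu_g$ for some $\mathcal A$-metric $g$. The induced density $\nu$ on $Y$ is the volume density of the $\mathcal B$-metric $g_\partial=g_{|\mathcal B}$. Through $\varrho$ the densities $\mu$ and $\nu$ are ordinary one-densities on $M\setminus\partial_sM$ and $Y_0$. **Theorem.** Let $M$ be a Lie manifold with boundary $Y$, measured by $\mu=\mu_g$, and let $\nu$ be the density on $Y$ induced by $g$. Let $\mathbf n\in\Gamma(\mathcal A_{|Y})$ be the inward pointing unit normal field, i.e. $\mathbf n\perp_g\mathcal B$, $g(\mathbf n,\mathbf n)=1$ and $\varrho(\mathbf n)$ points into $M$; let $\tau$ be the accompanying one-form on $\mathcal A_{|Y}$, i.e. $\tau(\mathbf n)=1$ and $\tau_{|\mathcal B}=0$. Then there are $r>0$, an open neighborhood $\mathcal U$ of $Y$ in $M$ and a diffeomorphism $\Phi=(u,\psi)\colon\mathcal U\to[0,r)\times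 Y$ of manifolds with corners such that: i) $u$ is the restriction to $\mathcal U$ of a boundary defining function of $Y$: a function in $C^\infty(M,\mathbb R)$, also denoted by $u$, with $Y=u^{-1}(0)$ and $du\neq0$ at each point of $Y$. ii) $\Phi_{|Y}=\mathrm{id}_Y$, i.e. $\Phi(y)=(0,y)$ for $y\in Y$; thus $\psi=\mathrm{pr}_Y\circ\Phi$ is a smooth retraction of $\mathcal U$ onto $Y$. iii) $d\Phi(\varrho(\mathbf n))=\partial_u$ along $Y$. iv) $\tau=du\circ\varrho$ on $\mathcal A_{|Y}$. v) $\Phi_*(\mu)=|du|\otimes\nu$, as an equality of one-densities on $[0,r)\times Y_0$. (The rest of $[0,r)\times Y$ corresponds to the singular boundary.) -/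

import Mathlib

open Set Filter Topology
open scoped Manifold ContDiff Bundle

/-! ### One-densities on vector spaces -/

/-- A (one-)density on a real vector space `V` of dimension `k`: a real function of `k`-tuples of
vectors which is multiplied by `|det P|` when the tuple is transformed by the matrix `P`. -/
structure OneDensity (k : ℕ) (V : Type*) [AddCommGroup V] [Module ℝ V] where
  toFun : (Fin k → V) → ℝ
  map_matrix' : ∀ (P : Matrix (Fin k) (Fin k) ℝ) (v : Fin k → V),
    toFun (fun i => ∑ j, P i j • v j) = |P.det| * toFun v

namespace OneDensity

variable {k : ℕ} {V W : Type*} [AddCommGroup V] [Module ℝ V] [AddCommGroup W] [Module ℝ W]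

instance : CoeFun (OneDensity k V) (fun _ => (Fin k → V) → ℝ) := ⟨OneDensity.toFun⟩

/-- Pull-back of a density along a linear map. -/
def comap (δ : OneDensity k W) (L : V →ₗ[ℝ] W) : OneDensity k V where
  toFun v := δ (fun i => L (v i))
  map_matrix' P v := by
    simpa only [map_sum, map_smul] using δ.map_matrix' P (fun i => L (v i))

/-- `δ = |du| ⊗ ν` as densities on `ℝ × W`, where `u` is the coordinate of `ℝ`:
`δ (c ∂_u, w₁, …, w_k) = |c| ν (w₁, …, w_k)`. -/
def IsLebesgueTensor (δ : OneDensity (k + 1) (ℝ × W)) (ν : OneDensity k W) : Prop :=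
  ∀ (c : ℝ) (w : Fin k → W),
    δ (Fin.cons ((c, 0) : ℝ × W) (fun i => ((0, w i) : ℝ × W))) = |c| * ν w

/-- The condition `δ = |du| ⊗ ν` determines `δ`. -/
theorem IsLebesgueTensor.unique {δ δ' : OneDensity (k + 1) (ℝ × W)} {ν : OneDensity k W}
    [Module.Finite ℝ W] (hW : Module.finrank ℝ W = k)
    (h : δ.IsLebesgueTensor ν) (h' : δ'.IsLebesgueTensor ν) (x : Fin (k + 1) → ℝ × W) :
    δ x = δ' x := by
  let b : Module.Basis (Fin k) ℝ W := Module.finBasisOfFinrankEq ℝ W hW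
  have hx : x = fun i => ∑ j, (Matrix.of fun (i : Fin (k + 1)) (j : Fin (k + 1)) =>
      (Fin.cons (x i).1 (fun m => b.repr (x i).2 m) : Fin (k + 1) → ℝ) j) i j •
      (Fin.cons ((1, 0) : ℝ × W) (fun m => ((0, b m) : ℝ × W)) : Fin (k + 1) → ℝ × W) j := by
    funext i
    simp only [Matrix.of_apply, Fin.sum_univ_succ, Fin.cons_zero, Fin.cons_succ]
    ext
    · simp [Prod.fst_sum]
    · simp [Prod.snd_sum, b.sum_repr]
  rw [hx, δ.map_matrix', δ'.map_matrix', h, h']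

end OneDensity

/-- The inverse of a linear map, if it is bijective (and `0` otherwise). -/
noncomputable def LinearMap.inverseOrZero {V W : Type*} [AddCommGroup V] [Module ℝ V]
    [AddCommGroup W] [Module ℝ W] (L : V →ₗ[ℝ] W) : W →ₗ[ℝ] V :=
  open Classical in
  if h : Function.Bijective L then (LinearEquiv.ofBijective L h).symm.toLinearMap else 0

/-! ### Manifolds with corners and boundary hypersurfaces

Manifolds with corners of dimension `m` are modelled on the quadrant `[0, ∞)^m`. -/

/-- The model of `m`-dimensional manifolds with corners. -/
noncomputable abbrev cornerModel (m : ℕ) :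
    ModelWithCorners ℝ (EuclideanSpace ℝ (Fin m)) (EuclideanQuadrant m) :=
  modelWithCornersEuclideanQuadrant m

section Corners

variable {n : ℕ} {M : Type*} [TopologicalSpace M] [ChartedSpace (EuclideanQuadrant (n + 1)) M]
  {Y : Type*} [TopologicalSpace Y] [ChartedSpace (EuclideanQuadrant n) Y]

/-- The `i`-th coordinate function of a chart (only meaningful on the domain of the chart). -/
noncomputable def chartCoord {m : ℕ} {X : Type*} [TopologicalSpace X]
    (φ : OpenPartialHomeomorph X (EuclideanQuadrant m)) (i : Fin m) (p : X) : ℝ :=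
  (φ p).1 i

/-- `p` lies on the boundary face `{φ_i = 0}` of `M` and this face is contained in `S` near `p`. -/
def FaceInside (S : Set M) (φ : OpenPartialHomeomorph M (EuclideanQuadrant (n + 1)))
    (i : Fin (n + 1)) (p : M) : Prop :=
  p ∈ φ.source ∧ chartCoord φ i p = 0 ∧ ∀ᶠ q in 𝓝 p, chartCoord φ i q = 0 → q ∈ S

/-- `p` lies on the boundary face `{φ_i = 0}` of `M` and this face is not contained in `S` near
`p`; for the regular boundary `S` this means that it belongs to a singular hyperface of `M`. -/
def SingularFace (S : Set M) (φ : OpenPartialHomeomorph M (EuclideanQuadrant (n + 1)))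
    (i : Fin (n + 1)) (p : M) : Prop :=
  p ∈ φ.source ∧ chartCoord φ i p = 0 ∧ ¬ ∀ᶠ q in 𝓝 p, chartCoord φ i q = 0 → q ∈ S

/-- The union of the singular boundary hyperfaces of `M`, i.e. of the boundary hyperfaces that are
not contained in the regular boundary `S`. Its complement is `M₀ ∪ Y₀`, the union of the interior
of `M` and the interior of the regular boundary. -/
def singularBoundary (S : Set M) : Set M :=
  {p | ∃ φ ∈ IsManifold.maximalAtlas (cornerModel (n + 1)) ∞ M, ∃ i, SingularFace S φ i p}

/-- `ι : Y → M` identifies the manifold with corners `Y` with a closed embedded hypersurface of `M`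
which is a boundary hyperface (or a disjoint union of such): around each of its points
there is a chart of `M` in which `Y` is `{x₀ = 0}`, the remaining coordinates being a chart
of `Y`. -/
structure IsBoundaryHypersurface (ι : Y → M) : Prop where
  isClosedEmbedding : IsClosedEmbedding ι
  exists_chart : ∀ y : Y,
    ∃ φ ∈ IsManifold.maximalAtlas (cornerModel (n + 1)) ∞ M,
    ∃ χ ∈ IsManifold.maximalAtlas (cornerModel n) ∞ Y,
      y ∈ χ.source ∧ χ.source = ι ⁻¹' φ.source ∧
      (∀ q ∈ φ.source, q ∈ range ι ↔ chartCoord φ 0 q = 0) ∧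
      ∀ z ∈ χ.source, ∀ i : Fin n, chartCoord φ i.succ (ι z) = chartCoord χ i z

/-- The tangent map `T_y Y → T_{ι y} M` of `ι`. -/
noncomputable def tangentIncl (ι : Y → M) (y : Y) :
    TangentSpace (cornerModel n) y →ₗ[ℝ] TangentSpace (cornerModel (n + 1)) (ι y) :=
  (mfderiv (cornerModel n) (cornerModel (n + 1)) ι y).toLinearMap

/-- A smooth function on `M` with zero set the hypersurface `Y` and with
differential non-vanishing at `Y`. -/
structure IsBoundaryDefiningFunction (ι : Y → M) (ρ : M → ℝ) : Prop where
  contMDiff : ContMDiff (cornerModel (n + 1)) 𝓘(ℝ, ℝ) ∞ ρ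
  zero_iff : ∀ p, ρ p = 0 ↔ p ∈ range ι
  mfderiv_ne_zero : ∀ y, mfderiv (cornerModel (n + 1)) 𝓘(ℝ, ℝ) ρ (ι y) ≠ 0

end Corners

/-! ### Lie manifolds with boundary -/

section Lie

variable {n : ℕ} {M : Type*} [TopologicalSpace M] [ChartedSpace (EuclideanQuadrant (n + 1)) M]
  {Y : Type*} [TopologicalSpace Y] [ChartedSpace (EuclideanQuadrant n) Y]
  (F : Type*) [NormedAddCommGroup F] [NormedSpace ℝ F]
  {A : M → Type*} [TopologicalSpace (Bundle.TotalSpace F A)] [∀ p, TopologicalSpace (A p)]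
  [∀ p, AddCommGroup (A p)] [∀ p, Module ℝ (A p)]

/-- The space `𝒱` of vector fields on `M` of the form `ϱ ∘ s`, where `s` is a smooth section of the
vector bundle `A` and `ϱ : A → TM` is the anchor. -/
def structureVectorFields [FiberBundle F A]
    (ϱ : ∀ p : M, A p →ₗ[ℝ] TangentSpace (cornerModel (n + 1)) p) :
    Set (∀ p : M, TangentSpace (cornerModel (n + 1)) p) :=
  {X | ∃ s : ∀ p, A p,
    ContMDiff (cornerModel (n + 1)) ((cornerModel (n + 1)).prod 𝓘(ℝ, F)) ∞
      (fun p => (⟨p, s p⟩ : Bundle.TotalSpace F A)) ∧ X = fun p => ϱ p (s p)}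

/-- `(M, A, 𝒱)`, with `𝒱 = ϱ(Γ(A))`, is a Lie manifold with boundary `Y ⊆ M` (`Y` is
included by `ι`): `Y` is a boundary hypersurface of `M`, the anchor `ϱ : A → TM` is a smooth
bundle map, `𝒱` is a Lie algebra of vector fields that are tangent to all singular boundary
hyperfaces (those other than `Y`), `ϱ` is an isomorphism off the singular boundary,
and `Y` is transverse to `𝒱` at the singular boundary.

As the anchor is injective over a dense set, `Γ(A) ≅ 𝒱`; so `A` is the bundle that belongs to the
projective module `𝒱`, and the bracket of `𝒱` makes it a Lie algebroid. -/
structure IsLieManifoldWithBoundary [IsManifold (cornerModel (n + 1)) ∞ M] [FiberBundle F A]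
    (ϱ : ∀ p : M, A p →ₗ[ℝ] TangentSpace (cornerModel (n + 1)) p) (ι : Y → M) : Prop where
  hypersurface : IsBoundaryHypersurface (n := n) ι
  contMDiff_anchor :
    ContMDiff ((cornerModel (n + 1)).prod 𝓘(ℝ, F)) (cornerModel (n + 1)).tangent ∞
      (fun a : Bundle.TotalSpace F A =>
        (⟨a.1, ϱ a.1 a.2⟩ : TangentBundle (cornerModel (n + 1)) M))
  lieBracket_mem : ∀ X ∈ structureVectorFields F ϱ, ∀ Z ∈ structureVectorFields F ϱ,
    VectorField.mlieBracket (cornerModel (n + 1)) X Z ∈ structureVectorFields F ϱ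
  tangent_singular : ∀ φ ∈ IsManifold.maximalAtlas (cornerModel (n + 1)) ∞ M, ∀ i p,
    SingularFace (range ι) φ i p → ∀ a : A p,
      mfderiv (cornerModel (n + 1)) 𝓘(ℝ, ℝ) (chartCoord φ i) p (ϱ p a) = (0 : ℝ)
  bijective_anchor : ∀ p, p ∉ singularBoundary (n := n) (range ι) → Function.Bijective (ϱ p)
  transverse : ∀ y, ι y ∈ singularBoundary (n := n) (range ι) →
    LinearMap.range (ϱ (ι y)) ⊔ LinearMap.range (tangentIncl (n := n) ι y) = ⊤

end Lie

section Boundary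

variable {n : ℕ} {M : Type*} [TopologicalSpace M] [ChartedSpace (EuclideanQuadrant (n + 1)) M]
  {Y : Type*} [TopologicalSpace Y] [ChartedSpace (EuclideanQuadrant n) Y]
  {A : M → Type*} [∀ p, AddCommGroup (A p)] [∀ p, Module ℝ (A p)]

/-- The fibre `B_y = {a ∈ A_y : ϱ(a) ∈ T_y Y}` of the Lie subalgebroid `B ⊆ A|_Y` of the Lie
submanifold `(Y, B, 𝒲)`, whose sections are
`𝒲 = {V|_Y : V ∈ 𝒱, V|_Y tangent to Y}`. -/
noncomputable def boundaryAlgebroid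
    (ϱ : ∀ p : M, A p →ₗ[ℝ] TangentSpace (cornerModel (n + 1)) p) (ι : Y → M) (y : Y) :
    Submodule ℝ (A (ι y)) :=
  (LinearMap.range (tangentIncl (n := n) ι y)).comap (ϱ (ι y))

/-- The inverse `T_y Y → B_y` of the anchor of `B`, for `y` in the interior of `Y`. -/
noncomputable def boundaryAnchorInv
    (ϱ : ∀ p : M, A p →ₗ[ℝ] TangentSpace (cornerModel (n + 1)) p) (ι : Y → M) (y : Y) :
    TangentSpace (cornerModel n) y →ₗ[ℝ] boundaryAlgebroid ϱ ι y :=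
  ((ϱ (ι y)).inverseOrZero ∘ₗ tangentIncl (n := n) ι y).codRestrict (boundaryAlgebroid ϱ ι y)
    (by
      intro w
      by_cases h : Function.Bijective (ϱ (ι y))
      · have : ϱ (ι y) ((ϱ (ι y)).inverseOrZero (tangentIncl (n := n) ι y w))
            = tangentIncl (n := n) ι y w := by
          rw [LinearMap.inverseOrZero, dif_pos h]
          exact (LinearEquiv.ofBijective (ϱ (ι y)) h).apply_symm_apply _
        exact ⟨w, this.symm⟩
      · simp [LinearMap.inverseOrZero, dif_neg h])

/-- The density on the tangent space `T_p M` that a density on the fibre `A_p` induces through the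
isomorphism `ϱ : A_p ≅ T_p M`, for `p` off the singular boundary. -/
noncomputable def tangentDensity
    (ϱ : ∀ p : M, A p →ₗ[ℝ] TangentSpace (cornerModel (n + 1)) p)
    (μ : ∀ p, OneDensity (n + 1) (A p)) (p : M) :
    OneDensity (n + 1) (TangentSpace (cornerModel (n + 1)) p) :=
  (μ p).comap (ϱ p).inverseOrZero

/-- The density on the tangent space `T_y Y` that a density on the fibre `B_y` induces through the
anchor `B_y ≅ T_y Y` of `B`, for `y` in the interior of `Y`. -/
noncomputable def boundaryTangentDensity
    (ϱ : ∀ p : M, A p →ₗ[ℝ] TangentSpace (cornerModel (n + 1)) p) (ι : Y → M)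
    (ν : ∀ y, OneDensity n (boundaryAlgebroid ϱ ι y)) (y : Y) :
    OneDensity n (TangentSpace (cornerModel n) y) :=
  (ν y).comap (boundaryAnchorInv ϱ ι y)

end Boundary

section Metric

variable {n : ℕ} {M : Type*} [TopologicalSpace M] [ChartedSpace (EuclideanQuadrant (n + 1)) M]
  {Y : Type*} [TopologicalSpace Y] [ChartedSpace (EuclideanQuadrant n) Y]
  {F : Type*} [NormedAddCommGroup F] [NormedSpace ℝ F]
  {A : M → Type*} [TopologicalSpace (Bundle.TotalSpace F A)] [∀ p, TopologicalSpace (A p)]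
  [∀ p, AddCommGroup (A p)] [∀ p, Module ℝ (A p)]
  [∀ p, IsTopologicalAddGroup (A p)] [∀ p, ContinuousConstSMul ℝ (A p)]
  [FiberBundle F A] [VectorBundle ℝ F A]

/-- The volume density `√(det (g(vᵢ, vⱼ)))` of an `A`-metric `g` (a smooth euclidean structure on
the bundle `A`), on `k`-dimensional subspaces of the fibre `A_p`. -/
noncomputable def gramDensity
    (g : Bundle.ContMDiffRiemannianMetric (cornerModel (n + 1)) ∞ F A) (k : ℕ) (p : M) :
    OneDensity k (A p) where
  toFun v := √(Matrix.of fun i j => g.inner p (v i) (v j)).det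
  map_matrix' P v := by
    have h : (Matrix.of fun i j : Fin k =>
          g.inner p (∑ l, P i l • v l) (∑ l, P j l • v l))
        = P * (Matrix.of fun i j => g.inner p (v i) (v j)) * P.transpose := by
      ext i j
      simp only [Matrix.of_apply, Matrix.mul_apply, Matrix.transpose_apply, map_sum, map_smul,
        sum_apply, smul_apply, smul_eq_mul,
        Finset.sum_mul, Finset.mul_sum]
      refine Finset.sum_congr rfl fun l _ => Finset.sum_congr rfl fun m _ => ?_
      ring
    rw [h, Matrix.det_mul, Matrix.det_mul, Matrix.det_transpose,
      show ∀ a b : ℝ, a * b * a = a ^ 2 * b from fun a b => by ring,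
      Real.sqrt_mul (sq_nonneg _), Real.sqrt_sq_eq_abs]

/-- The volume density `μ_g` of an `A`-metric `g` on `M`. -/
noncomputable def volumeDensity
    (g : Bundle.ContMDiffRiemannianMetric (cornerModel (n + 1)) ∞ F A) (p : M) :
    OneDensity (n + 1) (A p) :=
  gramDensity g (n + 1) p

/-- The volume density `ν` on `Y` of the `B`-metric `g_∂`, the restriction of `g` to
`B ⊆ A|_Y`. -/
noncomputable def inducedDensity
    (ϱ : ∀ p : M, A p →ₗ[ℝ] TangentSpace (cornerModel (n + 1)) p) (ι : Y → M)
    (g : Bundle.ContMDiffRiemannianMetric (cornerModel (n + 1)) ∞ F A) (y : Y) :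
    OneDensity n (boundaryAlgebroid ϱ ι y) :=
  (gramDensity g n (ι y)).comap (boundaryAlgebroid ϱ ι y).subtype

/-- `N ∈ Γ(A|_Y)` is the inward unit normal field of `Y` for the `A`-metric `g`. -/
structure IsInwardUnitNormal
    (ϱ : ∀ p : M, A p →ₗ[ℝ] TangentSpace (cornerModel (n + 1)) p) (ι : Y → M)
    (g : Bundle.ContMDiffRiemannianMetric (cornerModel (n + 1)) ∞ F A)
    (N : ∀ y, A (ι y)) : Prop where
  contMDiff : ContMDiff (cornerModel n) ((cornerModel (n + 1)).prod 𝓘(ℝ, F)) ∞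
    (fun y => (⟨ι y, N y⟩ : Bundle.TotalSpace F A))
  orthogonal : ∀ y, ∀ b ∈ boundaryAlgebroid ϱ ι y, g.inner (ι y) (N y) b = 0
  unit : ∀ y, g.inner (ι y) (N y) (N y) = 1
  inward : ∀ φ ∈ IsManifold.maximalAtlas (cornerModel (n + 1)) ∞ M, ∀ i y,
    FaceInside (range ι) φ i (ι y) →
      (0 : ℝ) < mfderiv (cornerModel (n + 1)) 𝓘(ℝ, ℝ) (chartCoord φ i) (ι y) (ϱ (ι y) (N y))

end Metric

section Tube

variable {n : ℕ} {M : Type*} [TopologicalSpace M] [ChartedSpace (EuclideanQuadrant (n + 1)) M]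
  {Y : Type*} [TopologicalSpace Y] [ChartedSpace (EuclideanQuadrant n) Y]

/-- `Φ` is a diffeomorphism from an open neighborhood of `Y` in `M` onto the manifold with corners
`[0, r) × Y` (as a subset of `ℝ × Y`). -/
structure IsCollarDiffeo (ι : Y → M) (r : ℝ) (Φ : PartialEquiv M (ℝ × Y)) : Prop where
  isOpen_source : IsOpen Φ.source
  subset_source : range ι ⊆ Φ.source
  target_eq : Φ.target = Ico 0 r ×ˢ univ
  contMDiffOn : ContMDiffOn (cornerModel (n + 1)) (𝓘(ℝ, ℝ).prod (cornerModel n)) ∞ Φ Φ.source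
  contMDiffOn_symm :
    ContMDiffOn (𝓘(ℝ, ℝ).prod (cornerModel n)) (cornerModel (n + 1)) ∞ Φ.symm Φ.target

/-- The push-forward `Φ_* μ` at the point `q` of a density `μ` on the tangent spaces of `M`:
`(Φ_* μ)_q (v₁, …) = μ_{Φ⁻¹(q)} (d(Φ⁻¹) v₁, …)`. -/
noncomputable def pushforwardDensity (Φ : PartialEquiv M (ℝ × Y))
    (μ : ∀ p : M, OneDensity (n + 1) (TangentSpace (cornerModel (n + 1)) p)) (q : ℝ × Y) :
    OneDensity (n + 1) (ℝ × TangentSpace (cornerModel n) q.2) :=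
  (μ (Φ.symm q)).comap
    (mfderivWithin (𝓘(ℝ, ℝ).prod (cornerModel n)) (cornerModel (n + 1)) Φ.symm Φ.target
      q).toLinearMap

end Tube

/-!
The collar is spanned by the integral curves of a field `ϱ s`, where the smooth section `s` of `A`
extends the normal field `N`; the remaining freedom is the speed on these curves, and it is used up
by the condition that the density be constant along them.

*Straightening.* Near a point of `Y`, the field `ϱ s` points inwards at `Y` and is tangent to the
other faces of the quadrant. Its flow therefore exists in the quadrant, is smooth up to the boundary
(`exists_smooth_flow`, by `IsFlowOn.contDiffOn`), and gives a parametrization of `M` whose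
`x₀`-lines are integral curves (`IsLieManifoldWithBoundary.exists_boundaryParam_flow`).

*Normal form.* The density of `M` is singular at the singular boundary, but its logarithmic
derivative along the `x₀`-lines is not. Write the fields `ϱ σ₀, …, ϱ σ_n` of a frame of `A` in the
coordinates. As `𝒱` is closed under brackets, the bracket of `ϱ s` with these fields is a combination
of them with smooth coefficients; so by Liouville's formula the determinant of the frame grows along
the lines by a smooth positive factor, also where it vanishes
(`IsLieManifoldWithBoundary.det_frameMatrix_eq`). The change of the density along the lines is
compensated by a smooth change of the parameter on the lines, normalized to have `∂_{x₀} = ϱ s` at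
`Y`. The result is called a normal form (`IsLieManifoldWithBoundary.exists_normalParam`).

*Uniqueness.* A transition map between normal forms maps `x₀`-lines to `x₀`-lines. Off the singular
boundary the density determines the parameter on the lines, and the points off the singular boundary
are dense; so two normal forms have the same first coordinate `u` and the same projection to `Y` near
their common points in `Y` (`NormalParam.eventually_eq`).

*Collar.* By compactness of `Y` the maps `(u, ψ)` glue to a map on a neighborhood of `Y`
(`IsCompact.exists_glue`). It is a local diffeomorphism and injective on `Y`, hence injective near
`Y`, and its image contains some `[0, r) × Y` (`IsBoundaryHypersurface.exists_collar`). The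
derivatives along `Y` follow from `∂_{x₀} = ϱ s`. For the density, it suffices by construction to
compare both sides at `u = 0`, where the Gram determinant splits into the normal and the tangential
part (`NormalParam.tangentDensity_cons`).
-/

/-! ### Linear differential equations with parameters -/

section Volterra

variable {X : Type*} [NormedAddCommGroup X] [NormedSpace ℝ X]

/-- The integration operator `φ ↦ (t ↦ ∫₀ᵗ φ)` on continuous functions on `[0, 1]`. -/
noncomputable def volterra (X : Type*) [NormedAddCommGroup X] [NormedSpace ℝ X] :
    C(Icc (0 : ℝ) 1, X) →L[ℝ] C(Icc (0 : ℝ) 1, X) :=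
  LinearMap.mkContinuous
    { toFun := fun φ =>
        { toFun := fun t => ∫ s in (0 : ℝ)..t, IccExtend zero_le_one φ s
          continuous_toFun :=
            (intervalIntegral.continuous_primitive
              (fun a b => (φ.continuous.Icc_extend' ).intervalIntegrable a b) 0).comp
              continuous_subtype_val }
      map_add' := fun φ ψ => by
        ext t
        have h : ∀ φ : C(Icc (0 : ℝ) 1, X), IntervalIntegrable (IccExtend zero_le_one φ)
          MeasureTheory.volume 0 t := fun φ => (φ.continuous.Icc_extend').intervalIntegrable _ _
        exact intervalIntegral.integral_add (h φ) (h ψ)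
      map_smul' := fun c φ => by
        ext t
        exact intervalIntegral.integral_smul c (IccExtend zero_le_one φ) }
    1 (fun φ => by
      rw [one_mul]
      refine (ContinuousMap.norm_le _ (norm_nonneg φ)).2 fun t => ?_
      have := intervalIntegral.norm_integral_le_of_norm_le_const (a := (0 : ℝ)) (b := t)
        (f := IccExtend zero_le_one φ) (C := ‖φ‖) (fun s _ => φ.norm_coe_le_norm _)
      refine this.trans ?_
      rw [sub_zero, abs_of_nonneg t.2.1]
      exact mul_le_of_le_one_right (norm_nonneg φ) t.2.2)

end Volterra

section Neumann

variable {B : Type*} [NormedAddCommGroup B] [NormedSpace ℝ B] [CompleteSpace B]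

/-- `1 - K` is a factor of the invertible operator `1 - K ^ k`. -/
theorem isUnit_one_sub_of_norm_pow_lt_one {K : B →L[ℝ] B} {k : ℕ} (hn : ‖K ^ k‖ < 1) :
    IsUnit (1 - K) := by
  have hu := isUnit_one_sub_of_norm_lt_one hn
  rw [← mul_neg_geom_sum] at hu
  have hc : Commute (1 - K) (∑ i ∈ Finset.range k, K ^ i) :=
    Commute.sum_right _ _ _ fun i _ =>
      ((Commute.one_left _).sub_left (Commute.refl _)).pow_right i
  exact (hc.isUnit_mul_iff.1 hu).1

/-- The solution of `j = b + K j` depends continuously on `K`, because inversion of operators is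
continuous. -/
theorem exists_continuous_fixed_point {P : Type*} [TopologicalSpace P] {K : P → B →L[ℝ] B}
    (hK : Continuous K) (hu : ∀ p, IsUnit (1 - K p)) (b : B) :
    ∃ j : P → B, Continuous j ∧ ∀ p, j p = b + K p (j p) := by
  refine ⟨fun p => Ring.inverse (1 - K p) b, ?_, fun p => ?_⟩
  · refine Continuous.clm_apply (continuous_iff_continuousAt.2 fun p => ?_) continuous_const
    obtain ⟨v, hv⟩ := hu p
    have h1 : ContinuousAt (fun p => 1 - K p) p := (continuous_const.sub hK).continuousAt
    have h2 := NormedRing.inverse_continuousAt v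
    rw [hv] at h2
    exact ContinuousAt.comp (f := fun p => 1 - K p) h2 h1
  · have h1 := Ring.mul_inverse_cancel _ (hu p)
    have h2 := congrArg (fun L => L b) h1
    rw [← sub_eq_iff_eq_add]
    exact h2

end Neumann

section LinearFlow

variable {Z X : Type*} [NormedAddCommGroup Z] [NormedSpace ℝ Z] [NormedAddCommGroup X]
  [NormedSpace ℝ X]

/-- The operator `φ ↦ (t ↦ b (A t) (φ t))` on continuous functions on `[0, 1]`. -/
noncomputable def pointwiseBilin (b : Z →L[ℝ] X →L[ℝ] X) (A : C(Icc (0 : ℝ) 1, Z)) :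
    C(Icc (0 : ℝ) 1, X) →L[ℝ] C(Icc (0 : ℝ) 1, X) :=
  LinearMap.mkContinuous
    { toFun := fun φ => { toFun := fun t => b (A t) (φ t), continuous_toFun := by fun_prop }
      map_add' := fun φ ψ => by ext t; exact map_add (b (A t)) _ _
      map_smul' := fun c φ => by ext t; exact map_smul (b (A t)) _ _ }
    (‖b‖ * ‖A‖) (fun φ => by
      refine (ContinuousMap.norm_le _ (by positivity)).2 fun t => ?_
      refine (b.le_opNorm₂ (A t) (φ t)).trans ?_
      gcongr
      · exact A.norm_coe_le_norm _
      · exact φ.norm_coe_le_norm _)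

theorem pointwiseBilin_apply (b : Z →L[ℝ] X →L[ℝ] X) (A : C(Icc (0 : ℝ) 1, Z))
    (φ : C(Icc (0 : ℝ) 1, X)) (t : Icc (0 : ℝ) 1) :
    pointwiseBilin b A φ t = b (A t) (φ t) := rfl

set_option synthInstance.maxHeartbeats 200000 in
theorem continuous_pointwiseBilin (b : Z →L[ℝ] X →L[ℝ] X) : Continuous (pointwiseBilin b) := by
  have h : LipschitzWith ‖b‖₊ (pointwiseBilin b) := by
    refine LipschitzWith.of_dist_le_mul fun A A' => ?_
    rw [dist_eq_norm, dist_eq_norm]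
    refine ContinuousLinearMap.opNorm_le_bound _ (by positivity) fun φ => ?_
    refine (ContinuousMap.norm_le _ (by positivity)).2 fun t => ?_
    have h1 : (pointwiseBilin b A - pointwiseBilin b A') φ t = b ((A - A') t) (φ t) := by
      rw [ContinuousMap.sub_apply, map_sub]; rfl
    rw [h1]
    refine (b.le_opNorm₂ _ (φ t)).trans ?_
    rw [coe_nnnorm]
    gcongr
    · exact (A - A').norm_coe_le_norm _
    · exact φ.norm_coe_le_norm _
  exact h.continuous

/-- The integral operator `φ ↦ (t ↦ ∫₀ᵗ b A φ)` of the linear equation `φ' = b A φ` on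
`[0, 1]`. -/
noncomputable def linearVolterra (b : Z →L[ℝ] X →L[ℝ] X) (A : C(Icc (0 : ℝ) 1, Z)) :
    C(Icc (0 : ℝ) 1, X) →L[ℝ] C(Icc (0 : ℝ) 1, X) :=
  (volterra X).comp (pointwiseBilin b A)

theorem linearVolterra_apply (b : Z →L[ℝ] X →L[ℝ] X) (A : C(Icc (0 : ℝ) 1, Z))
    (φ : C(Icc (0 : ℝ) 1, X)) (t : Icc (0 : ℝ) 1) :
    linearVolterra b A φ t
      = ∫ s in (0 : ℝ)..t, IccExtend zero_le_one (pointwiseBilin b A φ) s := rfl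

theorem continuous_linearVolterra (b : Z →L[ℝ] X →L[ℝ] X) : Continuous (linearVolterra b) :=
  (ContinuousLinearMap.compL ℝ _ _ _ (volterra X)).continuous.comp (continuous_pointwiseBilin b)

/-- Every iteration of the integral operator contributes one more integration of a power of `t`;
this is the source of the factorial, which makes a power of the operator a contraction. -/
theorem norm_linearVolterra_pow_apply_le (b : Z →L[ℝ] X →L[ℝ] X) (A : C(Icc (0 : ℝ) 1, Z))
    (φ : C(Icc (0 : ℝ) 1, X)) (k : ℕ) (t : Icc (0 : ℝ) 1) :
    ‖(linearVolterra b A ^ k) φ t‖ ≤ (‖b‖ * ‖A‖ * t) ^ k / k.factorial * ‖φ‖ := by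
  induction k generalizing t with
  | zero => simpa using φ.norm_coe_le_norm t
  | succ k ih =>
    rw [pow_succ', mul_apply_eq_comp, linearVolterra_apply]
    have hb : ∀ s ∈ Ioc (0 : ℝ) t,
        ‖IccExtend zero_le_one (pointwiseBilin b A ((linearVolterra b A ^ k) φ)) s‖
          ≤ ‖b‖ * ‖A‖ * ((‖b‖ * ‖A‖ * s) ^ k / k.factorial * ‖φ‖) := by
      intro s hs
      have hs1 : s ∈ Icc (0 : ℝ) 1 := ⟨hs.1.le, hs.2.trans t.2.2⟩
      rw [IccExtend_of_mem _ _ hs1, pointwiseBilin_apply]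
      refine (b.le_opNorm₂ _ _).trans ?_
      gcongr
      · exact A.norm_coe_le_norm _
      · exact ih ⟨s, hs1⟩
    refine (intervalIntegral.norm_integral_le_of_norm_le t.2.1
      (Filter.Eventually.of_forall hb) ?_).trans (le_of_eq ?_)
    · apply Continuous.intervalIntegrable; fun_prop
    · have : ∀ s : ℝ, ‖b‖ * ‖A‖ * ((‖b‖ * ‖A‖ * s) ^ k / k.factorial * ‖φ‖)
          = ((‖b‖ * ‖A‖) ^ (k + 1) / k.factorial * ‖φ‖) * s ^ k := fun s => by
        rw [mul_pow _ s]; ring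
      simp_rw [this]
      rw [intervalIntegral.integral_const_mul, integral_pow, Nat.factorial_succ]
      have h1 : ((k : ℝ) + 1) ≠ 0 := by positivity
      have h2 : (k.factorial : ℝ) ≠ 0 := by positivity
      push_cast
      field_simp
      ring

theorem isUnit_one_sub_linearVolterra [CompleteSpace X] (b : Z →L[ℝ] X →L[ℝ] X)
    (A : C(Icc (0 : ℝ) 1, Z)) : IsUnit (1 - linearVolterra b A) := by
  obtain ⟨k, hk⟩ : ∃ k : ℕ, (‖b‖ * ‖A‖) ^ k / k.factorial < 1 :=
    ((FloorSemiring.tendsto_pow_div_factorial_atTop (‖b‖ * ‖A‖)).eventually_lt_const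
      one_pos).exists
  have hn : ‖linearVolterra b A ^ k‖ < 1 := by
    refine lt_of_le_of_lt (ContinuousLinearMap.opNorm_le_bound _ (by positivity) fun φ => ?_) hk
    refine (ContinuousMap.norm_le _ (by positivity)).2 fun t => ?_
    refine (norm_linearVolterra_pow_apply_le b A φ k t).trans ?_
    have h1 : ‖b‖ * ‖A‖ * t ≤ ‖b‖ * ‖A‖ := mul_le_of_le_one_right (by positivity) t.2.2
    have h0 : 0 ≤ ‖b‖ * ‖A‖ * t := mul_nonneg (by positivity) t.2.1
    gcongr
  exact isUnit_one_sub_of_norm_pow_lt_one hn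

/-- A family of linear differential equations `φ' = b A φ` on `[0, 1]` whose coefficients depend
continuously on a parameter has solutions that depend continuously on it. -/
theorem exists_linear_flow [CompleteSpace X] (b : Z →L[ℝ] X →L[ℝ] X) {P : Type*}
    [TopologicalSpace P] {A : Icc (0 : ℝ) 1 × P → Z} (hA : Continuous A) (x₀ : X) :
    ∃ J : ℝ × P → X, Continuous J ∧ (∀ p, J (0, p) = x₀) ∧
      ∀ p, ∀ t, ∀ ht : t ∈ Icc (0 : ℝ) 1,
        HasDerivWithinAt (fun t => J (t, p)) (b (A (⟨t, ht⟩, p)) (J (t, p))) (Icc 0 1) t := by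
  -- the coefficients as a continuous family of curves; `j p` is the solution with parameter `p`
  let a : C(P, C(Icc (0 : ℝ) 1, Z)) :=
    ContinuousMap.curry ⟨fun q : P × Icc (0 : ℝ) 1 => A (q.2, q.1), by fun_prop⟩
  let x₁ : C(Icc (0 : ℝ) 1, X) := ContinuousMap.const _ x₀
  obtain ⟨j, hj, hfix⟩ := exists_continuous_fixed_point
    ((continuous_linearVolterra b).comp a.continuous)
    (fun p => isUnit_one_sub_linearVolterra b (a p)) x₁
  have hfix' : ∀ p, ∀ t : Icc (0 : ℝ) 1, j p t
      = x₀ + ∫ s in (0 : ℝ)..t, IccExtend zero_le_one (pointwiseBilin b (a p) (j p)) s :=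
    fun p t => congrArg (fun φ => φ t) (hfix p)
  have hJ : Continuous (fun q : ℝ × P => j q.2 (projIcc 0 1 zero_le_one q.1)) := by
    have h := ContinuousMap.continuous_uncurry_of_continuous ⟨j, hj⟩
    exact h.comp (continuous_snd.prodMk ((continuous_projIcc (h := zero_le_one)).comp
      continuous_fst))
  refine ⟨_, hJ, fun p => ?_, fun p t ht => ?_⟩
  · have h0 : projIcc (0 : ℝ) 1 zero_le_one 0 = ⟨0, left_mem_Icc.2 zero_le_one⟩ :=
      projIcc_of_mem zero_le_one (left_mem_Icc.2 zero_le_one)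
    simp only [h0, hfix', intervalIntegral.integral_same, add_zero]
  · have hcont : Continuous (IccExtend zero_le_one (pointwiseBilin b (a p) (j p))) :=
      (pointwiseBilin b (a p) (j p)).continuous.Icc_extend'
    have hd : HasDerivAt
        (fun t => x₀ + ∫ s in (0 : ℝ)..t, IccExtend zero_le_one (pointwiseBilin b (a p) (j p)) s)
        (IccExtend zero_le_one (pointwiseBilin b (a p) (j p)) t) t :=
      (intervalIntegral.integral_hasDerivAt_right (hcont.intervalIntegrable _ _)
        (hcont.stronglyMeasurableAtFilter _ _) hcont.continuousAt).const_add x₀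
    have hv : ∀ s ∈ Icc (0 : ℝ) 1, j p (projIcc 0 1 zero_le_one s)
        = x₀ + ∫ s in (0 : ℝ)..s, IccExtend zero_le_one (pointwiseBilin b (a p) (j p)) s := by
      intro s hs
      rw [projIcc_of_mem zero_le_one hs, hfix']
    have := (hd.hasDerivWithinAt (s := Icc 0 1)).congr_of_mem hv ht
    convert this using 1
    rw [IccExtend_of_mem _ _ ht, pointwiseBilin_apply, projIcc_of_mem zero_le_one ht]
    rfl

end LinearFlow

/-! ### Smooth dependence of flows on initial values -/

section SmoothDependence

universe v

variable {E : Type v} [NormedAddCommGroup E] [NormedSpace ℝ E]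

/-- A family `γ(·, x) : [0, 1] → K`, `x ∈ U`, of solutions of `γ' = f(γ)`, `γ(0, x) = x`,
depending continuously on `x`. -/
structure IsFlowOn (f : E → E) (K U : Set E) (γ : ℝ × E → E) : Prop where
  continuousOn : ContinuousOn γ (Icc 0 1 ×ˢ U)
  mapsTo : MapsTo γ (Icc 0 1 ×ˢ U) K
  initial : ∀ x ∈ U, γ (0, x) = x
  deriv : ∀ x ∈ U, ∀ t ∈ Icc (0 : ℝ) 1,
    HasDerivWithinAt (fun t => γ (t, x)) (f (γ (t, x))) (Icc 0 1) t

/-- The mean derivative of `f` on the segment from `x` to `x'`. -/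
noncomputable def segmentDeriv (f : E → E) (K : Set E) (x x' : E) : E →L[ℝ] E :=
  ∫ s in (0 : ℝ)..1, fderivWithin ℝ f K (x + (projIcc (0 : ℝ) 1 zero_le_one s : ℝ) • (x' - x))

theorem segment_mem {K : Set E} (hK : Convex ℝ K) {x x' : E} (hx : x ∈ K) (hx' : x' ∈ K)
    {s : ℝ} (hs : s ∈ Icc (0 : ℝ) 1) : x + s • (x' - x) ∈ K :=
  hK.add_smul_sub_mem hx hx' hs

theorem segmentDeriv_self [CompleteSpace E] (f : E → E) (K : Set E) (x : E) :
    segmentDeriv f K x x = fderivWithin ℝ f K x := by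
  simp [segmentDeriv]

theorem continuous_segmentDeriv {f : E → E} {K : Set E} (hK : Convex ℝ K)
    (hD : ContinuousOn (fderivWithin ℝ f K) K) {P : Type*} [TopologicalSpace P] {a b : P → E}
    (ha : Continuous a) (hb : Continuous b) (haK : ∀ p, a p ∈ K) (hbK : ∀ p, b p ∈ K) :
    Continuous fun p => segmentDeriv f K (a p) (b p) := by
  refine intervalIntegral.continuous_parametric_intervalIntegral_of_continuous
    (f := fun p s => fderivWithin ℝ f K
      (a p + (projIcc (0 : ℝ) 1 zero_le_one s : ℝ) • (b p - a p))) ?_ continuous_const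
  have hproj : Continuous (fun s : ℝ => (projIcc (0 : ℝ) 1 zero_le_one s : ℝ)) :=
    continuous_subtype_val.comp continuous_projIcc
  refine hD.comp_continuous (f := fun q : P × ℝ =>
    a q.1 + (projIcc (0 : ℝ) 1 zero_le_one q.2 : ℝ) • (b q.1 - a q.1)) ?_ fun q =>
      segment_mem hK (haK _) (hbK _) (projIcc (0 : ℝ) 1 zero_le_one q.2).2
  exact (ha.comp continuous_fst).add ((hproj.comp continuous_snd).smul
    ((hb.comp continuous_fst).sub (ha.comp continuous_fst)))

/-- Hadamard's form of the mean value theorem. -/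
theorem segmentDeriv_apply [CompleteSpace E] {f : E → E} {K : Set E} (hK : Convex ℝ K)
    (hf : DifferentiableOn ℝ f K) (hD : ContinuousOn (fderivWithin ℝ f K) K) {x x' : E}
    (hx : x ∈ K) (hx' : x' ∈ K) : segmentDeriv f K x x' (x' - x) = f x' - f x := by
  have hproj : Continuous (fun s : ℝ => (projIcc (0 : ℝ) 1 zero_le_one s : ℝ)) :=
    continuous_subtype_val.comp continuous_projIcc
  have hc : Continuous fun s : ℝ => fderivWithin ℝ f K
      (x + (projIcc (0 : ℝ) 1 zero_le_one s : ℝ) • (x' - x)) :=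
    hD.comp_continuous (continuous_const.add (hproj.smul continuous_const)) fun s =>
      segment_mem hK hx hx' (projIcc (0 : ℝ) 1 zero_le_one s).2
  rw [segmentDeriv, ContinuousLinearMap.intervalIntegral_apply (hc.intervalIntegrable _ _)]
  have hderiv : ∀ s ∈ Ioo (0 : ℝ) 1, HasDerivAt (fun s : ℝ => f (x + s • (x' - x)))
      (fderivWithin ℝ f K (x + (projIcc (0 : ℝ) 1 zero_le_one s : ℝ) • (x' - x)) (x' - x)) s := by
    intro s hs
    have hs' : s ∈ Icc (0 : ℝ) 1 := Ioo_subset_Icc_self hs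
    rw [projIcc_of_mem zero_le_one hs']
    have hl : HasDerivWithinAt (fun s : ℝ => x + s • (x' - x)) (x' - x) (Icc 0 1) s := by
      simpa using (((hasDerivAt_id s).smul_const (x' - x)).const_add x).hasDerivWithinAt
    have := (hf _ (segment_mem hK hx hx' hs')).hasFDerivWithinAt.comp_hasDerivWithinAt s hl
      (fun s hs => segment_mem hK hx hx' hs)
    exact this.hasDerivAt (Icc_mem_nhds hs.1 hs.2)
  have := intervalIntegral.integral_eq_sub_of_hasDerivAt_of_le (f := fun s : ℝ =>
    f (x + s • (x' - x))) zero_le_one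
    (hf.continuousOn.comp (by fun_prop) fun s hs => segment_mem hK hx hx' hs) hderiv
    ((hc.clm_apply continuous_const).intervalIntegrable _ _)
  simpa using this

/-- Uniqueness for linear equations. -/
theorem eqOn_of_linear_ode {A : ℝ → E →L[ℝ] E} (hA : ContinuousOn A (Icc 0 1)) {φ ψ : ℝ → E}
    (hφ : ∀ t ∈ Icc (0 : ℝ) 1, HasDerivWithinAt φ (A t (φ t)) (Icc 0 1) t)
    (hψ : ∀ t ∈ Icc (0 : ℝ) 1, HasDerivWithinAt ψ (A t (ψ t)) (Icc 0 1) t) (h0 : φ 0 = ψ 0) :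
    EqOn φ ψ (Icc 0 1) := by
  obtain ⟨C, hC⟩ := isCompact_Icc.exists_bound_of_continuousOn hA
  refine ODE_solution_unique_of_mem_Icc_right (v := fun t x => A t x) (s := fun _ => univ)
    (K := C.toNNReal) (fun t ht => ?_) (fun t ht => (hφ t ht).continuousWithinAt)
    (fun t ht => ?_) (fun _ _ => mem_univ _) (fun t ht => (hψ t ht).continuousWithinAt)
    (fun t ht => ?_) (fun _ _ => mem_univ _) h0
  · refine ((A t).lipschitz.weaken ?_).lipschitzOnWith
    rw [← NNReal.coe_le_coe, coe_nnnorm]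
    exact (hC t (Ico_subset_Icc_self ht)).trans (Real.le_coe_toNNReal C)
  · exact (hφ t (Ico_subset_Icc_self ht)).mono_of_mem_nhdsWithin
      (Icc_mem_nhdsGE_of_mem ht)
  · exact (hψ t (Ico_subset_Icc_self ht)).mono_of_mem_nhdsWithin
      (Icc_mem_nhdsGE_of_mem ht)

/-- The derivative of a flow in the initial value is a solution of the variational equation. -/
theorem IsFlowOn.exists_hasFDerivWithinAt [CompleteSpace E] {f : E → E} {K U : Set E}
    {γ : ℝ × E → E} (h : IsFlowOn f K U γ) (hK : Convex ℝ K)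
    (hf : DifferentiableOn ℝ f K) (hD : ContinuousOn (fderivWithin ℝ f K) K) :
    ∃ J : ℝ × E → E →L[ℝ] E, ContinuousOn J (Icc 0 1 ×ˢ U) ∧ (∀ x ∈ U, J (0, x) = 1) ∧
      (∀ x ∈ U, ∀ t ∈ Icc (0 : ℝ) 1, HasDerivWithinAt (fun t => J (t, x))
        ((fderivWithin ℝ f K (γ (t, x))).comp (J (t, x))) (Icc 0 1) t) ∧
      ∀ x ∈ U, ∀ t ∈ Icc (0 : ℝ) 1, HasFDerivWithinAt γ
        ((ContinuousLinearMap.fst ℝ ℝ E).smulRight (f (γ (t, x))) +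
          (J (t, x)).comp (ContinuousLinearMap.snd ℝ ℝ E)) (Icc 0 1 ×ˢ U) (t, x) := by
  classical
  -- The difference of two solutions solves a linear equation whose coefficients are the mean
  -- derivatives of `f` between them. Its solution operator `J` depends continuously on the pair of
  -- initial values; on the diagonal it is the derivative of the flow.
  let P := U × U
  let A : Icc (0 : ℝ) 1 × P → E →L[ℝ] E := fun q =>
    segmentDeriv f K (γ (q.1, q.2.1)) (γ (q.1, q.2.2))
  have hγ1 : ∀ u : P → U, Continuous u → Continuous fun q : Icc (0 : ℝ) 1 × P => γ (q.1, u q.2) :=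
    fun u hu => h.continuousOn.comp_continuous (by fun_prop) fun q => ⟨q.1.2, (u q.2).2⟩
  have hA : Continuous A := continuous_segmentDeriv hK hD (hγ1 Prod.fst continuous_fst)
    (hγ1 Prod.snd continuous_snd) (fun q => h.mapsTo ⟨q.1.2, q.2.1.2⟩)
    (fun q => h.mapsTo ⟨q.1.2, q.2.2.2⟩)
  obtain ⟨J, hJc, hJ0, hJd⟩ := exists_linear_flow (ContinuousLinearMap.compL ℝ E E E) hA 1
  have hdiff : ∀ x x' : U, ∀ t ∈ Icc (0 : ℝ) 1,
      γ (t, x') - γ (t, x) = J (t, x, x') ((x' : E) - x) := by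
    intro x x'
    have hAc : ContinuousOn (fun t : ℝ => segmentDeriv f K (γ (t, x)) (γ (t, x'))) (Icc 0 1) := by
      rw [continuousOn_iff_continuous_domRestrict]
      exact hA.comp (f := fun t : Icc (0 : ℝ) 1 => (t, ((x, x') : P))) (by fun_prop)
    refine eqOn_of_linear_ode (φ := fun t => γ (t, x') - γ (t, x))
      (ψ := fun t => J (t, x, x') ((x' : E) - x)) hAc (fun t ht => ?_) (fun t ht => ?_) ?_
    · rw [segmentDeriv_apply hK hf hD (h.mapsTo ⟨ht, x.2⟩) (h.mapsTo ⟨ht, x'.2⟩)]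
      exact (h.deriv x' x'.2 t ht).sub (h.deriv x x.2 t ht)
    · exact (ContinuousLinearMap.apply ℝ E ((x' : E) - x)).hasFDerivAt.comp_hasDerivWithinAt t
        (hJd (x, x') t ht)
    · simp [h.initial x x.2, h.initial x' x'.2, hJ0]
  let J' : ℝ × E → E →L[ℝ] E := fun q => if hq : q.2 ∈ U then J (q.1, ⟨q.2, hq⟩, ⟨q.2, hq⟩) else 0
  have hJ' : ∀ t, ∀ x, ∀ hx : x ∈ U, J' (t, x) = J (t, ⟨x, hx⟩, ⟨x, hx⟩) := fun t x hx => dif_pos hx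
  refine ⟨J', ?_, fun x hx => by rw [hJ' _ _ hx, hJ0], fun x hx t ht => ?_, fun x hx t ht => ?_⟩
  · rw [continuousOn_iff_continuous_domRestrict]
    refine (hJc.comp (f := fun q : ↥(Icc (0 : ℝ) 1 ×ˢ U) =>
      (q.1.1, ((⟨q.1.2, q.2.2⟩, ⟨q.1.2, q.2.2⟩) : P))) (by fun_prop)).congr fun q => ?_
    exact (hJ' _ _ q.2.2).symm
  · have := hJd (⟨x, hx⟩, ⟨x, hx⟩) t ht
    rw [show A (⟨t, ht⟩, ⟨x, hx⟩, ⟨x, hx⟩) = fderivWithin ℝ f K (γ (t, x)) from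
      segmentDeriv_self _ _ _] at this
    simp only [hJ' _ _ hx]
    exact this
  · -- `γ (q.1, q.2) = J (q.1, x, q.2) (q.2 - x) + γ (q.1, x)`, where `J` may be replaced by its
    -- value at the base point with an error of order `o(q - (t, x))`
    have hsplit : ∀ q ∈ Icc (0 : ℝ) 1 ×ˢ U, γ q =
        (if hq : q.2 ∈ U then J (q.1, ⟨x, hx⟩, ⟨q.2, hq⟩) else 0) (q.2 - x) + γ (q.1, x) := by
      intro q hq
      have := hdiff ⟨x, hx⟩ ⟨q.2, hq.2⟩ q.1 hq.1
      rw [dif_pos (show q.2 ∈ U from hq.2), ← this]; simp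
    have h1 : HasFDerivWithinAt (fun q : ℝ × E => γ (q.1, x))
        ((ContinuousLinearMap.fst ℝ ℝ E).smulRight (f (γ (t, x)))) (Icc 0 1 ×ˢ U) (t, x) := by
      have := (h.deriv x hx t ht).hasFDerivWithinAt.comp (t, x)
        (hasFDerivWithinAt_fst (𝕜 := ℝ) (p := (t, x)) (s := Icc (0 : ℝ) 1 ×ˢ U)) fun q hq => hq.1
      exact this.congr_fderiv (by ext <;> simp)
    have h2 : HasFDerivWithinAt (fun q : ℝ × E =>
        (if hq : q.2 ∈ U then J (q.1, ⟨x, hx⟩, ⟨q.2, hq⟩) else 0) (q.2 - x))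
        ((J' (t, x)).comp (ContinuousLinearMap.snd ℝ ℝ E)) (Icc 0 1 ×ˢ U) (t, x) := by
      set Θ : ℝ × E → E →L[ℝ] E := fun q =>
        if hq : q.2 ∈ U then J (q.1, ⟨x, hx⟩, ⟨q.2, hq⟩) else 0 with hΘ
      have hΘc : ContinuousWithinAt Θ (Icc 0 1 ×ˢ U) (t, x) := by
        have : ContinuousOn Θ (Icc 0 1 ×ˢ U) := by
          rw [continuousOn_iff_continuous_domRestrict]
          refine (hJc.comp (f := fun q : ↥(Icc (0 : ℝ) 1 ×ˢ U) =>
            (q.1.1, ((⟨x, hx⟩, ⟨q.1.2, q.2.2⟩) : P))) (by fun_prop)).congr fun q => ?_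
          have hq : q.1.2 ∈ U := q.2.2
          simp [hΘ, hq]
        exact this _ ⟨ht, hx⟩
      have hΘx : Θ (t, x) = J' (t, x) := by simp only [hΘ, hJ' _ _ hx]; rw [dif_pos hx]
      rw [hasFDerivWithinAt_iff_isLittleO]
      rw [← hΘx]
      have hz : (fun q : ℝ × E => Θ q (q.2 - x) - Θ (t, x) ((t, x).2 - x) -
          (Θ (t, x)).comp (ContinuousLinearMap.snd ℝ ℝ E) (q - (t, x)))
          = fun q => (Θ q - Θ (t, x)) (q.2 - x) := by
        funext q; simp
      rw [hz]
      have ho : (fun q : ℝ × E => Θ q - Θ (t, x)) =o[𝓝[Icc 0 1 ×ˢ U] (t, x)]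
          (fun _ => (1 : ℝ)) := by
        rw [Asymptotics.isLittleO_one_iff]
        simpa using (tendsto_sub_nhds_zero_iff.2 hΘc)
      have hb : (fun q : ℝ × E => (Θ q - Θ (t, x)) (q.2 - x)) =O[𝓝[Icc 0 1 ×ˢ U] (t, x)]
          (fun q => ‖Θ q - Θ (t, x)‖ * ‖q - (t, x)‖) := by
        refine Asymptotics.IsBigO.of_bound 1 (Filter.Eventually.of_forall fun q => ?_)
        rw [one_mul, Real.norm_of_nonneg (by positivity)]
        refine ((Θ q - Θ (t, x)).le_opNorm _).trans ?_
        gcongr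
        exact norm_snd_le (q - (t, x))
      refine hb.trans_isLittleO ?_
      have := ho.norm_left.mul_isBigO
        ((Asymptotics.isBigO_refl (fun q : ℝ × E => q - (t, x)) (𝓝[Icc 0 1 ×ˢ U] (t, x))).norm_norm)
      refine (this.congr_right fun q => one_mul _).trans_isBigO ?_
      exact (Asymptotics.isBigO_refl _ _).norm_left
    rw [add_comm]
    exact (h2.add h1).congr hsplit (hsplit _ ⟨ht, hx⟩)

/-- **Smooth dependence on initial values**, up to the boundary: the flow of a smooth vector field
on a convex set is smooth. The extended system of `f` and its variational equation is of the same
kind, which allows for an induction on the order of differentiability. -/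
theorem IsFlowOn.contDiffOn_nat (k : ℕ) : ∀ {E : Type v} [NormedAddCommGroup E] [NormedSpace ℝ E]
    [CompleteSpace E] {f : E → E} {K U : Set E} {γ : ℝ × E → E}, IsFlowOn f K U γ → Convex ℝ K →
    UniqueDiffOn ℝ K → UniqueDiffOn ℝ U → ContDiffOn ℝ ∞ f K → U ⊆ K →
    ContDiffOn ℝ k γ (Icc 0 1 ×ˢ U) := by
  induction k with
  | zero =>
    intro E _ _ _ f K U γ h _ _ _ _ _
    exact contDiffOn_zero.2 h.continuousOn
  | succ k ih =>
    intro E _ _ _ f K U γ h hK hKu hU hf hUK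
    have hD : ContDiffOn ℝ ∞ (fderivWithin ℝ f K) K := hf.fderivWithin hKu (by simp)
    obtain ⟨J, hJc, hJ0, hJd, hγd⟩ := h.exists_hasFDerivWithinAt hK
      (hf.differentiableOn (by simp)) hD.continuousOn
    have hext : IsFlowOn (fun z : E × (E →L[ℝ] E) => (f z.1, (fderivWithin ℝ f K z.1).comp z.2))
        (K ×ˢ univ) (U ×ˢ univ)
        (fun q : ℝ × (E × (E →L[ℝ] E)) => (γ (q.1, q.2.1), (J (q.1, q.2.1)).comp q.2.2)) := by
      refine ⟨?_, fun q hq => ⟨h.mapsTo ⟨hq.1, hq.2.1⟩, mem_univ _⟩, fun x hx => ?_,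
        fun x hx t ht => ?_⟩
      · have hm : MapsTo (fun q : ℝ × (E × (E →L[ℝ] E)) => (q.1, q.2.1))
          (Icc (0 : ℝ) 1 ×ˢ U ×ˢ univ) (Icc 0 1 ×ˢ U) := fun q hq => ⟨hq.1, hq.2.1⟩
        exact (h.continuousOn.comp (by fun_prop) hm).prodMk
          ((hJc.comp (by fun_prop) hm).clm_comp (by fun_prop))
      · simp only [h.initial _ hx.1, hJ0 _ hx.1]
        rfl
      · refine (h.deriv _ hx.1 t ht).prodMk ?_
        exact ((ContinuousLinearMap.compL ℝ E E E).flip x.2).hasFDerivAt.comp_hasDerivWithinAt t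
          (hJd _ hx.1 t ht)
    have hfe : ContDiffOn ℝ ∞
        (fun z : E × (E →L[ℝ] E) => (f z.1, (fderivWithin ℝ f K z.1).comp z.2)) (K ×ˢ univ) := by
      have hm : MapsTo Prod.fst (K ×ˢ (univ : Set (E →L[ℝ] E))) K := fun q hq => hq.1
      exact (hf.comp contDiff_fst.contDiffOn hm).prodMk
        ((hD.comp contDiff_fst.contDiffOn hm).clm_comp contDiff_snd.contDiffOn)
    -- the induction hypothesis for the extended system gives `γ` and `J` of class `C^k`
    have hk := ih hext (hK.prod convex_univ) (hKu.prod uniqueDiffOn_univ)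
      (hU.prod uniqueDiffOn_univ) hfe (prod_mono hUK (subset_univ _))
    have hk1 : ContDiffOn ℝ k (fun q : ℝ × E => (γ q, J q)) (Icc 0 1 ×ˢ U) := by
      have hi : ContDiffOn ℝ k (fun q : ℝ × E => (q.1, q.2, (1 : E →L[ℝ] E))) (Icc 0 1 ×ˢ U) :=
        (contDiff_fst.prodMk (contDiff_snd.prodMk contDiff_const)).contDiffOn
      exact (hk.comp hi fun q hq => ⟨hq.1, hq.2, mem_univ _⟩).congr fun q hq => rfl
    have hu : UniqueDiffOn ℝ (Icc (0 : ℝ) 1 ×ˢ U) := (uniqueDiffOn_Icc one_pos).prod hU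
    rw [Nat.cast_succ, contDiffOn_succ_iff_hasFDerivWithinAt_of_uniqueDiffOn hu]
    refine ⟨by simp, _, ?_, fun q hq => hγd q.2 hq.2 q.1 hq.1⟩
    refine ContDiffOn.add ?_ ?_
    · exact contDiffOn_const.smulRight ((hf.of_le (by exact_mod_cast le_top)).comp hk1.fst h.mapsTo)
    · exact hk1.snd.clm_comp contDiffOn_const

theorem IsFlowOn.contDiffOn [CompleteSpace E] {f : E → E} {K U : Set E} {γ : ℝ × E → E}
    (h : IsFlowOn f K U γ) (hK : Convex ℝ K) (hKu : UniqueDiffOn ℝ K) (hU : UniqueDiffOn ℝ U)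
    (hf : ContDiffOn ℝ ∞ f K) (hUK : U ⊆ K) : ContDiffOn ℝ ∞ γ (Icc 0 1 ×ˢ U) :=
  contDiffOn_infty.2 fun k => h.contDiffOn_nat k hK hKu hU hf hUK

end SmoothDependence

/-! ### Boxes in the quadrant -/

section QuadrantFlow

/-- The square of the negative part is differentiable. -/
theorem hasDerivAt_min_zero_sq (r : ℝ) :
    HasDerivAt (fun r : ℝ => (min r 0) ^ 2) (2 * min r 0) r := by
  rcases lt_trichotomy r 0 with hr | rfl | hr
  · rw [min_eq_left hr.le]
    have h := hasDerivAt_pow 2 r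
    refine (by simpa using h : HasDerivAt (fun r : ℝ => r ^ 2) (2 * r) r).congr_of_eventuallyEq ?_
    filter_upwards [Iio_mem_nhds hr] with s hs
    rw [min_eq_left (le_of_lt hs)]
  · rw [hasDerivAt_iff_isLittleO_nhds_zero]
    have h1 : (fun h : ℝ => h ^ 2) =o[𝓝 0] (fun h : ℝ => h) :=
      Asymptotics.isLittleO_pow_id one_lt_two
    refine (Asymptotics.IsBigO.of_bound 1 (Filter.Eventually.of_forall fun h => ?_)).trans_isLittleO
      h1
    simp only [zero_add, min_self, smul_eq_mul, mul_zero, sub_zero, norm_pow, one_mul,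
      Real.norm_eq_abs, sq_abs]
    rcases le_total h 0 with hh | hh
    · rw [min_eq_left hh]; simp
    · rw [min_eq_right hh]; simpa using sq_nonneg h
  · rw [min_eq_right hr.le, mul_zero]
    refine (hasDerivAt_const r (0 : ℝ)).congr_of_eventuallyEq ?_
    filter_upwards [Ioi_mem_nhds hr] with s hs
    rw [min_eq_right (le_of_lt hs)]; simp

/-- A function that is stationary wherever it is negative does not become negative. -/
theorem nonneg_of_deriv_eq_zero_of_neg {φ φ' : ℝ → ℝ}
    (h : ∀ t ∈ Icc (0 : ℝ) 1, HasDerivWithinAt φ (φ' t) (Icc 0 1) t) (h0 : 0 ≤ φ 0)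
    (hneg : ∀ t ∈ Icc (0 : ℝ) 1, φ t < 0 → φ' t = 0) : ∀ t ∈ Icc (0 : ℝ) 1, 0 ≤ φ t := by
  intro t ht
  have hd : ∀ t ∈ Icc (0 : ℝ) 1, HasDerivWithinAt (fun t => (min (φ t) 0) ^ 2) 0 (Icc 0 1) t := by
    intro t ht
    refine ((hasDerivAt_min_zero_sq (φ t)).comp_hasDerivWithinAt t (h t ht)).congr_deriv ?_
    rcases lt_or_ge (φ t) 0 with hn | hn
    · rw [hneg t ht hn, mul_zero]
    · rw [min_eq_right hn]; simp
  have := constant_of_has_deriv_right_zero (fun t ht => (hd t ht).continuousWithinAt)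
    (fun t ht => (hd t (Ico_subset_Icc_self ht)).mono_of_mem_nhdsWithin
      (Icc_mem_nhdsGE_of_mem ht)) t ht
  rw [min_eq_right h0] at this
  have h2 : min (φ t) 0 = 0 := by simpa using this
  exact min_eq_right_iff.1 h2

/-- The quadrant `[0, ∞)^m`. -/
def quadrant (m : ℕ) : Set (EuclideanSpace ℝ (Fin m)) := {x | ∀ i, 0 ≤ x i}

theorem range_cornerModel (m : ℕ) : range (cornerModel m) = quadrant m :=
  range_euclideanQuadrant m

theorem uniqueDiffOn_quadrant (m : ℕ) : UniqueDiffOn ℝ (quadrant m) := by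
  rw [← range_cornerModel]
  exact (cornerModel m).uniqueDiffOn

/-- The part of the quadrant in the closed cube of radius `b` about `c`. -/
def quadrantBox {m : ℕ} (c : EuclideanSpace ℝ (Fin m)) (b : ℝ) : Set (EuclideanSpace ℝ (Fin m)) :=
  {x | ∀ i, 0 ≤ x i ∧ |x i - c i| ≤ b}

variable {m : ℕ} {c : EuclideanSpace ℝ (Fin m)} {b : ℝ}

theorem quadrantBox_subset : quadrantBox c b ⊆ quadrant m := fun _ hx i => (hx i).1

theorem quadrantBox_mono {b' : ℝ} (h : b ≤ b') : quadrantBox c b ⊆ quadrantBox c b' :=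
  fun _ hx i => ⟨(hx i).1, (hx i).2.trans h⟩

theorem convex_quadrantBox : Convex ℝ (quadrantBox c b) := by
  have : quadrantBox c b = ⋂ i : Fin m, (fun x : EuclideanSpace ℝ (Fin m) => x i) ⁻¹'
      (Ici 0 ∩ Metric.closedBall (c i) b) := by
    ext x; simp [quadrantBox, Real.dist_eq]
  rw [this]
  refine convex_iInter fun i => ((convex_Ici _).inter (convex_closedBall _ _)).is_linear_preimage ?_
  exact (EuclideanSpace.proj (𝕜 := ℝ) i).toLinearMap.isLinear

theorem norm_le_card_mul {m : ℕ} {x : EuclideanSpace ℝ (Fin m)} {b : ℝ} (h : ∀ i, |x i| ≤ b) :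
    ‖x‖ ≤ m * b := by
  have hx : x = ∑ i, EuclideanSpace.single i (x i) := by
    ext j; simp [Finset.sum_apply, Pi.single_apply]
  rw [hx]
  refine (norm_sum_le _ _).trans ?_
  refine (Finset.sum_le_sum (g := fun _ => b) fun i _ => ?_).trans (by simp)
  simpa using h i

theorem norm_sub_le_of_mem_quadrantBox {x : EuclideanSpace ℝ (Fin m)} (hx : x ∈ quadrantBox c b) :
    ‖x - c‖ ≤ m * b := norm_le_card_mul fun i => (hx i).2

theorem isCompact_quadrantBox : IsCompact (quadrantBox c b) := by
  refine Metric.isCompact_of_isClosed_isBounded ?_ ?_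
  · simp only [quadrantBox, ofPred_forall]
    refine isClosed_iInter fun i => IsClosed.and (isClosed_le ?_ ?_) (isClosed_le ?_ ?_) <;>
      fun_prop
  · refine (Metric.isBounded_closedBall (x := c) (r := m * b)).subset fun x hx => ?_
    rw [mem_closedBall_iff_norm]
    exact norm_sub_le_of_mem_quadrantBox hx

theorem isOpen_setOf_forall_apply {m : ℕ} {p : Fin m → Set ℝ} (hp : ∀ i, IsOpen (p i)) :
    IsOpen {x : EuclideanSpace ℝ (Fin m) | ∀ i, x i ∈ p i} := by
  simp only [ofPred_forall]
  exact isOpen_iInter_of_finite fun i =>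
    (hp i).preimage (by fun_prop : Continuous fun x : EuclideanSpace ℝ (Fin m) => x i)

theorem uniqueDiffOn_quadrantBox (hc : c ∈ quadrant m) (hb : 0 < b) :
    UniqueDiffOn ℝ (quadrantBox c b) := by
  refine uniqueDiffOn_convex convex_quadrantBox ⟨WithLp.toLp 2 fun i => c i + b / 2, ?_⟩
  have ho := isOpen_setOf_forall_apply (m := m) (p := fun i => Ioo (c i) (c i + b))
    fun i => isOpen_Ioo
  refine interior_maximal (fun x hx i => ?_) ho fun i => ?_
  · have := hx i
    have h0 := hc i
    exact ⟨h0.trans this.1.le, by rw [abs_le]; constructor <;> linarith [this.1, this.2]⟩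
  · simp only [mem_Ioo]
    constructor <;> linarith

theorem exists_lipschitzOnWith_of_contDiffOn {E G : Type*} [NormedAddCommGroup E]
    [NormedSpace ℝ E] [NormedAddCommGroup G] [NormedSpace ℝ G] {f : E → G} {K : Set E}
    (hf : ContDiffOn ℝ ∞ f K) (hK : Convex ℝ K) (hKu : UniqueDiffOn ℝ K) (hKc : IsCompact K) :
    ∃ L, LipschitzOnWith L f K := by
  obtain ⟨L, hL⟩ := hKc.exists_bound_of_continuousOn
    (hf.continuousOn_fderivWithin hKu (by simp))
  refine ⟨L.toNNReal, hK.lipschitzOnWith_of_nnnorm_fderivWithin_le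
    (hf.differentiableOn (by simp)) fun x hx => ?_⟩
  rw [← NNReal.coe_le_coe, coe_nnnorm]
  exact (hL x hx).trans (Real.le_coe_toNNReal L)

/-- The coordinatewise projection to `quadrantBox c b`. -/
noncomputable def boxClamp (c : EuclideanSpace ℝ (Fin m)) (b : ℝ) (x : EuclideanSpace ℝ (Fin m)) :
    EuclideanSpace ℝ (Fin m) :=
  WithLp.toLp 2 fun i => max (max 0 (c i - b)) (min (c i + b) (x i))

theorem boxClamp_mem (hc : c ∈ quadrant m) (hb : 0 ≤ b) (x : EuclideanSpace ℝ (Fin m)) :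
    boxClamp c b x ∈ quadrantBox c b := by
  intro i
  have h0 := hc i
  refine ⟨(le_max_left _ _).trans (le_max_left _ _), ?_⟩
  rw [abs_le]
  constructor
  · have : c i - b ≤ boxClamp c b x i := (le_max_right _ _).trans (le_max_left _ _)
    linarith
  · have : boxClamp c b x i ≤ c i + b :=
      max_le (max_le (by linarith) (by linarith)) (min_le_left _ _)
    linarith

theorem boxClamp_of_mem {x : EuclideanSpace ℝ (Fin m)} (hx : x ∈ quadrantBox c b) :
    boxClamp c b x = x := by
  ext i
  have h := hx i
  have h2 := abs_le.1 h.2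
  change max (max 0 (c i - b)) (min (c i + b) (x i)) = x i
  rw [min_eq_right (by linarith), max_eq_right (max_le h.1 (by linarith))]

/-- The projection maps points that leave the quadrant through the face `{x_i = 0}` to this face. -/
theorem boxClamp_apply_of_neg (i : Fin m) {x : EuclideanSpace ℝ (Fin m)} (hx : x i ≤ 0)
    (h : |x i - c i| ≤ b) : boxClamp c b x i = 0 := by
  have h2 := abs_le.1 h
  change max (max 0 (c i - b)) (min (c i + b) (x i)) = 0
  rw [max_eq_left (by linarith : c i - b ≤ 0), min_eq_right (by linarith), max_eq_left hx]

theorem exists_lipschitzWith_boxClamp (c : EuclideanSpace ℝ (Fin m)) (b : ℝ) :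
    ∃ L, LipschitzWith L (boxClamp c b) := by
  have h1 : LipschitzWith 1
      (fun x : Fin m → ℝ => fun i => max (max 0 (c i - b)) (min (c i + b) (x i))) := by
    refine LipschitzWith.of_dist_le_mul fun x y => ?_
    rw [NNReal.coe_one, one_mul, dist_pi_le_iff dist_nonneg]
    intro i
    refine le_trans ?_ (dist_le_pi_dist x y i)
    rw [Real.dist_eq, Real.dist_eq]
    exact (abs_max_sub_max_le_max _ _ _ _).trans
      (by simpa using (abs_min_sub_min_le_max (c i + b) (x i) (c i + b) (y i)))
  exact ⟨_, (PiLp.lipschitzWith_toLp 2 (fun _ : Fin m => ℝ)).comp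
    (h1.comp (PiLp.lipschitzWith_ofLp 2 (fun _ : Fin m => ℝ)))⟩

end QuadrantFlow

/-! ### Flows on the quadrant -/

section QuadrantFlow

/-- Initial values `x` and speeds `δ` for which the flow of `κ δ w` stays in the quadrant. -/
def flowDomain {n : ℕ} (c : EuclideanSpace ℝ (Fin (n + 1))) (b κ : ℝ) :
    Set (EuclideanSpace ℝ (Fin (n + 1)) × ℝ) :=
  {z | z.1 ∈ quadrantBox c b ∧ |z.2| ≤ 1 ∧ 0 ≤ z.1 0 + κ * z.2}

theorem uniqueDiffOn_flowDomain {n : ℕ} {c : EuclideanSpace ℝ (Fin (n + 1))}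
    (hc : c ∈ quadrant (n + 1)) {b κ : ℝ} (hb : 0 < b) : UniqueDiffOn ℝ (flowDomain c b κ) := by
  have h1 : flowDomain c b κ = (quadrantBox c b ×ˢ Metric.closedBall (0 : ℝ) 1) ∩
      {z | 0 ≤ z.1 0 + κ * z.2} := by
    ext z; simp [flowDomain, and_assoc]
  refine uniqueDiffOn_convex ?_ ⟨(WithLp.toLp 2 fun i => c i + b / 2, 0), ?_⟩
  · rw [h1]
    refine (convex_quadrantBox.prod (convex_closedBall _ _)).inter ?_
    exact convex_halfSpace_ge (f := fun z : EuclideanSpace ℝ (Fin (n + 1)) × ℝ =>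
      z.1 0 + κ * z.2) ⟨fun x y => by simp; ring, fun s x => by simp; ring⟩ 0
  · have ho1 := isOpen_setOf_forall_apply (m := n + 1) (p := fun i => Ioo (c i) (c i + b))
      fun i => isOpen_Ioo
    have ho2 : IsOpen {z : EuclideanSpace ℝ (Fin (n + 1)) × ℝ | 0 < z.1 0 + κ * z.2} :=
      isOpen_lt continuous_const (by fun_prop)
    refine interior_maximal (fun z hz => ?_)
      ((ho1.prod (Metric.isOpen_ball (x := (0 : ℝ)) (ε := 1))).inter ho2) ⟨⟨fun i => ?_, ?_⟩, ?_⟩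
    · obtain ⟨⟨hz1, hz2⟩, hz3⟩ := hz
      refine ⟨fun i => ?_, by simpa using (Metric.ball_subset_closedBall hz2), le_of_lt hz3⟩
      have := hz1 i
      have h0 := hc i
      exact ⟨h0.trans this.1.le, by rw [abs_le]; constructor <;> linarith [this.1, this.2]⟩
    · simp only [mem_Ioo]
      constructor <;> linarith
    · simp
    · have := hc 0
      simp only [mem_ofPred_eq]
      linarith

/-- A smooth vector field `w` on a box in the quadrant with `x₀`-component `1` that is tangent to
the faces `{x_i = 0}`, `i > 0`, has a smooth local flow in the quadrant. The equation is rescaled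
to the time interval `[0, 1]`; `κ * z.2` is the time for which `w` is followed. It may be negative,
as long as the `x₀`-coordinate at the end is not. -/
theorem exists_smooth_flow {n : ℕ} {c : EuclideanSpace ℝ (Fin (n + 1))}
    (hc : c ∈ quadrant (n + 1)) {b : ℝ} (hb : 0 < b)
    {w : EuclideanSpace ℝ (Fin (n + 1)) → EuclideanSpace ℝ (Fin (n + 1))}
    (hw : ContDiffOn ℝ ∞ w (quadrantBox c (2 * b)))
    (hw0 : ∀ x ∈ quadrantBox c (2 * b), w x 0 = 1)
    (hwi : ∀ x ∈ quadrantBox c (2 * b), ∀ i : Fin n, x i.succ = 0 → w x i.succ = 0) :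
    ∃ κ > 0, ∃ C > 0, ∃ X : ℝ × (EuclideanSpace ℝ (Fin (n + 1)) × ℝ) →
        EuclideanSpace ℝ (Fin (n + 1)),
      ContDiffOn ℝ ∞ X (Icc 0 1 ×ˢ flowDomain c b κ) ∧
      ∀ z ∈ flowDomain c b κ, X (0, z) = z.1 ∧ ∀ t ∈ Icc (0 : ℝ) 1,
        HasDerivWithinAt (fun t => X (t, z)) ((κ * z.2) • w (X (t, z))) (Icc 0 1) t ∧
        X (t, z) ∈ quadrantBox c (2 * b) ∧ X (t, z) 0 = z.1 0 + t * (κ * z.2) ∧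
        ‖X (t, z) - z.1‖ ≤ C * (κ * |z.2|) := by
  have h2b : 0 < 2 * b := by positivity
  have hcv : Convex ℝ (quadrantBox c (2 * b)) := convex_quadrantBox
  have hud : UniqueDiffOn ℝ (quadrantBox c (2 * b)) := uniqueDiffOn_quadrantBox hc h2b
  obtain ⟨L₁, hL₁⟩ := exists_lipschitzOnWith_of_contDiffOn hw hcv hud isCompact_quadrantBox
  obtain ⟨L₂, hL₂⟩ := exists_lipschitzWith_boxClamp c (2 * b)
  obtain ⟨C', hC'⟩ := isCompact_quadrantBox.exists_bound_of_continuousOn hw.continuousOn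
  set C : ℝ := max C' 1 with hCdef
  have hC1 : 1 ≤ C := le_max_right _ _
  have hC0 : 0 < C := by linarith
  -- a Lipschitz extension of `w` to the whole space, to which the Picard-Lindelöf theorem applies
  set G : EuclideanSpace ℝ (Fin (n + 1)) → EuclideanSpace ℝ (Fin (n + 1)) :=
    fun x => w (boxClamp c (2 * b) x) with hGdef
  have hmem : ∀ x, boxClamp c (2 * b) x ∈ quadrantBox c (2 * b) := boxClamp_mem hc h2b.le
  have hGC : ∀ x, ‖G x‖ ≤ C := fun x => (hC' _ (hmem x)).trans (le_max_left _ _)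
  have hGL : LipschitzWith (L₁ * L₂) G := by
    have := hL₁.comp (hL₂.lipschitzOnWith (s := univ)) fun x _ => hmem x
    exact lipschitzOnWith_univ.1 this
  have hG0 : ∀ x, G x 0 = 1 := fun x => hw0 _ (hmem x)
  have hGe : ∀ x ∈ quadrantBox c (2 * b), G x = w x := fun x hx => by
    simp only [hGdef, boxClamp_of_mem hx]
  -- `flowDomain` is contained in the ball of radius `r`. The factor `κ` makes the field small
  -- enough for solutions to stay in the ball of radius `a = r + 1`, and in the larger box.
  set r : ℝ := (n + 1) * b + 1 with hr
  have hr0 : 0 < r := by positivity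
  set a : ℝ := r + 1 with ha
  have ha0 : 0 < a := by positivity
  set κ : ℝ := min (1 / (a * C)) (b / C) with hκ
  have hκ0 : 0 < κ := lt_min (by positivity) (by positivity)
  have hκ1 : κ * a * C ≤ 1 := by
    have : κ ≤ 1 / (a * C) := min_le_left _ _
    calc κ * a * C = κ * (a * C) := by ring
      _ ≤ 1 / (a * C) * (a * C) := by gcongr
      _ = 1 := by field_simp
  have hκ2 : C * κ ≤ b := by
    have : κ ≤ b / C := min_le_right _ _
    calc C * κ ≤ C * (b / C) := by gcongr
      _ = b := by field_simp
  -- the speed is carried along as a constant component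
  let F : EuclideanSpace ℝ (Fin (n + 1)) × ℝ → EuclideanSpace ℝ (Fin (n + 1)) × ℝ :=
    fun z => ((κ * z.2) • G z.1, 0)
  have hFb : ∀ z ∈ Metric.closedBall (c, (0 : ℝ)) a, ‖F z‖ ≤ 1 := by
    intro z hz
    have hz2 : |z.2| ≤ a := by
      have := (norm_snd_le (z - (c, 0))).trans (mem_closedBall_iff_norm.1 hz)
      simpa using this
    simp only [F, Prod.norm_mk, norm_zero, norm_smul, norm_mul, Real.norm_eq_abs, abs_of_pos hκ0]
    refine max_le (le_trans ?_ hκ1) zero_le_one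
    gcongr
    exact hGC _
  have hFL : LipschitzOnWith (Real.toNNReal (κ * a * (L₁ * L₂) + κ * C)) F
      (Metric.closedBall (c, (0 : ℝ)) a) := by
    refine LipschitzOnWith.of_dist_le_mul fun z hz z' hz' => ?_
    have hz2 : |z.2| ≤ a := by
      have := (norm_snd_le (z - (c, 0))).trans (mem_closedBall_iff_norm.1 hz)
      simpa using this
    rw [Real.coe_toNNReal _ (by positivity), dist_eq_norm, dist_eq_norm]
    have he : F z - F z' = ((κ * z.2) • (G z.1 - G z'.1) + (κ * (z.2 - z'.2)) • G z'.1, 0) := by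
      simp only [F, Prod.mk_sub_mk, sub_zero]
      congr 1
      module
    rw [he, Prod.norm_mk, norm_zero]
    refine max_le ?_ (by positivity)
    refine (norm_add_le _ _).trans ?_
    rw [norm_smul, norm_smul, norm_mul, norm_mul, Real.norm_eq_abs, Real.norm_eq_abs,
      abs_of_pos hκ0, add_mul]
    have h1 : ‖G z.1 - G z'.1‖ ≤ L₁ * L₂ * ‖z - z'‖ := by
      have := hGL.dist_le_mul z.1 z'.1
      rw [dist_eq_norm, dist_eq_norm] at this
      refine this.trans ?_
      rw [NNReal.coe_mul]
      gcongr
      exact norm_fst_le (z - z')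
    have h2 : ‖z.2 - z'.2‖ ≤ ‖z - z'‖ := norm_snd_le (z - z')
    refine add_le_add ?_ ?_
    · calc κ * |z.2| * ‖G z.1 - G z'.1‖ ≤ κ * a * (L₁ * L₂ * ‖z - z'‖) := by gcongr
        _ = _ := by ring
    · calc κ * ‖z.2 - z'.2‖ * ‖G z'.1‖ ≤ κ * ‖z - z'‖ * C := by
            gcongr
            exact hGC _
        _ = _ := by ring
  have hPL : IsPicardLindelof (fun _ : ℝ => F) (tmin := 0) (tmax := 1)
      ⟨0, left_mem_Icc.2 zero_le_one⟩ (c, (0 : ℝ)) (Real.toNNReal a) (Real.toNNReal r) 1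
      (Real.toNNReal (κ * a * (L₁ * L₂) + κ * C)) := by
    refine IsPicardLindelof.of_time_independent (fun z hz => ?_) ?_ ?_
    · rw [Real.coe_toNNReal _ ha0.le] at hz
      simpa using hFb z hz
    · rw [Real.coe_toNNReal _ ha0.le]
      exact hFL
    · rw [Real.coe_toNNReal _ ha0.le, Real.coe_toNNReal _ hr0.le]
      simp [ha]
  obtain ⟨α, hα, hαc⟩ :=
    hPL.exists_forall_mem_closedBall_eq_hasDerivWithinAt_continuousOn
  rw [Real.coe_toNNReal _ hr0.le] at hα hαc
  have hUball : flowDomain c b κ ⊆ Metric.closedBall (c, (0 : ℝ)) r := by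
    intro z hz
    rw [mem_closedBall_iff_norm, Prod.norm_def]
    refine max_le ?_ ?_
    · refine (norm_sub_le_of_mem_quadrantBox hz.1).trans ?_
      rw [hr]; push_cast; linarith
    · simp only [Prod.snd_sub, sub_zero, Real.norm_eq_abs]
      refine hz.2.1.trans ?_
      rw [hr]
      have : 0 ≤ ((n : ℝ) + 1) * b := by positivity
      linarith
  let γ : ℝ × (EuclideanSpace ℝ (Fin (n + 1)) × ℝ) → EuclideanSpace ℝ (Fin (n + 1)) × ℝ :=
    fun q => α (q.2, q.1)
  have hγ0 : ∀ z ∈ flowDomain c b κ, γ (0, z) = z := fun z hz => (hα z (hUball hz)).1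
  have hγd : ∀ z ∈ flowDomain c b κ, ∀ t ∈ Icc (0 : ℝ) 1,
      HasDerivWithinAt (fun t => γ (t, z)) (F (γ (t, z))) (Icc 0 1) t :=
    fun z hz t ht => (hα z (hUball hz)).2 t ht
  have hγ2 : ∀ z ∈ flowDomain c b κ, ∀ t ∈ Icc (0 : ℝ) 1, (γ (t, z)).2 = z.2 := by
    intro z hz t ht
    have hd : ∀ t ∈ Icc (0 : ℝ) 1, HasDerivWithinAt (fun t => (γ (t, z)).2) 0 (Icc 0 1) t :=
      fun t ht => ((ContinuousLinearMap.snd ℝ (EuclideanSpace ℝ (Fin (n + 1)))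
        ℝ).hasFDerivAt.comp_hasDerivWithinAt t (hγd z hz t ht)).congr_deriv rfl
    have := constant_of_has_deriv_right_zero (fun t ht => (hd t ht).continuousWithinAt)
      (fun t ht => (hd t (Ico_subset_Icc_self ht)).mono_of_mem_nhdsWithin
        (Icc_mem_nhdsGE_of_mem ht)) t ht
    rw [this, hγ0 z hz]
  have hγ1 : ∀ z ∈ flowDomain c b κ, ∀ t ∈ Icc (0 : ℝ) 1,
      HasDerivWithinAt (fun t => (γ (t, z)).1) ((κ * z.2) • G (γ (t, z)).1) (Icc 0 1) t := by
    intro z hz t ht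
    have := (hasFDerivAt_fst (𝕜 := ℝ)).comp_hasDerivWithinAt t (hγd z hz t ht)
    refine this.congr_deriv ?_
    simp only [F, hγ2 z hz t ht]
    rfl
  have hγi : ∀ z ∈ flowDomain c b κ, ∀ i, ∀ t ∈ Icc (0 : ℝ) 1,
      HasDerivWithinAt (fun t => (γ (t, z)).1 i) (κ * z.2 * G (γ (t, z)).1 i) (Icc 0 1) t :=
    fun z hz i t ht => (EuclideanSpace.proj (𝕜 := ℝ) i).hasFDerivAt.comp_hasDerivWithinAt t
      (hγ1 z hz t ht)
  have hbd : ∀ z ∈ flowDomain c b κ, ∀ t ∈ Icc (0 : ℝ) 1,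
      ‖(γ (t, z)).1 - z.1‖ ≤ C * (κ * |z.2|) := by
    intro z hz t ht
    have := (convex_Icc (0 : ℝ) 1).norm_image_sub_le_of_norm_hasDerivWithin_le (hγ1 z hz)
      (C := C * (κ * |z.2|)) (fun s hs => ?_) (left_mem_Icc.2 zero_le_one) ht
    · rw [hγ0 z hz] at this
      refine this.trans (mul_le_of_le_one_right (by positivity) ?_)
      rw [sub_zero, Real.norm_of_nonneg ht.1]
      exact ht.2
    · rw [norm_smul, norm_mul, Real.norm_eq_abs, Real.norm_eq_abs, abs_of_pos hκ0, mul_comm]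
      gcongr
      exact hGC _
  have hbd' : ∀ z ∈ flowDomain c b κ, ∀ t ∈ Icc (0 : ℝ) 1, ∀ i,
      |(γ (t, z)).1 i - c i| ≤ 2 * b := by
    intro z hz t ht i
    have h1 : |(γ (t, z)).1 i - z.1 i| ≤ b := by
      refine (PiLp.norm_apply_le ((γ (t, z)).1 - z.1) i).trans ((hbd z hz t ht).trans ?_)
      calc C * (κ * |z.2|) ≤ C * (κ * 1) := by gcongr; exact hz.2.1
        _ ≤ b := by simpa using hκ2
    have h2 := (hz.1 i).2
    calc |(γ (t, z)).1 i - c i| = |((γ (t, z)).1 i - z.1 i) + (z.1 i - c i)| := by ring_nf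
      _ ≤ 2 * b := (abs_add_le _ _).trans (by linarith)
  have hγz : ∀ z ∈ flowDomain c b κ, ∀ t ∈ Icc (0 : ℝ) 1,
      (γ (t, z)).1 0 = z.1 0 + t * (κ * z.2) := by
    intro z hz t ht
    have hd : ∀ t ∈ Icc (0 : ℝ) 1,
        HasDerivWithinAt (fun t => (γ (t, z)).1 0 - t * (κ * z.2)) 0 (Icc 0 1) t := by
      intro t ht
      refine ((hγi z hz 0 t ht).sub
        ((hasDerivAt_id t).mul_const (κ * z.2)).hasDerivWithinAt).congr_deriv ?_
      rw [hG0]; ring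
    have := constant_of_has_deriv_right_zero (fun t ht => (hd t ht).continuousWithinAt)
      (fun t ht => (hd t (Ico_subset_Icc_self ht)).mono_of_mem_nhdsWithin
        (Icc_mem_nhdsGE_of_mem ht)) t ht
    rw [hγ0 z hz] at this
    linarith
  have hγK : ∀ z ∈ flowDomain c b κ, ∀ t ∈ Icc (0 : ℝ) 1,
      (γ (t, z)).1 ∈ quadrantBox c (2 * b) := by
    intro z hz t ht i
    refine ⟨?_, hbd' z hz t ht i⟩
    refine Fin.cases ?_ (fun i => ?_) i
    · -- The `0`-th coordinate is affine in `t` and non-negative at both ends.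
      rw [hγz z hz t ht]
      have h0 := (hz.1 0).1
      have h1 := hz.2.2
      nlinarith [ht.1, ht.2]
    · -- Where `x_i` is negative, the extended field has no `i`-th component.
      refine nonneg_of_deriv_eq_zero_of_neg (hγi z hz i.succ) ?_ (fun s hs hneg => ?_) t ht
      · rw [hγ0 z hz]
        exact (hz.1 _).1
      · have h0 : boxClamp c (2 * b) (γ (s, z)).1 i.succ = 0 :=
          boxClamp_apply_of_neg _ hneg.le (hbd' z hz s hs _)
        simp only [hGdef]
        rw [hwi _ (hmem _) i h0, mul_zero]
  -- the solutions remain in the box, where the extension is `w`, so they depend smoothly on `z`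
  have hflow : IsFlowOn (fun z : EuclideanSpace ℝ (Fin (n + 1)) × ℝ => ((κ * z.2) • w z.1, (0 : ℝ)))
      (quadrantBox c (2 * b) ×ˢ univ) (flowDomain c b κ) γ := by
    refine ⟨?_, fun q hq => ⟨hγK q.2 hq.2 q.1 hq.1, mem_univ _⟩, hγ0, fun z hz t ht => ?_⟩
    · exact hαc.comp continuous_swap.continuousOn fun q hq => ⟨hUball hq.2, hq.1⟩
    · have := hγd z hz t ht
      simp only [F, hGe _ (hγK z hz t ht)] at this
      exact this
  have hsm := hflow.contDiffOn (hcv.prod convex_univ) (hud.prod uniqueDiffOn_univ)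
    (uniqueDiffOn_flowDomain hc hb) ?_ ?_
  · refine ⟨κ, hκ0, C, hC0, fun q => (γ q).1, hsm.fst, fun z hz => ⟨congrArg Prod.fst (hγ0 z hz),
      fun t ht => ⟨?_, hγK z hz t ht, hγz z hz t ht, hbd z hz t ht⟩⟩⟩
    have := hγ1 z hz t ht
    rwa [hGe _ (hγK z hz t ht)] at this
  · refine ContDiffOn.prodMk ?_ contDiffOn_const
    have h1 : ContDiffOn ℝ ∞ (fun z : EuclideanSpace ℝ (Fin (n + 1)) × ℝ => κ * z.2)
        (quadrantBox c (2 * b) ×ˢ univ) := (contDiff_const.mul contDiff_snd).contDiffOn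
    have h2 : ContDiffOn ℝ ∞ (fun z : EuclideanSpace ℝ (Fin (n + 1)) × ℝ => w z.1)
        (quadrantBox c (2 * b) ×ˢ univ) := hw.comp contDiff_fst.contDiffOn fun z hz => hz.1
    exact h1.smul h2
  · intro z hz
    exact ⟨quadrantBox_mono (by linarith) hz.1, mem_univ _⟩

end QuadrantFlow

/-! ### Straightening a vector field at a boundary face -/

section Straightening

/-- The relatively open part of the quadrant in the open cube of radius `b` about `c`. -/
def openBox {m : ℕ} (c : EuclideanSpace ℝ (Fin m)) (b : ℝ) : Set (EuclideanSpace ℝ (Fin m)) :=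
  {x | ∀ i, 0 ≤ x i ∧ |x i - c i| < b}

section

variable {m : ℕ} {c : EuclideanSpace ℝ (Fin m)} {b : ℝ}

theorem openBox_subset_quadrantBox : openBox c b ⊆ quadrantBox c b :=
  fun _ hx i => ⟨(hx i).1, (hx i).2.le⟩

theorem quadrantBox_subset_openBox {b' : ℝ} (h : b < b') : quadrantBox c b ⊆ openBox c b' :=
  fun _ hx i => ⟨(hx i).1, (hx i).2.trans_lt h⟩

theorem openBox_subset : openBox c b ⊆ quadrant m := fun _ hx i => (hx i).1

theorem openBox_eq : openBox c b = quadrant m ∩ {x | ∀ i, x i ∈ Metric.ball (c i) b} := by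
  ext x; simp [openBox, quadrant, Real.dist_eq, forall_and]

theorem isOpen_cube (c : EuclideanSpace ℝ (Fin m)) (b : ℝ) :
    IsOpen {x : EuclideanSpace ℝ (Fin m) | ∀ i, x i ∈ Metric.ball (c i) b} :=
  isOpen_setOf_forall_apply fun _ => Metric.isOpen_ball

theorem mem_openBox_self (hc : c ∈ quadrant m) (hb : 0 < b) : c ∈ openBox c b :=
  fun i => ⟨hc i, by simpa using hb⟩

theorem openBox_mono {b' : ℝ} (h : b ≤ b') : openBox c b ⊆ openBox c b' :=
  fun _ hx i => ⟨(hx i).1, (hx i).2.trans_le h⟩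

theorem uniqueDiffOn_openBox : UniqueDiffOn ℝ (openBox c b) := by
  rw [openBox_eq]
  exact (uniqueDiffOn_quadrant m).inter (isOpen_cube c b)

theorem exists_quadrantBox_subset {U : Set (EuclideanSpace ℝ (Fin m))} (hU : U ∈ 𝓝 c) :
    ∃ b > 0, quadrantBox c b ⊆ U := by
  obtain ⟨r, hr, hrU⟩ := Metric.mem_nhds_iff.1 hU
  refine ⟨r / (m + 1), by positivity, fun x hx => hrU ?_⟩
  rw [mem_ball_iff_norm]
  refine (norm_sub_le_of_mem_quadrantBox hx).trans_lt ?_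
  rw [← mul_div_assoc, div_lt_iff₀ (by positivity)]
  nlinarith

end

variable {n : ℕ}

/-- The point `x` with its `0`-th coordinate replaced by `s`. -/
noncomputable def setZero (s : ℝ) (x : EuclideanSpace ℝ (Fin (n + 1))) :
    EuclideanSpace ℝ (Fin (n + 1)) :=
  x + (s - x 0) • EuclideanSpace.single 0 1

@[simp] theorem setZero_zero (s : ℝ) (x : EuclideanSpace ℝ (Fin (n + 1))) :
    setZero s x 0 = s := by simp [setZero]

@[simp] theorem setZero_succ (s : ℝ) (x : EuclideanSpace ℝ (Fin (n + 1))) (i : Fin n) :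
    setZero s x i.succ = x i.succ := by simp [setZero]

theorem setZero_self (x : EuclideanSpace ℝ (Fin (n + 1))) : setZero (x 0) x = x := by
  simp [setZero]

theorem setZero_of_eq {x : EuclideanSpace ℝ (Fin (n + 1))} {s : ℝ} (h : x 0 = s) :
    setZero s x = x := by
  simp [setZero, h]

@[simp] theorem setZero_setZero (s t : ℝ) (x : EuclideanSpace ℝ (Fin (n + 1))) :
    setZero s (setZero t x) = setZero s x := by
  ext i; refine Fin.cases ?_ (fun i => ?_) i <;> simp

theorem contDiff_setZero : ContDiff ℝ ∞
    (fun q : ℝ × EuclideanSpace ℝ (Fin (n + 1)) => setZero q.1 q.2) := by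
  unfold setZero
  have : ContDiff ℝ ∞ fun q : ℝ × EuclideanSpace ℝ (Fin (n + 1)) => q.2 0 :=
    (EuclideanSpace.proj (𝕜 := ℝ) (0 : Fin (n + 1))).contDiff.comp contDiff_snd
  fun_prop

theorem continuous_setZero (s : ℝ) :
    Continuous (setZero s : EuclideanSpace ℝ (Fin (n + 1)) → _) := by
  unfold setZero; fun_prop

theorem hasDerivAt_setZero (x : EuclideanSpace ℝ (Fin (n + 1))) (s : ℝ) :
    HasDerivAt (fun s => setZero s x) (EuclideanSpace.single 0 1) s := by
  unfold setZero
  simpa using (((hasDerivAt_id s).sub_const (x 0)).smul_const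
    (EuclideanSpace.single (0 : Fin (n + 1)) (1 : ℝ))).const_add x

/-- A vector field `w` as in `exists_smooth_flow` is straightened by a change of coordinates `S`
with inverse `R` which fixes `{x₀ = 0}`: `S x` is the point reached from the projection of `x` to
`{x₀ = 0}` after following `w` for the time `x₀`. -/
theorem exists_straightening {c : EuclideanSpace ℝ (Fin (n + 1))}
    (hc : c ∈ quadrant (n + 1)) (hc0 : c 0 = 0) {U : Set (EuclideanSpace ℝ (Fin (n + 1)))}
    (hU : U ∈ 𝓝 c) {w : EuclideanSpace ℝ (Fin (n + 1)) → EuclideanSpace ℝ (Fin (n + 1))}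
    (hw : ContDiffOn ℝ ∞ w (quadrant (n + 1) ∩ U))
    (hw0 : ∀ x ∈ quadrant (n + 1) ∩ U, w x 0 = 1)
    (hwi : ∀ x ∈ quadrant (n + 1) ∩ U, ∀ i : Fin n, x i.succ = 0 → w x i.succ = 0) :
    ∃ ε > 0, ∃ V : Set (EuclideanSpace ℝ (Fin (n + 1))), IsOpen V ∧ c ∈ V ∧
      ∃ S R : EuclideanSpace ℝ (Fin (n + 1)) → EuclideanSpace ℝ (Fin (n + 1)),
        ContDiffOn ℝ ∞ S (openBox c ε) ∧ ContDiffOn ℝ ∞ R (quadrant (n + 1) ∩ V) ∧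
        (∀ x ∈ openBox c ε, S x ∈ quadrant (n + 1) ∩ V ∧ S x ∈ U ∧ R (S x) = x ∧ S x 0 = x 0 ∧
          (x 0 = 0 → S x = x) ∧
          fderivWithin ℝ S (openBox c ε) x (EuclideanSpace.single 0 1) = w (S x)) ∧
        ∀ x ∈ quadrant (n + 1) ∩ V, R x ∈ openBox c ε ∧ S (R x) = x := by
  obtain ⟨b₂, hb₂, hbU⟩ := exists_quadrantBox_subset hU
  obtain ⟨b, hb, rfl⟩ : ∃ b > 0, b₂ = 2 * b := ⟨b₂ / 2, by positivity, by ring⟩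
  have hsub : quadrantBox c (2 * b) ⊆ quadrant (n + 1) ∩ U :=
    fun x hx => ⟨quadrantBox_subset hx, hbU hx⟩
  obtain ⟨κ, hκ, C, hC, X, hXs, hX⟩ := exists_smooth_flow hc hb (hw.mono hsub)
    (fun x hx => hw0 x (hsub hx)) (fun x hx => hwi x (hsub hx))
  obtain ⟨L, hL⟩ := exists_lipschitzOnWith_of_contDiffOn (hw.mono hsub) convex_quadrantBox
    (uniqueDiffOn_quadrantBox hc (by positivity)) isCompact_quadrantBox
  -- Integral curves of multiples of `w` in the box are determined by their initial values.
  have huniq : ∀ (k : ℝ) (f f' : ℝ → EuclideanSpace ℝ (Fin (n + 1))),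
      (∀ t ∈ Icc (0 : ℝ) 1, HasDerivWithinAt f (k • w (f t)) (Icc 0 1) t ∧
        f t ∈ quadrantBox c (2 * b)) →
      (∀ t ∈ Icc (0 : ℝ) 1, HasDerivWithinAt f' (k • w (f' t)) (Icc 0 1) t ∧
        f' t ∈ quadrantBox c (2 * b)) → f 0 = f' 0 → f 1 = f' 1 := by
    intro k f f' hf hf' h0
    refine ODE_solution_unique_of_mem_Icc_right (v := fun _ x => k • w x)
      (s := fun _ => quadrantBox c (2 * b)) (K := ‖k‖₊ * L) (fun t ht => ?_)
      (fun t ht => (hf t ht).1.continuousWithinAt) (fun t ht => ?_)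
      (fun t ht => (hf t (Ico_subset_Icc_self ht)).2)
      (fun t ht => (hf' t ht).1.continuousWithinAt) (fun t ht => ?_)
      (fun t ht => (hf' t (Ico_subset_Icc_self ht)).2) h0 (right_mem_Icc.2 zero_le_one)
    · refine LipschitzOnWith.of_dist_le_mul fun x hx y hy => ?_
      rw [dist_smul₀, NNReal.coe_mul, coe_nnnorm, mul_assoc]
      exact mul_le_mul_of_nonneg_left (hL.dist_le_mul x hx y hy) (norm_nonneg _)
    · exact (hf t (Ico_subset_Icc_self ht)).1.mono_of_mem_nhdsWithin (Icc_mem_nhdsGE_of_mem ht)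
    · exact (hf' t (Ico_subset_Icc_self ht)).1.mono_of_mem_nhdsWithin (Icc_mem_nhdsGE_of_mem ht)
  -- following the flow backwards leads back to the initial value
  have hrev : ∀ z ∈ flowDomain c b κ, (X (1, z), -z.2) ∈ flowDomain c b κ →
      X (1, (X (1, z), -z.2)) = z.1 := by
    intro z hz hz'
    have h := huniq (κ * -z.2) (fun t => X (t, (X (1, z), -z.2))) (fun t => X (1 - t, z))
      (fun t ht => ⟨((hX _ hz').2 t ht).1, ((hX _ hz').2 t ht).2.1⟩) (fun t ht => ?_) ?_
    · simpa [(hX z hz).1] using h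
    · have ht' : 1 - t ∈ Icc (0 : ℝ) 1 := ⟨by linarith [ht.2], by linarith [ht.1]⟩
      refine ⟨?_, ((hX _ hz).2 _ ht').2.1⟩
      have h1 : HasDerivWithinAt (fun t : ℝ => 1 - t) (-1) (Icc 0 1) t := by
        simpa using ((hasDerivAt_id t).const_sub 1).hasDerivWithinAt
      refine (((hX _ hz).2 _ ht').1.scomp t h1 fun s hs =>
        ⟨by linarith [hs.2], by linarith [hs.1]⟩).congr_deriv ?_
      module
    · simp [(hX _ hz').1]
  -- changing the speed amounts to rescaling time
  have hscale : ∀ x, ∀ δ, (x, δ) ∈ flowDomain c b κ → ∀ l ∈ Icc (0 : ℝ) 1,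
      (x, l * δ) ∈ flowDomain c b κ → X (1, (x, l * δ)) = X (l, (x, δ)) := by
    intro x δ hz l hl hz'
    have h := huniq (κ * (l * δ)) (fun t => X (t, (x, l * δ))) (fun t => X (l * t, (x, δ)))
      (fun t ht => ⟨((hX _ hz').2 t ht).1, ((hX _ hz').2 t ht).2.1⟩) (fun t ht => ?_) ?_
    · simpa using h
    · have hm : ∀ t ∈ Icc (0 : ℝ) 1, l * t ∈ Icc (0 : ℝ) 1 := fun t ht =>
        ⟨mul_nonneg hl.1 ht.1, mul_le_one₀ hl.2 ht.1 ht.2⟩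
      refine ⟨?_, ((hX _ hz).2 _ (hm t ht)).2.1⟩
      have h1 : HasDerivWithinAt (fun t : ℝ => l * t) l (Icc 0 1) t := by
        simpa using ((hasDerivAt_id t).const_mul l).hasDerivWithinAt
      refine (((hX _ hz).2 _ (hm t ht)).1.scomp t h1 hm).congr_deriv ?_
      module
    · simp [(hX _ hz').1, (hX _ hz).1]
  set ε₁ : ℝ := min b κ with hε₁
  have hε₁0 : 0 < ε₁ := lt_min hb hκ
  have hε₁b : ε₁ ≤ b := min_le_left _ _
  have hε₁κ : ε₁ ≤ κ := min_le_right _ _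
  -- `S` moves points of the box of radius `ε` by at most `C * ε`
  set ε : ℝ := ε₁ / (1 + C) with hε
  have hε0 : 0 < ε := by positivity
  have hεε : ε + C * ε = ε₁ := by rw [hε]; field_simp
  have hεε₁ : ε ≤ ε₁ := by nlinarith
  have hx0 : ∀ {x : EuclideanSpace ℝ (Fin (n + 1))} {e : ℝ}, x ∈ openBox c e →
      0 ≤ x 0 ∧ x 0 < e := by
    intro x e hx
    have := hx 0
    rw [hc0, sub_zero] at this
    exact ⟨this.1, (le_abs_self _).trans_lt this.2⟩
  have hbox : ∀ {x : EuclideanSpace ℝ (Fin (n + 1))} {e : ℝ}, x ∈ openBox c e → e ≤ b →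
      setZero 0 x ∈ quadrantBox c b := by
    intro x e hx he i
    refine Fin.cases ?_ (fun i => ?_) i
    · simp [hc0, hb.le]
    · rw [setZero_succ]
      exact ⟨(hx i.succ).1, (hx i.succ).2.le.trans he⟩
  have hzS : ∀ {x : EuclideanSpace ℝ (Fin (n + 1))} {s : ℝ}, setZero 0 x ∈ quadrantBox c b →
      0 ≤ s → s ≤ κ → (setZero 0 x, s / κ) ∈ flowDomain c b κ := by
    intro x s hx hs hsκ
    refine ⟨hx, ?_, ?_⟩
    · simp only
      rw [abs_of_nonneg (by positivity), div_le_one hκ]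
      exact hsκ
    · simp only [setZero_zero]
      positivity
  have hzR : ∀ {x : EuclideanSpace ℝ (Fin (n + 1))}, x ∈ openBox c ε₁ →
      (x, -(x 0 / κ)) ∈ flowDomain c b κ := by
    intro x hx
    have := hx0 hx
    refine ⟨fun i => ⟨(hx i).1, (hx i).2.le.trans hε₁b⟩, ?_, ?_⟩
    · simp only
      rw [abs_neg, abs_of_nonneg (by have := this.1; positivity), div_le_one hκ]
      linarith
    · simp only
      field_simp
      simp
  let S : EuclideanSpace ℝ (Fin (n + 1)) → EuclideanSpace ℝ (Fin (n + 1)) :=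
    fun x => X (1, (setZero 0 x, x 0 / κ))
  let R : EuclideanSpace ℝ (Fin (n + 1)) → EuclideanSpace ℝ (Fin (n + 1)) :=
    fun x => setZero (x 0) (X (1, (x, -(x 0 / κ))))
  have h1m : (1 : ℝ) ∈ Icc (0 : ℝ) 1 := right_mem_Icc.2 zero_le_one
  have hzx : ∀ {x}, x ∈ openBox c ε → (setZero 0 x, x 0 / κ) ∈ flowDomain c b κ := fun hx =>
    hzS (hbox hx (hεε₁.trans hε₁b)) (hx0 hx).1 (by linarith [(hx0 hx).2])
  have hS0 : ∀ x ∈ openBox c ε, S x 0 = x 0 := by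
    intro x hx
    have := ((hX _ (hzx hx)).2 1 h1m).2.2.1
    simp only [S, this, setZero_zero]
    field_simp
    ring
  have hSN : ∀ x ∈ openBox c ε, S x ∈ openBox c ε₁ := by
    intro x hx i
    refine ⟨(((hX _ (hzx hx)).2 1 h1m).2.1 i).1, ?_⟩
    have h1 := ((hX _ (hzx hx)).2 1 h1m).2.2.2
    refine Fin.cases ?_ (fun i => ?_) i
    · rw [hS0 x hx]
      exact (hx 0).2.trans_le hεε₁
    · have h2 : |S x i.succ - setZero 0 x i.succ| ≤ C * ε := by
        refine (PiLp.norm_apply_le (S x - setZero 0 x) i.succ).trans (h1.trans ?_)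
        simp only
        rw [abs_of_nonneg (by have := (hx0 hx).1; positivity), mul_div_cancel₀ _ hκ.ne']
        have := (hx0 hx).2.le
        gcongr
      rw [setZero_succ] at h2
      have h3 := (hx i.succ).2
      calc |S x i.succ - c i.succ| = |(S x i.succ - x i.succ) + (x i.succ - c i.succ)| := by
            ring_nf
        _ < ε₁ := (abs_add_le _ _).trans_lt (by linarith)
  have hRS : ∀ x ∈ openBox c ε, R (S x) = x := by
    intro x hx
    have h := hrev _ (hzx hx) (by simpa [hS0 x hx, S] using hzR (hSN x hx))
    simp only [R, hS0 x hx]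
    simp only [S]
    rw [h, setZero_setZero, setZero_self]
  have hRX : ∀ x ∈ openBox c ε₁, X (1, (x, -(x 0 / κ))) 0 = 0 := by
    intro x hx
    rw [((hX _ (hzR hx)).2 1 h1m).2.2.1]
    simp only
    field_simp
    ring
  have hR0 : ∀ x, R x 0 = x 0 := fun x => setZero_zero _ _
  have hRQ : ∀ x ∈ openBox c ε₁, R x ∈ quadrant (n + 1) := by
    intro x hx i
    refine Fin.cases ?_ (fun i => ?_) i
    · rw [hR0]; exact (hx0 hx).1
    · simp only [R, setZero_succ]
      exact (((hX _ (hzR hx)).2 1 h1m).2.1 i.succ).1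
  have hSR : ∀ x ∈ openBox c ε₁, R x ∈ openBox c ε → S (R x) = x := by
    intro x hx hRx
    have he : setZero 0 (R x) = X (1, (x, -(x 0 / κ))) := by
      simp only [R, setZero_setZero]
      exact setZero_of_eq (hRX x hx)
    have h := hrev _ (hzR hx) ?_
    · simp only [neg_neg] at h
      simp only [S, hR0, he, h]
    · have := hzx hRx
      rw [he, hR0] at this
      simpa using this
  have hproj : ContDiff ℝ ∞ fun x : EuclideanSpace ℝ (Fin (n + 1)) => x 0 :=
    (EuclideanSpace.proj (𝕜 := ℝ) (0 : Fin (n + 1))).contDiff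
  have hSs : ContDiffOn ℝ ∞ S (openBox c ε) := by
    refine hXs.comp (contDiff_const.prodMk ((contDiff_setZero.comp
      (contDiff_const.prodMk contDiff_id)).prodMk (hproj.div_const κ))).contDiffOn
      fun x hx => ⟨h1m, hzx hx⟩
  have hRs : ContDiffOn ℝ ∞ R (openBox c ε₁) := by
    have h1 : ContDiffOn ℝ ∞ (fun x => X (1, (x, -(x 0 / κ)))) (openBox c ε₁) :=
      hXs.comp (contDiff_const.prodMk (contDiff_id.prodMk (hproj.div_const κ).neg)).contDiffOn
      fun x hx => ⟨h1m, hzR hx⟩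
    exact contDiff_setZero.comp_contDiffOn (hproj.contDiffOn.prodMk h1)
  obtain ⟨V', hV', hVe⟩ := continuousOn_iff'.1 hRs.continuousOn _ (isOpen_cube c ε)
  have hNe : ∀ x, x ∈ quadrant (n + 1) ∩ (V' ∩ {x | ∀ i, x i ∈ Metric.ball (c i) ε₁}) ↔
      x ∈ openBox c ε₁ ∧ R x ∈ openBox c ε := by
    intro x
    have hx : x ∈ openBox c ε₁ → (x ∈ V' ↔ R x ∈ openBox c ε) := by
      intro hx
      have h1 : x ∈ V' ↔ R x ∈ {x | ∀ i, x i ∈ Metric.ball (c i) ε} := by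
        have := Set.ext_iff.1 hVe x
        simp only [mem_inter_iff, hx, and_true, mem_preimage] at this
        exact this.symm
      rw [h1, openBox_eq]
      simp [hRQ x hx]
    constructor
    · rintro ⟨h1, h2, h3⟩
      have h4 : x ∈ openBox c ε₁ := by rw [openBox_eq]; exact ⟨h1, h3⟩
      exact ⟨h4, (hx h4).1 h2⟩
    · rintro ⟨h1, h2⟩
      have h3 := h1
      rw [openBox_eq] at h3
      exact ⟨h3.1, (hx h1).2 h2, h3.2⟩
  have hSe : ∀ x ∈ openBox c ε, x 0 = 0 → S x = x := by
    intro x hx h0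
    have h1 : (setZero 0 x, x 0 / κ) = (x, 0 * (x 0 / κ)) := by
      rw [setZero_of_eq h0]; simp [h0]
    have h2 : (x, x 0 / κ) ∈ flowDomain c b κ := by
      have := hzx hx
      rwa [setZero_of_eq h0] at this
    have h3 : (x, 0 * (x 0 / κ)) ∈ flowDomain c b κ := h1 ▸ hzx hx
    simp only [S, h1]
    rw [hscale x _ h2 0 (left_mem_Icc.2 zero_le_one) h3]
    exact (hX _ h2).1
  have hSN' : ∀ x ∈ openBox c ε, S x ∈ quadrant (n + 1) ∩
      (V' ∩ {x | ∀ i, x i ∈ Metric.ball (c i) ε₁}) := fun x hx =>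
    (hNe _).2 ⟨hSN x hx, by rw [hRS x hx]; exact hx⟩
  refine ⟨ε, hε0, V' ∩ {x | ∀ i, x i ∈ Metric.ball (c i) ε₁}, hV'.inter (isOpen_cube c ε₁), ?_,
    S, R, hSs, hRs.mono fun x hx => ((hNe x).1 hx).1, fun x hx => ⟨hSN' x hx, ?_, hRS x hx,
      hS0 x hx, hSe x hx, ?_⟩, fun x hx =>
    ⟨((hNe x).1 hx).2, hSR x ((hNe x).1 hx).1 ((hNe x).1 hx).2⟩⟩
  · have := hSN' c (mem_openBox_self hc hε0)
    rw [hSe c (mem_openBox_self hc hε0) hc0] at this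
    exact this.2
  · exact hbU (((hX _ (hzx hx)).2 1 h1m).2.1)
  · -- Along the line through `x` in the direction `e₀`, `S` is an integral curve of `w`.
    have hy := hbox hx (hεε₁.trans hε₁b)
    have hline : HasDerivWithinAt (fun s => S (setZero s x))
        (fderivWithin ℝ S (openBox c ε) x (EuclideanSpace.single 0 1)) (Ico 0 ε) (x 0) := by
      have h1 : HasFDerivWithinAt S (fderivWithin ℝ S (openBox c ε) x) (openBox c ε)
          (setZero (x 0) x) := by
        rw [setZero_self]
        exact ((hSs x hx).differentiableWithinAt (by simp)).hasFDerivWithinAt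
      have hm : MapsTo (fun s => setZero s x) (Ico 0 ε) (openBox c ε) := by
        intro s hs i
        refine Fin.cases ?_ (fun i => ?_) i
        · rw [setZero_zero, hc0, sub_zero, abs_of_nonneg hs.1]; exact hs
        · rw [setZero_succ]; exact hx _
      exact h1.comp_hasDerivWithinAt (x 0) (hasDerivAt_setZero x (x 0)).hasDerivWithinAt hm
    have hcurve : HasDerivWithinAt (fun s => S (setZero s x)) (w (S x)) (Ico 0 ε) (x 0) := by
      have hz := hzS hy hε0.le (hεε₁.trans hε₁κ)
      have he : ∀ s ∈ Ico 0 ε, S (setZero s x) = X (s / ε, (setZero 0 x, ε / κ)) := by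
        intro s hs
        have hl : s / ε ∈ Icc (0 : ℝ) 1 := ⟨div_nonneg hs.1 hε0.le, (div_le_one hε0).2 hs.2.le⟩
        have h2 : s / κ = s / ε * (ε / κ) := by field_simp
        simp only [S, setZero_setZero, setZero_zero]
        rw [h2]
        refine hscale _ _ hz _ hl ?_
        rw [← h2]
        exact hzS hy hs.1 (by linarith [hs.2])
      have hxm : x 0 ∈ Ico 0 ε := ⟨(hx0 hx).1, (hx0 hx).2⟩
      have hm : ∀ s ∈ Ico 0 ε, s / ε ∈ Icc (0 : ℝ) 1 := fun s hs =>
        ⟨div_nonneg hs.1 hε0.le, (div_le_one hε0).2 hs.2.le⟩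
      have h3 : HasDerivWithinAt (fun s : ℝ => s / ε) (1 / ε) (Ico 0 ε) (x 0) :=
        ((hasDerivAt_id _).div_const ε).hasDerivWithinAt
      have h4 := ((hX _ hz).2 _ (hm _ hxm)).1.scomp (x 0) h3 hm
      refine (h4.congr he (he _ hxm)).congr_deriv ?_
      rw [← he _ hxm, setZero_self, smul_smul]
      have : 1 / ε * (κ * (ε / κ)) = 1 := by field_simp
      rw [this, one_smul]
    exact (uniqueDiffOn_Ico 0 ε _ ⟨(hx0 hx).1, (hx0 hx).2⟩).eq_deriv _ hline hcurve

end Straightening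

/-! ### Primitives and inverse maps up to the boundary -/

section Integrals

universe v

variable {E : Type v} [NormedAddCommGroup E] [NormedSpace ℝ E]

/-- Integrals depending smoothly on a parameter in a convex set. The integral is the value at time
`1` of a flow, whose field has to be defined a little beyond the range of integration. -/
theorem contDiffOn_integral [CompleteSpace E] {f : ℝ × E → ℝ} {K : Set E} (hK : Convex ℝ K)
    (hKu : UniqueDiffOn ℝ K) (hf : ContDiffOn ℝ ∞ f (Icc 0 2 ×ˢ K)) :
    ContDiffOn ℝ ∞ (fun x => ∫ s in (0 : ℝ)..1, f (s, x)) K := by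
  set P : ℝ → E → ℝ := fun t x => ∫ s in (0 : ℝ)..t, f (projIcc (0 : ℝ) 2 zero_le_two s, x)
    with hP
  have hproj : Continuous (fun s : ℝ => (projIcc (0 : ℝ) 2 zero_le_two s : ℝ)) :=
    continuous_subtype_val.comp continuous_projIcc
  have hc : Continuous (Function.uncurry fun (q : ℝ × K) (s : ℝ) =>
      f (projIcc (0 : ℝ) 2 zero_le_two s, q.2)) := by
    refine hf.continuousOn.comp_continuous
      (f := fun q : (ℝ × K) × ℝ => ((projIcc (0 : ℝ) 2 zero_le_two q.2 : ℝ), (q.1.2 : E)))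
      (by fun_prop) fun q => ⟨(projIcc (0 : ℝ) 2 zero_le_two q.2).2, q.1.2.2⟩
  have hPc : ContinuousOn (fun q : ℝ × E => P q.1 q.2) (univ ×ˢ K) := by
    have h1 : Continuous fun q : ℝ × K => P q.1 q.2 :=
      intervalIntegral.continuous_parametric_intervalIntegral_of_continuous hc continuous_fst
    rw [continuousOn_iff_continuous_domRestrict]
    exact h1.comp (g := fun q : ℝ × K => P q.1 q.2)
      (f := fun q : (univ ×ˢ K : Set (ℝ × E)) => (q.1.1, (⟨q.1.2, q.2.2⟩ : K))) (by fun_prop)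
  have hPd : ∀ x ∈ K, ∀ t ∈ Icc (0 : ℝ) 2, HasDerivAt (fun t => P t x) (f (t, x)) t := by
    intro x hx t ht
    have h1 : Continuous fun s : ℝ => f (projIcc (0 : ℝ) 2 zero_le_two s, x) :=
      hc.comp (f := fun s : ℝ => (((0 : ℝ), (⟨x, hx⟩ : K)), s)) (by fun_prop)
    have := intervalIntegral.integral_hasDerivAt_right (h1.intervalIntegrable 0 t)
      h1.stronglyMeasurable.stronglyMeasurableAtFilter h1.continuousAt
    rwa [projIcc_of_mem _ ht] at this
  -- the flow of the field `(1, 0, f)` on triples of time, parameter and value of the integral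
  let F : ℝ × (E × ℝ) → ℝ × (E × ℝ) := fun z => (1, (0, f (z.1, z.2.1)))
  let γ : ℝ × (ℝ × (E × ℝ)) → ℝ × (E × ℝ) := fun q =>
    (q.2.1 + q.1, (q.2.2.1, q.2.2.2 + (P (q.2.1 + q.1) q.2.2.1 - P q.2.1 q.2.2.1)))
  have hflow : IsFlowOn F (Icc 0 2 ×ˢ (K ×ˢ univ)) (Icc 0 1 ×ˢ (K ×ˢ univ)) γ := by
    refine ⟨?_, ?_, ?_, ?_⟩
    · have h1 : ContinuousOn (fun q : ℝ × (ℝ × (E × ℝ)) => P (q.2.1 + q.1) q.2.2.1)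
          (Icc 0 1 ×ˢ (Icc 0 1 ×ˢ (K ×ˢ univ))) :=
        hPc.comp (f := fun q : ℝ × (ℝ × (E × ℝ)) => (q.2.1 + q.1, q.2.2.1))
          (by fun_prop) fun q hq => ⟨mem_univ _, hq.2.2.1⟩
      have h2 : ContinuousOn (fun q : ℝ × (ℝ × (E × ℝ)) => P q.2.1 q.2.2.1)
          (Icc 0 1 ×ˢ (Icc 0 1 ×ˢ (K ×ˢ univ))) :=
        hPc.comp (f := fun q : ℝ × (ℝ × (E × ℝ)) => (q.2.1, q.2.2.1))
          (by fun_prop) fun q hq => ⟨mem_univ _, hq.2.2.1⟩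
      refine ContinuousOn.prodMk (by fun_prop) (ContinuousOn.prodMk (by fun_prop) ?_)
      exact (by fun_prop : Continuous fun q : ℝ × (ℝ × (E × ℝ)) => q.2.2.2).continuousOn.add
        (h1.sub h2)
    · rintro ⟨t, τ, x, v⟩ ⟨ht, hτ, hx, -⟩
      exact ⟨⟨add_nonneg hτ.1 ht.1, by linarith [hτ.2, ht.2]⟩, hx, mem_univ _⟩
    · rintro ⟨τ, x, v⟩ -
      simp [γ]
    · rintro ⟨τ, x, v⟩ ⟨hτ, hx, -⟩ t ht
      have hm : τ + t ∈ Icc (0 : ℝ) 2 :=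
        ⟨add_nonneg hτ.1 ht.1, by linarith [hτ.2, ht.2]⟩
      have h1 : HasDerivAt (fun t => τ + t) 1 t := by
        simpa using (hasDerivAt_id t).const_add τ
      have h2 : HasDerivAt (fun t => v + (P (τ + t) x - P τ x)) (f (τ + t, x)) t := by
        simpa using (((hPd x hx _ hm).comp t h1).sub_const (P τ x)).const_add v
      exact (h1.prodMk ((hasDerivAt_const t x).prodMk h2)).hasDerivWithinAt
  have hsm := hflow.contDiffOn ((convex_Icc 0 2).prod (hK.prod convex_univ))
    ((uniqueDiffOn_Icc two_pos).prod (hKu.prod uniqueDiffOn_univ))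
    ((uniqueDiffOn_Icc one_pos).prod (hKu.prod uniqueDiffOn_univ)) ?_ ?_
  · have h1 : ContDiffOn ℝ ∞ (fun x : E => (γ (1, (0, (x, 0)))).2.2) K := by
      refine (hsm.comp (f := fun x : E => ((1 : ℝ), ((0 : ℝ), (x, (0 : ℝ))))) (by fun_prop)
        fun x hx => ?_).snd.snd
      exact ⟨right_mem_Icc.2 zero_le_one, left_mem_Icc.2 zero_le_one, hx, mem_univ _⟩
    refine h1.congr fun x hx => ?_
    simp only [γ, hP, zero_add, intervalIntegral.integral_same, sub_zero]
    refine intervalIntegral.integral_congr fun s hs => ?_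
    rw [uIcc_of_le zero_le_one] at hs
    rw [projIcc_of_mem _ (⟨hs.1, hs.2.trans one_le_two⟩ : s ∈ Icc (0 : ℝ) 2)]
  · refine contDiffOn_const.prodMk (contDiffOn_const.prodMk ?_)
    exact hf.comp (f := fun z : ℝ × (E × ℝ) => (z.1, z.2.1)) (by fun_prop)
      fun z hz => ⟨hz.1, hz.2.1⟩
  · exact fun z hz => ⟨⟨hz.1.1, hz.1.2.trans one_le_two⟩, hz.2⟩

end Integrals

section Primitive

variable {n : ℕ} {c : EuclideanSpace ℝ (Fin (n + 1))} {b : ℝ}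

theorem setZero_mem_quadrantBox (hc0 : c 0 = 0) {x : EuclideanSpace ℝ (Fin (n + 1))}
    (hx : x ∈ quadrantBox c b) {s : ℝ} (hs : s ∈ Icc 0 b) : setZero s x ∈ quadrantBox c b := by
  intro i
  refine Fin.cases ?_ (fun i => ?_) i
  · rw [setZero_zero, hc0, sub_zero, abs_of_nonneg hs.1]; exact hs
  · rw [setZero_succ]; exact hx _

theorem apply_zero_mem_Icc (hc0 : c 0 = 0) {x : EuclideanSpace ℝ (Fin (n + 1))}
    (hx : x ∈ quadrantBox c b) : x 0 ∈ Icc 0 b := by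
  have := hx 0
  rw [hc0, sub_zero] at this
  exact ⟨this.1, (le_abs_self _).trans this.2⟩

/-- A smooth function on a box about a boundary point has a smooth primitive in the direction of
the `0`-th coordinate. -/
theorem exists_primitive (hc : c ∈ quadrant (n + 1)) (hc0 : c 0 = 0) (hb : 0 < b)
    {q : EuclideanSpace ℝ (Fin (n + 1)) → ℝ} (hq : ContDiffOn ℝ ∞ q (quadrantBox c (2 * b))) :
    ∃ Q : EuclideanSpace ℝ (Fin (n + 1)) → ℝ, ContDiffOn ℝ ∞ Q (quadrantBox c b) ∧
      (∀ x, x 0 = 0 → Q x = 0) ∧ ∀ x ∈ quadrantBox c b,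
        HasDerivWithinAt (fun s => Q (setZero s x)) (q x) (Icc 0 b) (x 0) := by
  -- `∫₀^{x₀} q`, substituted to have constant bounds
  refine ⟨fun x => x 0 * ∫ s in (0 : ℝ)..1, q (setZero (s * x 0) x), ?_, fun x hx => by simp [hx],
    fun x hx => ?_⟩
  · have hproj : ContDiff ℝ ∞ fun x : EuclideanSpace ℝ (Fin (n + 1)) => x 0 :=
      (EuclideanSpace.proj (𝕜 := ℝ) (0 : Fin (n + 1))).contDiff
    refine hproj.contDiffOn.mul (contDiffOn_integral
      (f := fun p : ℝ × EuclideanSpace ℝ (Fin (n + 1)) => q (setZero (p.1 * p.2 0) p.2))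
      convex_quadrantBox (uniqueDiffOn_quadrantBox hc hb) ?_)
    refine hq.comp (contDiff_setZero.comp ((contDiff_fst.mul
      (hproj.comp contDiff_snd)).prodMk contDiff_snd)).contDiffOn fun p hp => ?_
    have h0 := apply_zero_mem_Icc hc0 hp.2
    refine setZero_mem_quadrantBox hc0 (quadrantBox_mono (by linarith) hp.2)
      ⟨mul_nonneg hp.1.1 h0.1, ?_⟩
    have := hp.1.2
    exact mul_le_mul this h0.2 h0.1 zero_le_two
  · have hx0 := apply_zero_mem_Icc hc0 hx
    have hcont : ContinuousOn (fun s => q (setZero s x)) (Icc 0 b) :=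
      hq.continuousOn.comp (contDiff_setZero.continuous.comp
        (by fun_prop : Continuous fun s : ℝ => (s, x))).continuousOn
        fun s hs => quadrantBox_mono (by linarith) (setZero_mem_quadrantBox hc0 hx hs)
    have h1 : ∀ s, s * ∫ t in (0 : ℝ)..1, q (setZero (t * s) x) =
        ∫ t in (0 : ℝ)..s, q (setZero t x) := by
      intro s
      have := intervalIntegral.mul_integral_comp_mul_right (a := 0) (b := 1)
        (f := fun t => q (setZero t x)) s
      simpa using this
    simp only [setZero_zero, setZero_setZero, h1]
    have hx1 : q x = (fun s => q (setZero s x)) (x 0) := by simp only [setZero_self]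
    rw [hx1]
    have hint : IntervalIntegrable (fun s => q (setZero s x)) MeasureTheory.volume 0 (x 0) := by
      refine ContinuousOn.intervalIntegrable (hcont.mono ?_)
      rw [uIcc_of_le hx0.1]
      exact Icc_subset_Icc_right hx0.2
    have : Fact (x 0 ∈ Icc 0 b) := ⟨hx0⟩
    exact intervalIntegral.integral_hasDerivWithinAt_right hint
      (hcont.stronglyMeasurableAtFilter_nhdsWithin measurableSet_Icc _) (hcont _ hx0)

/-- A function whose derivative vanishes along an `x₀`-line is constant on the line. -/
theorem eq_setZero_of_hasDerivWithinAt {F : Type*} [NormedAddCommGroup F] [NormedSpace ℝ F]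
    {f : EuclideanSpace ℝ (Fin (n + 1)) → F} {x : EuclideanSpace ℝ (Fin (n + 1))}
    (hx : x 0 ∈ Icc 0 b) (hf : ∀ s ∈ Icc 0 b,
      HasDerivWithinAt (fun s => f (setZero s x)) 0 (Icc 0 b) s) :
    f x = f (setZero 0 x) := by
  have := constant_of_has_deriv_right_zero (fun s hs => (hf s hs).continuousWithinAt)
    (fun s hs => (hf s (Ico_subset_Icc_self hs)).mono_of_mem_nhdsWithin
      (Icc_mem_nhdsGE_of_mem hs)) (x 0) hx
  rwa [setZero_self] at this

end Primitive

section Inverse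

variable {E : Type*} [NormedAddCommGroup E] [NormedSpace ℝ E] [CompleteSpace E]
  {E' : Type*} [NormedAddCommGroup E'] [NormedSpace ℝ E']

/-- A continuous right inverse of a smooth map with invertible derivatives is smooth; no interior
points are needed. -/
theorem contDiffOn_of_rightInverse {f : E → E'} {g : E' → E} {s : Set E} {t : Set E'}
    (hs : UniqueDiffOn ℝ s) (ht : UniqueDiffOn ℝ t) (hf : ContDiffOn ℝ ∞ f s) (hg : MapsTo g t s)
    (hgc : ContinuousOn g t) (hfg : ∀ y ∈ t, f (g y) = y)
    (hinv : ∀ y ∈ t, (fderivWithin ℝ f s (g y)).IsInvertible) : ContDiffOn ℝ ∞ g t := by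
  have hd : ∀ y ∈ t, HasFDerivWithinAt g (fderivWithin ℝ f s (g y)).inverse t y := by
    intro y hy
    obtain ⟨e, he⟩ := hinv y hy
    have h1 : HasFDerivWithinAt f (e : E →L[ℝ] E') s (g y) := by
      rw [he]
      exact ((hf _ (hg hy)).differentiableWithinAt (by simp)).hasFDerivWithinAt
    rw [← he, ContinuousLinearMap.inverse_equiv]
    refine HasFDerivWithinAt.of_local_left_inverse (tendsto_nhdsWithin_iff.2 ⟨hgc y hy, ?_⟩) h1 hy
      (eventually_mem_nhdsWithin.mono hfg)
    exact eventually_mem_nhdsWithin.mono hg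
  refine contDiffOn_infty.2 fun k => ?_
  induction k with
  | zero => exact contDiffOn_zero.2 hgc
  | succ k ih =>
    rw [Nat.cast_add, Nat.cast_one, contDiffOn_succ_iff_fderivWithin ht]
    refine ⟨fun y hy => (hd y hy).differentiableWithinAt, by simp, ?_⟩
    have h2 : ContDiffOn ℝ k (fun y => fderivWithin ℝ f s (g y)) t :=
      ((hf.fderivWithin hs (m := k) (by exact_mod_cast le_top)).comp ih hg)
    have h3 : ContDiffOn ℝ k (fun y => (fderivWithin ℝ f s (g y)).inverse) t := fun y hy =>
      ContDiffAt.comp_contDiffWithinAt y (g := ContinuousLinearMap.inverse)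
        (hinv y hy).contDiffAt_map_inverse (h2 y hy)
    exact h3.congr fun y hy => (hd y hy).fderivWithin (ht y hy)

end Inverse

/-! ### Changes of the first coordinate -/

section Reparametrization

variable {n : ℕ} {c : EuclideanSpace ℝ (Fin (n + 1))} {b : ℝ}

theorem hasFDerivWithinAt_setZero_apply {H : EuclideanSpace ℝ (Fin (n + 1)) → ℝ}
    {H' : EuclideanSpace ℝ (Fin (n + 1)) →L[ℝ] ℝ} {s : Set (EuclideanSpace ℝ (Fin (n + 1)))}
    {x : EuclideanSpace ℝ (Fin (n + 1))} (hH : HasFDerivWithinAt H H' s x) :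
    HasFDerivWithinAt (fun x => setZero (H x) x)
      (ContinuousLinearMap.id ℝ _ +
        (H' - EuclideanSpace.proj (𝕜 := ℝ) (0 : Fin (n + 1))).smulRight
          (EuclideanSpace.single (0 : Fin (n + 1)) (1 : ℝ))) s x := by
  have h1 : HasFDerivWithinAt (fun x : EuclideanSpace ℝ (Fin (n + 1)) => x 0)
      (EuclideanSpace.proj (𝕜 := ℝ) (0 : Fin (n + 1))) s x :=
    (EuclideanSpace.proj (𝕜 := ℝ) (0 : Fin (n + 1))).hasFDerivWithinAt
  have h2 : HasFDerivWithinAt (fun x : EuclideanSpace ℝ (Fin (n + 1)) =>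
      x + (H x - x 0) • EuclideanSpace.single (0 : Fin (n + 1)) (1 : ℝ)) _ s x :=
    (hasFDerivWithinAt_id x s).fun_add ((hH.fun_sub h1).smul_const _)
  exact h2

/-- The linear map that replaces the `0`-th coordinate by `H'` is invertible if `H' e₀ ≠ 0`. -/
theorem isInvertible_setZero_deriv {H' : EuclideanSpace ℝ (Fin (n + 1)) →L[ℝ] ℝ}
    (h : H' (EuclideanSpace.single 0 1) ≠ 0) :
    (ContinuousLinearMap.id ℝ _ +
        (H' - EuclideanSpace.proj (𝕜 := ℝ) (0 : Fin (n + 1))).smulRight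
          (EuclideanSpace.single (0 : Fin (n + 1)) (1 : ℝ))).IsInvertible := by
  set T' := ContinuousLinearMap.id ℝ (EuclideanSpace ℝ (Fin (n + 1))) +
        (H' - EuclideanSpace.proj (𝕜 := ℝ) (0 : Fin (n + 1))).smulRight
          (EuclideanSpace.single (0 : Fin (n + 1)) (1 : ℝ)) with hT'
  have hinj : Function.Injective T'.toLinearMap := by
    rw [← LinearMap.ker_eq_bot, LinearMap.ker_eq_bot']
    intro v hv
    have hv' : v + (H' v - v 0) • EuclideanSpace.single 0 1 = 0 := hv
    have hvs : ∀ i : Fin n, v i.succ = 0 := fun i => by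
      have := congrArg (fun z : EuclideanSpace ℝ (Fin (n + 1)) => z i.succ) hv'
      simpa using this
    have hve : v = v 0 • EuclideanSpace.single 0 1 := by
      ext i; refine Fin.cases ?_ (fun i => ?_) i
      · simp
      · simp [hvs]
    have hv0 : H' v = 0 := by
      have := congrArg (fun z : EuclideanSpace ℝ (Fin (n + 1)) => z 0) hv'
      simpa using this
    rw [hve, map_smul, smul_eq_mul, mul_eq_zero] at hv0
    rw [hve, hv0.resolve_right h, zero_smul]
  refine ⟨(LinearEquiv.ofInjectiveEndo T'.toLinearMap hinj).toContinuousLinearEquiv, ?_⟩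
  ext v; rfl

/-- The map that replaces the `0`-th coordinate by a function `H` with `∂₀ H ≠ 0` has an invertible
derivative. -/
theorem isInvertible_fderivWithin_setZero (hc : c ∈ quadrant (n + 1)) (hc0 : c 0 = 0)
    (hb : 0 < b) {H : EuclideanSpace ℝ (Fin (n + 1)) → ℝ} {x : EuclideanSpace ℝ (Fin (n + 1))}
    (hH : DifferentiableWithinAt ℝ H (quadrantBox c b) x) (hx : x ∈ quadrantBox c b) {a : ℝ}
    (ha : HasDerivWithinAt (fun s => H (setZero s x)) a (Icc 0 b) (x 0)) (ha0 : a ≠ 0) :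
    (fderivWithin ℝ (fun x => setZero (H x) x) (quadrantBox c b) x).IsInvertible := by
  have hu := uniqueDiffOn_quadrantBox hc hb
  have hHx := hH.hasFDerivWithinAt
  rw [(hasFDerivWithinAt_setZero_apply hHx).fderivWithin (hu x hx)]
  refine isInvertible_setZero_deriv ?_
  have hx' : HasFDerivWithinAt H (fderivWithin ℝ H (quadrantBox c b) x) (quadrantBox c b)
      (setZero (x 0) x) := by
    rwa [setZero_self]
  have h1 := hx'.comp_hasDerivWithinAt (x 0) (hasDerivAt_setZero x (x 0)).hasDerivWithinAt
    (fun s hs => setZero_mem_quadrantBox hc0 hx hs : MapsTo _ (Icc 0 b) _)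
  rw [(uniqueDiffOn_Icc hb _ (apply_zero_mem_Icc hc0 hx)).eq_deriv _ h1 ha]
  exact ha0

set_option maxHeartbeats 400000 in
/-- If `H` vanishes at `x₀ = 0` and has positive derivative `h` in the direction of `x₀`, then `H`
and the other coordinates form a coordinate system; `K` is its inverse. -/
theorem exists_inverse_of_primitive (hc : c ∈ quadrant (n + 1)) (hc0 : c 0 = 0) (hb : 0 < b)
    {h H : EuclideanSpace ℝ (Fin (n + 1)) → ℝ} (hh : ContinuousOn h (quadrantBox c b))
    (hpos : ∀ x ∈ quadrantBox c b, 0 < h x) (hH : ContDiffOn ℝ ∞ H (quadrantBox c b))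
    (hH0 : ∀ x, x 0 = 0 → H x = 0) (hHd : ∀ x ∈ quadrantBox c b,
        HasDerivWithinAt (fun s => H (setZero s x)) (h x) (Icc 0 b) (x 0)) :
    (∀ x ∈ quadrantBox c b, 0 ≤ H x ∧ (H x = 0 → x 0 = 0)) ∧
    ∃ e > 0, e ≤ b ∧ ∃ K : EuclideanSpace ℝ (Fin (n + 1)) → EuclideanSpace ℝ (Fin (n + 1)),
      ContDiffOn ℝ ∞ K (openBox c e) ∧
      (∀ y ∈ openBox c e, K y ∈ openBox c b ∧ setZero (H (K y)) (K y) = y) ∧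
      ∀ x ∈ quadrantBox c b, setZero (H x) x ∈ openBox c e → K (setZero (H x) x) = x := by
  -- the minimum `m` of `h` bounds the growth of `H` along the `x₀`-lines from below
  obtain ⟨x₁, hx₁, hmin⟩ := isCompact_quadrantBox.exists_isMinOn
    ⟨c, quadrantBox_mono hb.le fun i => ⟨hc i, by simp⟩⟩ hh
  set m := h x₁ with hm
  have hm0 : 0 < m := hpos _ hx₁
  have hHd' : ∀ x ∈ quadrantBox c b, ∀ s ∈ Icc 0 b,
      HasDerivWithinAt (fun s => H (setZero s x)) (h (setZero s x)) (Icc 0 b) s := by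
    intro x hx s hs
    simpa using hHd _ (setZero_mem_quadrantBox hc0 hx hs)
  have hgrow : ∀ x ∈ quadrantBox c b, ∀ s ∈ Icc 0 b, ∀ s' ∈ Icc 0 b, s ≤ s' →
      m * (s' - s) ≤ H (setZero s' x) - H (setZero s x) := by
    intro x hx s hs s' hs' hss
    have hI : ∀ r ∈ interior (Icc 0 b), HasDerivAt (fun s => H (setZero s x))
        (h (setZero r x)) r := fun r hr =>
      (hHd' x hx r (interior_subset hr)).hasDerivAt (mem_interior_iff_mem_nhds.1 hr)
    refine (convex_Icc 0 b).mul_sub_le_image_sub_of_le_deriv (f := fun s => H (setZero s x))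
      (fun r hr => (hHd' x hx r hr).continuousWithinAt)
      (fun r hr => (hI r hr).differentiableAt.differentiableWithinAt) (fun r hr => ?_) s hs s'
      hs' hss
    rw [(hI r hr).deriv]
    exact hmin (setZero_mem_quadrantBox hc0 hx (interior_subset hr))
  have hgrow' : ∀ x ∈ quadrantBox c b, ∀ s ∈ Icc 0 b, ∀ s' ∈ Icc 0 b,
      m * |s' - s| ≤ |H (setZero s' x) - H (setZero s x)| := by
    intro x hx s hs s' hs'
    rcases le_total s s' with hss | hss
    · rw [abs_of_nonneg (sub_nonneg.2 hss)]
      exact (hgrow x hx s hs s' hs' hss).trans (le_abs_self _)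
    · rw [abs_sub_comm, abs_of_nonneg (sub_nonneg.2 hss), abs_sub_comm]
      exact (hgrow x hx s' hs' s hs hss).trans (le_abs_self _)
  have h0m : (0 : ℝ) ∈ Icc 0 b := left_mem_Icc.2 hb.le
  have hbm : b ∈ Icc 0 b := right_mem_Icc.2 hb.le
  have hHnn : ∀ x ∈ quadrantBox c b, m * x 0 ≤ H x := by
    intro x hx
    have := hgrow x hx 0 h0m _ (apply_zero_mem_Icc hc0 hx) (apply_zero_mem_Icc hc0 hx).1
    rwa [setZero_self, hH0 _ (setZero_zero 0 x), sub_zero, sub_zero] at this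
  refine ⟨fun x hx => ?_, ?_⟩
  · have h1 := hHnn x hx
    have h2 := (apply_zero_mem_Icc hc0 hx).1
    refine ⟨(mul_nonneg hm0.le h2).trans h1, fun h => ?_⟩
    rw [h] at h1
    nlinarith
  obtain ⟨L, hL⟩ := exists_lipschitzOnWith_of_contDiffOn hH convex_quadrantBox
    (uniqueDiffOn_quadrantBox hc hb) isCompact_quadrantBox
  set e := min b (m * b) with he
  have he0 : 0 < e := lt_min hb (by positivity)
  have heb : e ≤ b := min_le_left _ _
  have hbox : openBox c e ⊆ quadrantBox c b :=
    openBox_subset_quadrantBox.trans (quadrantBox_mono heb)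
  have hy0 : ∀ {y}, y ∈ openBox c e → 0 ≤ y 0 ∧ y 0 < e := by
    intro y hy
    have := hy 0
    rw [hc0, sub_zero] at this
    exact ⟨this.1, (le_abs_self _).trans_lt this.2⟩
  -- `k y` is the point of the `x₀`-line through `y` at which `H` takes the value `y₀`
  have hex : ∀ y, ∃ s, y ∈ openBox c e → s ∈ Ico 0 b ∧ H (setZero s y) = y 0 := by
    intro y
    by_cases hy : y ∈ openBox c e
    · have hyb := hbox hy
      have hcont : ContinuousOn (fun s => H (setZero s y)) (Icc 0 b) :=
        fun s hs => (hHd' y hyb s hs).continuousWithinAt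
      have hend : y 0 < H (setZero b y) := by
        have := hHnn _ (setZero_mem_quadrantBox hc0 hyb hbm)
        rw [setZero_zero] at this
        exact (hy0 hy).2.trans_le ((min_le_right _ _).trans this)
      obtain ⟨s, hs, hsy⟩ := intermediate_value_Icc hb.le hcont
        (show y 0 ∈ Icc (H (setZero 0 y)) (H (setZero b y)) from
          ⟨by rw [hH0 _ (setZero_zero 0 y)]; exact (hy0 hy).1, hend.le⟩)
      refine ⟨s, fun _ => ⟨⟨hs.1, lt_of_le_of_ne hs.2 ?_⟩, hsy⟩⟩
      rintro rfl
      exact hend.ne' hsy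
    · exact ⟨0, fun h => absurd h hy⟩
  choose k hk using hex
  have hkI : ∀ {y}, y ∈ openBox c e → k y ∈ Icc 0 b := fun hy => Ico_subset_Icc_self (hk _ hy).1
  have hKm : ∀ y ∈ openBox c e, setZero (k y) y ∈ openBox c b := by
    intro y hy i
    refine Fin.cases ?_ (fun i => ?_) i
    · rw [setZero_zero, hc0, sub_zero, abs_of_nonneg (hk y hy).1.1]; exact (hk y hy).1
    · rw [setZero_succ]; exact ⟨(hy _).1, (hy _).2.trans_le heb⟩
  have hTK : ∀ y ∈ openBox c e, setZero (H (setZero (k y) y)) (setZero (k y) y) = y := by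
    intro y hy
    rw [(hk y hy).2, setZero_setZero, setZero_self]
  -- the growth of `H` along the lines and its Lipschitz continuity across them bound `k y' - k y`
  have hkc : ContinuousOn k (openBox c e) := by
    intro y hy
    rw [ContinuousWithinAt, tendsto_iff_dist_tendsto_zero]
    have hlim : Tendsto (fun y' => 1 / m * (|y' 0 - y 0| + L * dist (setZero 0 y') (setZero 0 y)))
        (𝓝[openBox c e] y) (𝓝 0) := by
      have hcont : Continuous fun y' : EuclideanSpace ℝ (Fin (n + 1)) =>
          1 / m * (|y' 0 - y 0| + L * dist (setZero 0 y') (setZero 0 y)) := by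
        have := continuous_setZero (n := n) 0
        fun_prop
      have := (hcont.tendsto y).mono_left (nhdsWithin_le_nhds (s := openBox c e))
      simpa using this
    refine squeeze_zero' (Eventually.of_forall fun _ => dist_nonneg) ?_ hlim
    filter_upwards [self_mem_nhdsWithin] with y' hy'
    have h1 := hgrow' y' (hbox hy') _ (hkI hy) _ (hkI hy')
    have h2 : |H (setZero (k y) y) - H (setZero (k y) y')| ≤
        L * dist (setZero 0 y') (setZero 0 y) := by
      have := hL.dist_le_mul _ (setZero_mem_quadrantBox hc0 (hbox hy) (hkI hy)) _
        (setZero_mem_quadrantBox hc0 (hbox hy') (hkI hy))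
      rw [Real.dist_eq] at this
      refine this.trans (le_of_eq ?_)
      rw [dist_comm, dist_eq_norm, dist_eq_norm]
      congr 2
      simp only [setZero]
      module
    rw [Real.dist_eq, one_div, ← div_eq_inv_mul, le_div_iff₀' hm0]
    refine h1.trans ?_
    rw [(hk y' hy').2]
    calc |y' 0 - H (setZero (k y) y')|
        = |(y' 0 - y 0) + (H (setZero (k y) y) - H (setZero (k y) y'))| := by
          rw [(hk y hy).2]; ring_nf
      _ ≤ _ := (abs_add_le _ _).trans (by gcongr)
  refine ⟨e, he0, heb, fun y => setZero (k y) y, ?_, fun y hy => ⟨hKm y hy, hTK y hy⟩, ?_⟩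
  · have hT : ContDiffOn ℝ ∞ (fun x => setZero (H x) x) (quadrantBox c b) :=
      contDiff_setZero.comp_contDiffOn (hH.prodMk contDiffOn_id)
    have hu := uniqueDiffOn_quadrantBox hc hb
    refine contDiffOn_of_rightInverse (f := fun x => setZero (H x) x) hu uniqueDiffOn_openBox hT
      (fun y hy => openBox_subset_quadrantBox (hKm y hy)) ?_ hTK fun y hy => ?_
    · exact (contDiff_setZero.continuous).comp_continuousOn (hkc.prodMk continuousOn_id)
    · have hxm : setZero (k y) y ∈ quadrantBox c b := openBox_subset_quadrantBox (hKm y hy)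
      exact isInvertible_fderivWithin_setZero hc hc0 hb
        ((hH _ hxm).differentiableWithinAt (by simp)) hxm (hHd _ hxm) (hpos _ hxm).ne'
  · intro x hx hTx
    have h1 := hk _ hTx
    rw [setZero_setZero, setZero_zero] at h1
    have h2 := hgrow' x hx _ (apply_zero_mem_Icc hc0 hx) _ (hkI hTx)
    rw [h1.2, setZero_self, sub_self, abs_zero] at h2
    have h3 : k (setZero (H x) x) = x 0 := by
      have : |k (setZero (H x) x) - x 0| ≤ 0 := by
        by_contra! h
        nlinarith
      exact sub_eq_zero.1 (abs_nonpos_iff.1 this)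
    simp only
    rw [h3, setZero_setZero, setZero_self]

end Reparametrization

/-! ### Parametrizations adapted to a boundary hypersurface -/

section Coordinates

variable {n : ℕ}

/-- The coordinates `x₁, …, x_n` of `x = (x₀, …, x_n)`. -/
noncomputable def tailCoord :
    EuclideanSpace ℝ (Fin (n + 1)) →L[ℝ] EuclideanSpace ℝ (Fin n) :=
  LinearMap.toContinuousLinearMap
    { toFun := fun x => WithLp.toLp 2 fun i => x i.succ
      map_add' := fun _ _ => rfl
      map_smul' := fun _ _ => rfl }

@[simp] theorem tailCoord_apply (x : EuclideanSpace ℝ (Fin (n + 1))) (i : Fin n) :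
    tailCoord x i = x i.succ := rfl

/-- The point `(t, y₁, …, y_n)`. -/
noncomputable def consCoord :
    ℝ × EuclideanSpace ℝ (Fin n) →L[ℝ] EuclideanSpace ℝ (Fin (n + 1)) :=
  LinearMap.toContinuousLinearMap
    { toFun := fun q => WithLp.toLp 2 (Fin.cons q.1 q.2)
      map_add' := fun a b => by
        ext i; refine Fin.cases ?_ (fun i => ?_) i <;> simp
      map_smul' := fun a b => by
        ext i; refine Fin.cases ?_ (fun i => ?_) i <;> simp }

@[simp] theorem consCoord_zero (q : ℝ × EuclideanSpace ℝ (Fin n)) : consCoord q 0 = q.1 := rfl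

@[simp] theorem consCoord_succ (q : ℝ × EuclideanSpace ℝ (Fin n)) (i : Fin n) :
    consCoord q i.succ = q.2 i := rfl

@[simp] theorem tailCoord_consCoord (q : ℝ × EuclideanSpace ℝ (Fin n)) :
    tailCoord (consCoord q) = q.2 := rfl

theorem consCoord_tailCoord (x : EuclideanSpace ℝ (Fin (n + 1))) :
    consCoord (x 0, tailCoord x) = x := by
  ext i; refine Fin.cases ?_ (fun i => ?_) i <;> simp

@[simp] theorem tailCoord_setZero (s : ℝ) (x : EuclideanSpace ℝ (Fin (n + 1))) :
    tailCoord (setZero s x) = tailCoord x := by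
  ext i; simp

theorem consCoord_tailCoord_eq_setZero (s : ℝ) (x : EuclideanSpace ℝ (Fin (n + 1))) :
    consCoord (s, tailCoord x) = setZero s x := by
  ext i; refine Fin.cases ?_ (fun i => ?_) i <;> simp

end Coordinates

section Param

variable {n : ℕ} {M : Type*} [TopologicalSpace M] [ChartedSpace (EuclideanQuadrant (n + 1)) M]
  {Y : Type*} [TopologicalSpace Y] [ChartedSpace (EuclideanQuadrant n) Y]

/-- A parametrization `G` of an open set `O` of `M` by a box about a point of `{x₀ = 0}`, adapted
to the hypersurface `Y`: on `{x₀ = 0}` it is the inverse of the chart `χ` of `Y`. Its inverse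
is `R`. -/
structure BoundaryParam (ι : Y → M) (χ : OpenPartialHomeomorph Y (EuclideanQuadrant n))
    (c : EuclideanSpace ℝ (Fin (n + 1))) (e : ℝ) (G : EuclideanSpace ℝ (Fin (n + 1)) → M)
    (R : M → EuclideanSpace ℝ (Fin (n + 1))) (O : Set M) : Prop where
  isOpen : IsOpen O
  center_mem : c ∈ quadrant (n + 1)
  center_zero : c 0 = 0
  pos : 0 < e
  chart_mem : χ ∈ IsManifold.maximalAtlas (cornerModel n) ∞ Y
  contMDiffOn : ContMDiffOn 𝓘(ℝ, EuclideanSpace ℝ (Fin (n + 1))) (cornerModel (n + 1)) ∞ G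
    (openBox c e)
  contMDiffOn_inv : ContMDiffOn (cornerModel (n + 1)) 𝓘(ℝ, EuclideanSpace ℝ (Fin (n + 1))) ∞ R O
  mapsTo : MapsTo G (openBox c e) O
  mapsTo_inv : MapsTo R O (openBox c e)
  left_inv : ∀ x ∈ openBox c e, R (G x) = x
  right_inv : ∀ p ∈ O, G (R p) = p
  tail_mem : ∀ x ∈ openBox c e, tailCoord x ∈ (χ.extend (cornerModel n)).target
  eq_incl : ∀ x ∈ openBox c e, x 0 = 0 →
    G x = ι ((χ.extend (cornerModel n)).symm (tailCoord x))
  inv_apply_zero : ∀ z, ι z ∈ O → R (ι z) 0 = 0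

namespace BoundaryParam

variable {ι : Y → M} {χ : OpenPartialHomeomorph Y (EuclideanQuadrant n)}
    {c : EuclideanSpace ℝ (Fin (n + 1))} {e : ℝ} {G : EuclideanSpace ℝ (Fin (n + 1)) → M}
    {R : M → EuclideanSpace ℝ (Fin (n + 1))} {O : Set M}

/-- The coordinates of the points of `Y`. -/
theorem inv_incl (h : BoundaryParam ι χ c e G R O) (hι : Function.Injective ι) {z : Y}
    (hz : ι z ∈ O) :
    z ∈ χ.source ∧ R (ι z) = consCoord (0, χ.extend (cornerModel n) z) := by
  have hx := h.mapsTo_inv hz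
  have h0 := h.inv_apply_zero z hz
  have h1 := h.eq_incl _ hx h0
  rw [h.right_inv _ hz] at h1
  have h2 := hι h1
  have ht := h.tail_mem _ hx
  have h3 := (χ.extend (cornerModel n)).map_target ht
  have h4 := (χ.extend (cornerModel n)).right_inv ht
  rw [← h2] at h3 h4
  refine ⟨by simpa using h3, ?_⟩
  rw [h4, ← h0, consCoord_tailCoord]

theorem setZero_mem (h : BoundaryParam ι χ c e G R O) {x : EuclideanSpace ℝ (Fin (n + 1))}
    (hx : x ∈ openBox c e) {s : ℝ} (hs : s ∈ Ico 0 e) : setZero s x ∈ openBox c e := by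
  intro i
  refine Fin.cases ?_ (fun i => ?_) i
  · rw [setZero_zero, h.center_zero, sub_zero, abs_of_nonneg hs.1]; exact hs
  · rw [setZero_succ]; exact hx _

theorem apply_zero_mem (h : BoundaryParam ι χ c e G R O) {x : EuclideanSpace ℝ (Fin (n + 1))}
    (hx : x ∈ openBox c e) : x 0 ∈ Ico 0 e := by
  have := hx 0
  rw [h.center_zero, sub_zero] at this
  exact ⟨this.1, (le_abs_self _).trans_lt this.2⟩

theorem setZero_zero_mem (h : BoundaryParam ι χ c e G R O) {x : EuclideanSpace ℝ (Fin (n + 1))}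
    (hx : x ∈ openBox c e) : setZero 0 x ∈ openBox c e :=
  h.setZero_mem hx ⟨le_rfl, h.pos⟩

/-- Composition with a change of coordinates which fixes `{x₀ = 0}`. -/
theorem comp (h : BoundaryParam ι χ c e G R O) {e' : ℝ} (he' : 0 < e')
    {V : Set (EuclideanSpace ℝ (Fin (n + 1)))} (hV : IsOpen V)
    {S T : EuclideanSpace ℝ (Fin (n + 1)) → EuclideanSpace ℝ (Fin (n + 1))}
    (hS : ContDiffOn ℝ ∞ S (openBox c e')) (hT : ContDiffOn ℝ ∞ T (quadrant (n + 1) ∩ V))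
    (hSm : ∀ x ∈ openBox c e', S x ∈ V ∧ S x ∈ openBox c e ∧ T (S x) = x ∧ (x 0 = 0 → S x = x))
    (hTm : ∀ x ∈ quadrant (n + 1) ∩ V, T x ∈ openBox c e' ∧ S (T x) = x ∧ (x 0 = 0 → T x 0 = 0)) :
    BoundaryParam ι χ c e' (G ∘ S) (T ∘ R) (O ∩ R ⁻¹' V) where
  isOpen := h.contMDiffOn_inv.continuousOn.isOpen_inter_preimage h.isOpen hV
  center_mem := h.center_mem
  center_zero := h.center_zero
  pos := he'
  chart_mem := h.chart_mem
  contMDiffOn := h.contMDiffOn.comp hS.contMDiffOn fun x hx => (hSm x hx).2.1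
  contMDiffOn_inv := hT.contMDiffOn.comp (h.contMDiffOn_inv.mono inter_subset_left)
    fun p hp => ⟨openBox_subset (h.mapsTo_inv hp.1), hp.2⟩
  mapsTo := fun x hx => ⟨h.mapsTo (hSm x hx).2.1, by
    simp only [mem_preimage, Function.comp_apply, h.left_inv _ (hSm x hx).2.1]
    exact (hSm x hx).1⟩
  mapsTo_inv := fun p hp => (hTm _ ⟨openBox_subset (h.mapsTo_inv hp.1), hp.2⟩).1
  left_inv := fun x hx => by
    simp only [Function.comp_apply, h.left_inv _ (hSm x hx).2.1, (hSm x hx).2.2.1]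
  right_inv := fun p hp => by
    simp only [Function.comp_apply, (hTm _ ⟨openBox_subset (h.mapsTo_inv hp.1), hp.2⟩).2.1,
      h.right_inv p hp.1]
  tail_mem := fun x hx => by
    have h1 : setZero 0 x ∈ openBox c e' := by
      intro i
      refine Fin.cases ?_ (fun i => ?_) i
      · rw [setZero_zero, h.center_zero]; simpa using he'
      · rw [setZero_succ]; exact hx _
    have h2 := (hSm _ h1).2.1
    rw [(hSm _ h1).2.2.2 (setZero_zero _ _)] at h2
    simpa using h.tail_mem _ h2
  eq_incl := fun x hx h0 => by
    have h2 := (hSm _ hx).2.1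
    have h3 := (hSm _ hx).2.2.2 h0
    rw [h3] at h2
    rw [Function.comp_apply, h3, h.eq_incl x h2 h0]
  inv_apply_zero := fun z hz =>
    (hTm _ ⟨openBox_subset (h.mapsTo_inv hz.1), hz.2⟩).2.2 (h.inv_apply_zero z hz.1)

/-- Restriction to a smaller box. -/
theorem restrict (h : BoundaryParam ι χ c e G R O) {e' : ℝ} (he' : 0 < e') (hee : e' ≤ e) :
    BoundaryParam ι χ c e' G R (O ∩ R ⁻¹' {x | ∀ i, x i ∈ Metric.ball (c i) e'}) := by
  refine h.comp he' (isOpen_cube c e') (S := id) (T := id) contDiffOn_id contDiffOn_id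
    (fun x hx => ⟨?_, openBox_mono hee hx, rfl, fun _ => rfl⟩)
    (fun x hx => ⟨?_, rfl, fun h => h⟩)
  · rw [openBox_eq] at hx; exact hx.2
  · rw [openBox_eq]; exact hx

end BoundaryParam

/-- Around each point of a boundary hypersurface there is an adapted parametrization, given by a
chart. -/
theorem IsBoundaryHypersurface.exists_boundaryParam {ι : Y → M}
    (hι : IsBoundaryHypersurface (n := n) ι) (y : Y) :
    ∃ φ ∈ IsManifold.maximalAtlas (cornerModel (n + 1)) ∞ M,
    ∃ χ c e O, BoundaryParam ι χ c e (φ.extend (cornerModel (n + 1))).symm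
      (φ.extend (cornerModel (n + 1))) O ∧ ι y ∈ O ∧ O ⊆ φ.source ∧
      φ.extend (cornerModel (n + 1)) (ι y) = c ∧
      ∀ q ∈ φ.source, q ∈ range ι ↔ chartCoord φ 0 q = 0 := by
  obtain ⟨φ, hφ, χ, hχ, hy, hs, hr, hc⟩ := hι.exists_chart y
  set I := cornerModel (n + 1) with hI
  have hys : ι y ∈ φ.source := by
    have : y ∈ ι ⁻¹' φ.source := hs ▸ hy
    exact this
  have hφI : ∀ p i, φ.extend I p i = chartCoord φ i p := fun p i => rfl
  have hχJ : ∀ z i, χ.extend (cornerModel n) z i = chartCoord χ i z := fun p i => rfl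
  set c := φ.extend I (ι y) with hcdef
  have hcQ : c ∈ quadrant (n + 1) := by
    rw [← range_cornerModel]; exact mem_range_self _
  have hc0 : c 0 = 0 := (hr _ hys).1 (mem_range_self _)
  have htail : tailCoord c = χ.extend (cornerModel n) y := by
    ext i
    exact hc y hy i
  have h1 : (φ.extend I).target ∈ 𝓝[quadrant (n + 1)] c := by
    rw [← range_cornerModel]
    exact φ.extend_target_mem_nhdsWithin hys
  have h2 : tailCoord ⁻¹' (χ.extend (cornerModel n)).target ∈ 𝓝[quadrant (n + 1)] c := by
    have h3 : (χ.extend (cornerModel n)).target ∈ 𝓝[quadrant n] (tailCoord c) := by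
      rw [htail, ← range_cornerModel]
      exact χ.extend_target_mem_nhdsWithin hy
    refine (tailCoord.continuous.continuousWithinAt.tendsto_nhdsWithin ?_) h3
    exact fun x hx i => hx i.succ
  obtain ⟨U, hU, hUs⟩ := mem_nhdsWithin_iff_exists_mem_nhds_inter.1 (inter_mem h1 h2)
  obtain ⟨e, he, heU⟩ := exists_quadrantBox_subset hU
  have hbox : ∀ x ∈ openBox c e, x ∈ (φ.extend I).target ∧
      tailCoord x ∈ (χ.extend (cornerModel n)).target := fun x hx =>
    hUs ⟨heU (openBox_subset_quadrantBox hx), openBox_subset hx⟩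
  have hsrc : (φ.extend I).source = φ.source := φ.extend_source
  refine ⟨φ, hφ, χ, c, e, φ.source ∩ φ.extend I ⁻¹' {x | ∀ i, x i ∈ Metric.ball (c i) e}, ?_,
    ⟨hys, fun i => ?_⟩, inter_subset_left, rfl, hr⟩
  · refine ⟨?_, hcQ, hc0, he, hχ, ?_, ?_, ?_, ?_, ?_, ?_, fun x hx => (hbox x hx).2, ?_, ?_⟩
    · have := φ.continuousOn_extend (I := I)
      rw [hsrc] at this
      exact this.isOpen_inter_preimage φ.open_source (isOpen_cube c e)
    · refine (contMDiffOn_extend_symm hφ).mono fun x hx => ?_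
      have := (hbox x hx).1
      rwa [φ.extend_target'] at this
    · exact (φ.contMDiffOn_extend hφ).mono inter_subset_left
    · intro x hx
      refine ⟨hsrc ▸ (φ.extend I).map_target (hbox x hx).1, ?_⟩
      rw [mem_preimage, (φ.extend I).right_inv (hbox x hx).1]
      rw [openBox_eq] at hx
      exact hx.2
    · intro p hp
      rw [openBox_eq, ← range_cornerModel]
      exact ⟨mem_range_self _, hp.2⟩
    · exact fun x hx => (φ.extend I).right_inv (hbox x hx).1
    · exact fun p hp => (φ.extend I).left_inv (hsrc ▸ hp.1)
    · intro x hx hx0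
      have hp : (φ.extend I).symm x ∈ φ.source := hsrc ▸ (φ.extend I).map_target (hbox x hx).1
      have hpx : φ.extend I ((φ.extend I).symm x) = x := (φ.extend I).right_inv (hbox x hx).1
      obtain ⟨z, hz⟩ := (hr _ hp).2 (by rw [← hφI, hpx, hx0])
      have hzs : z ∈ χ.source := by rw [hs, mem_preimage, hz]; exact hp
      rw [← hz]
      congr 1
      have : tailCoord x = χ.extend (cornerModel n) z := by
        ext i
        rw [hχJ, ← hc z hzs, hz, ← hφI, hpx]
        rfl
      rw [this, (χ.extend (cornerModel n)).left_inv (by simpa using hzs)]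
    · intro z hz
      exact (hr _ hz.1).1 (mem_range_self _)
  · exact Metric.mem_ball_self he

end Param

/-! ### Derivatives and vector fields in a parametrization -/

section Box

variable {m : ℕ} {c : EuclideanSpace ℝ (Fin m)} {b : ℝ}

theorem convex_openBox : Convex ℝ (openBox c b) := by
  have : openBox c b = ⋂ i : Fin m, (fun x : EuclideanSpace ℝ (Fin m) => x i) ⁻¹'
      (Ici 0 ∩ Metric.ball (c i) b) := by
    ext x; simp [openBox, Real.dist_eq]
  rw [this]
  refine convex_iInter fun i => ((convex_Ici _).inter (convex_ball _ _)).is_linear_preimage ?_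
  exact (EuclideanSpace.proj (𝕜 := ℝ) i).toLinearMap.isLinear

theorem openBox_subset_closure_interior (hc : c ∈ quadrant m) (hb : 0 < b) :
    openBox c b ⊆ closure (interior (openBox c b)) := by
  rw [convex_openBox.closure_interior_eq_closure_of_nonempty_interior]
  · exact subset_closure
  · refine ⟨WithLp.toLp 2 fun i => c i + b / 2, ?_⟩
    have ho := isOpen_setOf_forall_apply (m := m) (p := fun i => Ioo (c i) (c i + b))
      fun i => isOpen_Ioo
    refine interior_maximal (fun x hx i => ?_) ho fun i => ?_
    · have := hx i
      have h0 := hc i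
      exact ⟨h0.trans this.1.le, by rw [abs_lt]; constructor <;> linarith [this.1, this.2]⟩
    · simp only [mem_Ioo]
      constructor <;> linarith

end Box

section Param

variable {n : ℕ} {M : Type*} [TopologicalSpace M] [ChartedSpace (EuclideanQuadrant (n + 1)) M]
  {Y : Type*} [TopologicalSpace Y] [ChartedSpace (EuclideanQuadrant n) Y]

/-- The derivative at `x` of a parametrization `G` by the box of radius `e` about `c`. -/
noncomputable def paramDeriv (G : EuclideanSpace ℝ (Fin (n + 1)) → M)
    (c : EuclideanSpace ℝ (Fin (n + 1))) (e : ℝ) (x : EuclideanSpace ℝ (Fin (n + 1))) :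
    EuclideanSpace ℝ (Fin (n + 1)) →L[ℝ] TangentSpace (cornerModel (n + 1)) (G x) :=
  mfderivWithin 𝓘(ℝ, EuclideanSpace ℝ (Fin (n + 1))) (cornerModel (n + 1)) G (openBox c e) x

/-- The derivative at `p` of a map `R` to the model space. -/
noncomputable def coordDeriv (R : M → EuclideanSpace ℝ (Fin (n + 1))) (p : M) :
    TangentSpace (cornerModel (n + 1)) p →L[ℝ] EuclideanSpace ℝ (Fin (n + 1)) :=
  mfderiv (cornerModel (n + 1)) 𝓘(ℝ, EuclideanSpace ℝ (Fin (n + 1))) R p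

/-- The vector field `X` on `M` in the coordinates of a parametrization `G` with inverse `R`. -/
noncomputable def coordField (R : M → EuclideanSpace ℝ (Fin (n + 1)))
    (G : EuclideanSpace ℝ (Fin (n + 1)) → M)
    (X : ∀ p : M, TangentSpace (cornerModel (n + 1)) p) (x : EuclideanSpace ℝ (Fin (n + 1))) :
    EuclideanSpace ℝ (Fin (n + 1)) :=
  coordDeriv R (G x) (X (G x))

namespace BoundaryParam

variable {ι : Y → M} {χ : OpenPartialHomeomorph Y (EuclideanQuadrant n)}
    {c : EuclideanSpace ℝ (Fin (n + 1))} {e : ℝ} {G : EuclideanSpace ℝ (Fin (n + 1)) → M}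
    {R : M → EuclideanSpace ℝ (Fin (n + 1))} {O : Set M}

theorem mdifferentiableWithinAt (h : BoundaryParam ι χ c e G R O)
    {x : EuclideanSpace ℝ (Fin (n + 1))} (hx : x ∈ openBox c e) :
    MDifferentiableWithinAt 𝓘(ℝ, EuclideanSpace ℝ (Fin (n + 1))) (cornerModel (n + 1)) G
      (openBox c e) x :=
  (h.contMDiffOn x hx).mdifferentiableWithinAt (by simp)

theorem mdifferentiableAt_inv (h : BoundaryParam ι χ c e G R O) {p : M} (hp : p ∈ O) :
    MDifferentiableAt (cornerModel (n + 1)) 𝓘(ℝ, EuclideanSpace ℝ (Fin (n + 1))) R p :=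
  ((h.contMDiffOn_inv p hp).contMDiffAt (h.isOpen.mem_nhds hp)).mdifferentiableAt (by simp)

theorem coordDeriv_paramDeriv (h : BoundaryParam ι χ c e G R O)
    {x : EuclideanSpace ℝ (Fin (n + 1))} (hx : x ∈ openBox c e)
    (v : EuclideanSpace ℝ (Fin (n + 1))) :
    coordDeriv R (G x) (paramDeriv G c e x v) = v := by
  have hu : UniqueMDiffWithinAt 𝓘(ℝ, EuclideanSpace ℝ (Fin (n + 1))) (openBox c e) x :=
    (uniqueDiffOn_openBox x hx).uniqueMDiffWithinAt
  have h1 := (h.mdifferentiableAt_inv (h.mapsTo hx)).hasMFDerivAt.comp_hasMFDerivWithinAt x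
    (h.mdifferentiableWithinAt hx).hasMFDerivWithinAt
  have h2 : HasMFDerivWithinAt 𝓘(ℝ, EuclideanSpace ℝ (Fin (n + 1)))
      𝓘(ℝ, EuclideanSpace ℝ (Fin (n + 1))) (R ∘ G) (openBox c e) x
      (ContinuousLinearMap.id ℝ _) :=
    (hasMFDerivWithinAt_id (openBox c e) x).congr_of_eventuallyEq
      (eventuallyEq_of_mem self_mem_nhdsWithin fun y hy => h.left_inv y hy) (h.left_inv x hx)
  exact DFunLike.congr_fun (hu.eq h1 h2) v

theorem paramDeriv_coordDeriv (h : BoundaryParam ι χ c e G R O)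
    {x : EuclideanSpace ℝ (Fin (n + 1))} (hx : x ∈ openBox c e)
    (v : TangentSpace (cornerModel (n + 1)) (G x)) :
    paramDeriv G c e x (coordDeriv R (G x) v) = v := by
  -- Both spaces are copies of the model space, so a one-sided inverse is two-sided.
  let P : EuclideanSpace ℝ (Fin (n + 1)) →ₗ[ℝ] EuclideanSpace ℝ (Fin (n + 1)) :=
    (paramDeriv G c e x).toLinearMap
  let Q : EuclideanSpace ℝ (Fin (n + 1)) →ₗ[ℝ] EuclideanSpace ℝ (Fin (n + 1)) :=
    (coordDeriv R (G x)).toLinearMap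
  have h1 : Q * P = 1 := LinearMap.ext fun v => h.coordDeriv_paramDeriv hx v
  have h2 : P * Q = 1 := mul_eq_one_comm.1 h1
  exact DFunLike.congr_fun h2 v

theorem inverse_paramDeriv (h : BoundaryParam ι χ c e G R O)
    {x : EuclideanSpace ℝ (Fin (n + 1))} (hx : x ∈ openBox c e) :
    (paramDeriv G c e x).inverse = coordDeriv R (G x) ∧ (paramDeriv G c e x).IsInvertible := by
  have h1 : (paramDeriv G c e x).comp (coordDeriv R (G x)) = ContinuousLinearMap.id ℝ _ := by
    ext1 v; exact h.paramDeriv_coordDeriv hx v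
  have h2 : (coordDeriv R (G x)).comp (paramDeriv G c e x) = ContinuousLinearMap.id ℝ _ := by
    ext1 v; exact h.coordDeriv_paramDeriv hx v
  exact ⟨ContinuousLinearMap.inverse_eq h1 h2, ContinuousLinearMap.IsInvertible.of_inverse h1 h2⟩

theorem coordField_eq (h : BoundaryParam ι χ c e G R O)
    (X : ∀ p : M, TangentSpace (cornerModel (n + 1)) p)
    {x : EuclideanSpace ℝ (Fin (n + 1))} (hx : x ∈ openBox c e) :
    coordField R G X x = VectorField.mpullbackWithin 𝓘(ℝ, EuclideanSpace ℝ (Fin (n + 1)))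
      (cornerModel (n + 1)) G X (openBox c e) x := by
  rw [VectorField.mpullbackWithin_apply]
  exact (DFunLike.congr_fun (h.inverse_paramDeriv hx).1 (X (G x))).symm

variable [IsManifold (cornerModel (n + 1)) ∞ M]

theorem contDiffOn_coordField (h : BoundaryParam ι χ c e G R O)
    {X : ∀ p : M, TangentSpace (cornerModel (n + 1)) p}
    (hX : ContMDiff (cornerModel (n + 1)) (cornerModel (n + 1)).tangent ∞
      (fun p => (⟨p, X p⟩ : TangentBundle (cornerModel (n + 1)) M))) :
    ContDiffOn ℝ ∞ (coordField R G X) (openBox c e) := by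
  intro x hx
  have : IsManifold (cornerModel (n + 1)) 1 M := IsManifold.of_le (n := ∞) ENat.LEInfty.out
  have h1 := ContMDiffWithinAt.mpullbackWithin_vectorField (t := univ) (m := ∞) (n := ∞)
    (V := X) (hX (G x)).contMDiffWithinAt (h.contMDiffOn x hx) (h.inverse_paramDeriv hx).2 hx
    uniqueDiffOn_openBox.uniqueMDiffOn (by simp) (mapsTo_univ _ _)
  rw [contMDiffWithinAt_vectorSpace_iff_contDiffWithinAt] at h1
  exact h1.congr (fun y hy => h.coordField_eq X hy)
      (h.coordField_eq X hx)

theorem coordField_mlieBracket (h : BoundaryParam ι χ c e G R O)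
    {X Z : ∀ p : M, TangentSpace (cornerModel (n + 1)) p}
    (hX : ContMDiff (cornerModel (n + 1)) (cornerModel (n + 1)).tangent ∞
      (fun p => (⟨p, X p⟩ : TangentBundle (cornerModel (n + 1)) M)))
    (hZ : ContMDiff (cornerModel (n + 1)) (cornerModel (n + 1)).tangent ∞
      (fun p => (⟨p, Z p⟩ : TangentBundle (cornerModel (n + 1)) M)))
    {x : EuclideanSpace ℝ (Fin (n + 1))} (hx : x ∈ openBox c e) :
    coordField R G (VectorField.mlieBracket (cornerModel (n + 1)) X Z) x =
      VectorField.lieBracketWithin ℝ (coordField R G X) (coordField R G Z) (openBox c e) x := by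
  have : IsManifold (cornerModel (n + 1)) (minSmoothness ℝ 3) M := by
    simp only [minSmoothness_of_isRCLikeNormedField]
    exact IsManifold.of_le (n := ∞) ENat.LEInfty.out
  have hu : UniqueMDiffOn 𝓘(ℝ, EuclideanSpace ℝ (Fin (n + 1))) (openBox c e) :=
    uniqueDiffOn_openBox.uniqueMDiffOn
  have h1 := VectorField.mpullbackWithin_mlieBracketWithin (t := univ) (n := ∞)
    (V := X) (W := Z)
    ((hX (G x)).mdifferentiableAt (by simp)).mdifferentiableWithinAt
    ((hZ (G x)).mdifferentiableAt (by simp)).mdifferentiableWithinAt hu (h.contMDiffOn x hx) hx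
    (by rw [minSmoothness_of_isRCLikeNormedField]; exact ENat.LEInfty.out) (by simp)
    (openBox_subset_closure_interior h.center_mem h.pos hx)
  rw [VectorField.mlieBracketWithin_univ, VectorField.mlieBracketWithin_eq_lieBracketWithin,
    ← h.coordField_eq _ hx] at h1
  rw [h1, VectorField.lieBracketWithin_congr (fun y hy => h.coordField_eq X hy)
      (h.coordField_eq X hx)
    (fun y hy => h.coordField_eq Z hy) (h.coordField_eq Z hx)]

end BoundaryParam

end Param

/-! ### Smooth sections -/

section Sections

variable {n : ℕ} {M : Type*} [TopologicalSpace M] [T2Space M] [CompactSpace M]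
  [ChartedSpace (EuclideanQuadrant (n + 1)) M] [IsManifold (cornerModel (n + 1)) ∞ M]
  {F : Type*} [NormedAddCommGroup F] [NormedSpace ℝ F]
  {A : M → Type*} [TopologicalSpace (Bundle.TotalSpace F A)] [∀ p, TopologicalSpace (A p)]
  [∀ p, AddCommGroup (A p)] [∀ p, Module ℝ (A p)]
  [∀ p, IsTopologicalAddGroup (A p)] [∀ p, ContinuousConstSMul ℝ (A p)]
  [FiberBundle F A] [VectorBundle ℝ F A]

variable (n F) in
/-- The section `s` of the vector bundle `A` with fibre `F` is smooth. -/
def IsSmoothSection (s : ∀ p, A p) : Prop :=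
  ContMDiff (cornerModel (n + 1)) ((cornerModel (n + 1)).prod 𝓘(ℝ, F)) ∞
    (fun p => (⟨p, s p⟩ : Bundle.TotalSpace F A))

set_option linter.unusedSectionVars false

/-- Germs of smooth sections extend to global smooth sections. -/
theorem exists_isSmoothSection_eventuallyEq {s : ∀ p, A p} {U : Set M} {p : M} (hU : U ∈ 𝓝 p)
    (hs : ContMDiffOn (cornerModel (n + 1)) ((cornerModel (n + 1)).prod 𝓘(ℝ, F)) ∞
      (fun p => (⟨p, s p⟩ : Bundle.TotalSpace F A)) U) :
    ∃ s' : ∀ p, A p, IsSmoothSection n F s' ∧ ∀ᶠ q in 𝓝 p, s' q = s q := by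
  obtain ⟨t, ht, htc, htU⟩ := exists_mem_nhds_isClosed_subset (interior_mem_nhds.2 hU)
  obtain ⟨ψ, h1, h0, -⟩ := exists_contMDiffMap_one_nhds_of_subset_interior (n := (⊤ : ℕ∞))
    (cornerModel (n + 1)) (isClosed_singleton (x := p)) (t := t)
    (singleton_subset_iff.2 (mem_interior_iff_mem_nhds.2 ht))
  refine ⟨fun q => ψ q • s q, ?_, ?_⟩
  · refine ContMDiffOn.smul_section_of_tsupport ψ.contMDiff.contMDiffOn isOpen_interior
      (subset_trans (closure_minimal (fun q hq => ?_) htc) htU) (hs.mono interior_subset)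
    by_contra hqt
    exact hq (h0 q hqt)
  · rw [nhdsSet_singleton] at h1
    filter_upwards [h1] with q hq
    rw [hq, one_smul]

/-- Every point has a neighborhood with a frame of global smooth sections. -/
theorem exists_frame [FiniteDimensional ℝ F] [ContMDiffVectorBundle ∞ F A (cornerModel (n + 1))]
    {κ : Type*} [Fintype κ] (b : Module.Basis κ ℝ F) (p : M) :
    ∃ (σ : κ → ∀ p, A p) (O : Set M), IsOpen O ∧ p ∈ O ∧ (∀ k, IsSmoothSection n F (σ k)) ∧
      (∀ q ∈ O, ∃ B : Module.Basis κ ℝ (A q), ∀ k, B k = σ k q) ∧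
      ∀ t : ∀ p, A p, IsSmoothSection n F t → ∃ a : κ → M → ℝ,
        (∀ k, ContMDiffOn (cornerModel (n + 1)) 𝓘(ℝ, ℝ) ∞ (a k) O) ∧
        ∀ q ∈ O, t q = ∑ k, a k q • σ k q := by
  have : ContMDiffVectorBundle 1 F A (cornerModel (n + 1)) :=
    ContMDiffVectorBundle.of_le (n := ∞) ENat.LEInfty.out
  set e := trivializationAt F A p
  have hp : p ∈ e.baseSet := FiberBundle.mem_baseSet_trivializationAt' p
  have hex : ∀ k, ∃ s' : ∀ p, A p, IsSmoothSection n F s' ∧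
      ∀ᶠ q in 𝓝 p, s' q = e.localFrame b k q := fun k =>
    exists_isSmoothSection_eventuallyEq (e.open_baseSet.mem_nhds hp)
      (e.contMDiffOn_localFrame_baseSet ∞ b k)
  choose σ hσ hσe using hex
  obtain ⟨O, hO, hOo, hpO⟩ := mem_nhds_iff.1
    ((eventually_all.2 hσe).and (e.open_baseSet.mem_nhds hp))
  refine ⟨σ, O, hOo, hpO, hσ, fun q hq => ⟨e.basisAt b (hO hq).2, fun k => ?_⟩, fun t ht =>
    ⟨fun k q => e.localFrameCoeff (cornerModel (n + 1)) b k q (t q), fun k => ?_, fun q hq => ?_⟩⟩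
  · rw [(hO hq).1 k, e.localFrame_apply_of_mem_baseSet b (hO hq).2]
  · exact contMDiffOn_localFrameCoeff b hOo (fun q hq => (hO hq).2) (ht.contMDiffOn) k
  · refine (e.eq_sum_localFrameCoeff_smul (I := cornerModel (n + 1)) (b := b) (s := t)
      (hO hq).2).trans ?_
    exact Finset.sum_congr rfl fun k _ => by rw [(hO hq).1 k]

variable {Y : Type*} [TopologicalSpace Y] [ChartedSpace (EuclideanQuadrant n) Y]

/-- The retraction onto `Y` of the domain of an adapted parametrization. -/
noncomputable def paramRetract (χ : OpenPartialHomeomorph Y (EuclideanQuadrant n))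
    (R : M → EuclideanSpace ℝ (Fin (n + 1))) (p : M) : Y :=
  (χ.extend (cornerModel n)).symm (tailCoord (R p))

omit [T2Space M] [CompactSpace M] [IsManifold (cornerModel (n + 1)) ∞ M] in
theorem BoundaryParam.paramRetract_incl {ι : Y → M}
    {χ : OpenPartialHomeomorph Y (EuclideanQuadrant n)}
    {c : EuclideanSpace ℝ (Fin (n + 1))} {e : ℝ} {G : EuclideanSpace ℝ (Fin (n + 1)) → M}
    {R : M → EuclideanSpace ℝ (Fin (n + 1))} {O : Set M} (h : BoundaryParam ι χ c e G R O)
    (hι : Function.Injective ι) {z : Y} (hz : ι z ∈ O) : paramRetract χ R (ι z) = z := by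
  obtain ⟨h1, h2⟩ := h.inv_incl hι hz
  rw [paramRetract, h2, tailCoord_consCoord]
  exact (χ.extend (cornerModel n)).left_inv (by simpa using h1)

omit [T2Space M] [CompactSpace M] [IsManifold (cornerModel (n + 1)) ∞ M] in
theorem BoundaryParam.contMDiffOn_paramRetract {ι : Y → M}
    {χ : OpenPartialHomeomorph Y (EuclideanQuadrant n)}
    {c : EuclideanSpace ℝ (Fin (n + 1))} {e : ℝ} {G : EuclideanSpace ℝ (Fin (n + 1)) → M}
    {R : M → EuclideanSpace ℝ (Fin (n + 1))} {O : Set M} (h : BoundaryParam ι χ c e G R O) :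
    ContMDiffOn (cornerModel (n + 1)) (cornerModel n) ∞ (paramRetract χ R) O := by
  refine (contMDiffOn_extend_symm h.chart_mem).comp
    (tailCoord.contDiff.contMDiff.comp_contMDiffOn h.contMDiffOn_inv) fun p hp => ?_
  have := h.tail_mem _ (h.mapsTo_inv hp)
  rwa [χ.extend_target'] at this

/-- A smooth section along a boundary hypersurface extends to the whole manifold. -/
theorem IsBoundaryHypersurface.exists_isSmoothSection_eq
    [ContMDiffVectorBundle ∞ F A (cornerModel (n + 1))] {ι : Y → M}
    (hι : IsBoundaryHypersurface (n := n) ι) {N : ∀ y, A (ι y)}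
    (hN : ContMDiff (cornerModel n) ((cornerModel (n + 1)).prod 𝓘(ℝ, F)) ∞
      (fun y => (⟨ι y, N y⟩ : Bundle.TotalSpace F A))) :
    ∃ s : ∀ p, A p, IsSmoothSection n F s ∧ ∀ y, s (ι y) = N y := by
  have hinj := hι.isClosedEmbedding.injective
  -- A section with values in the affine subspaces `t p` extends `N`; as these are convex, local
  -- sections can be patched with a partition of unity.
  let t : ∀ p, Set (A p) := fun p => {a | ∀ y, ∀ h : ι y = p, a = h ▸ N y}
  suffices hloc : ∀ p, ∃ U ∈ 𝓝 p, ∃ s : ∀ p, A p,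
      ContMDiffOn (cornerModel (n + 1)) ((cornerModel (n + 1)).prod 𝓘(ℝ, F)) ∞
        (fun p => (⟨p, s p⟩ : Bundle.TotalSpace F A)) U ∧ ∀ q ∈ U, s q ∈ t q by
    obtain ⟨s, hs⟩ := exists_contMDiffSection_forall_mem_convex_of_local (n := (⊤ : ℕ∞))
      (F_fiber := F) (cornerModel (n + 1)) A t (fun p a ha b hb u v hu hv huv y hy => by
        rw [ha y hy, hb y hy, ← add_smul, huv, one_smul]) hloc
    exact ⟨s, s.contMDiff, fun y => hs (ι y) y rfl⟩
  · intro p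
    by_cases hp : p ∈ range ι
    · obtain ⟨y, rfl⟩ := hp
      obtain ⟨φ, -, χ, c, e, O, h, hyO, -⟩ := hι.exists_boundaryParam y
      set R := φ.extend (cornerModel (n + 1)) with hR
      -- near `Y`, extend `N` to be constant along the fibres of the retraction in a trivialization
      set E := trivializationAt F A (ι y)
      have hbase : ι y ∈ E.baseSet := FiberBundle.mem_baseSet_trivializationAt' (ι y)
      have hNE : ContMDiffOn (cornerModel n) 𝓘(ℝ, F) ∞
          (fun z => (E ⟨ι z, N z⟩).2) (ι ⁻¹' E.baseSet) := by
        have h1 := (E.contMDiffOn (IB := cornerModel (n + 1)) (n := ∞)).comp hN.contMDiffOn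
          (s := ι ⁻¹' E.baseSet) fun z hz => by
            simpa [E.mem_source] using hz
        exact contMDiff_snd.comp_contMDiffOn h1
      have hzc := h.contMDiffOn_paramRetract
      set z := paramRetract χ R with hz
      have hzy : z (ι y) = y := h.paramRetract_incl hinj hyO
      obtain ⟨U', hU', hUe⟩ := continuousOn_iff'.1 hzc.continuousOn (ι ⁻¹' E.baseSet)
        (E.open_baseSet.preimage hι.isClosedEmbedding.continuous)
      have hUm : ∀ q ∈ O, q ∈ U' → ι (z q) ∈ E.baseSet := fun q hqO hqU => by
        have : q ∈ z ⁻¹' (ι ⁻¹' E.baseSet) ∩ O := by rw [hUe]; exact ⟨hqU, hqO⟩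
        exact this.1
      have hyU : ι y ∈ U' := by
        have : ι y ∈ z ⁻¹' (ι ⁻¹' E.baseSet) ∩ O :=
          ⟨by simp only [mem_preimage, hzy]; exact hbase, hyO⟩
        rw [hUe] at this
        exact this.1
      refine ⟨O ∩ U' ∩ E.baseSet, ((h.isOpen.inter hU').inter E.open_baseSet).mem_nhds
        ⟨⟨hyO, hyU⟩, hbase⟩, fun q => E.symm q (E ⟨ι (z q), N (z q)⟩).2, ?_, ?_⟩
      · rw [E.contMDiffOn_section_iff ((h.isOpen.inter hU').inter E.open_baseSet)
          inter_subset_right]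
        refine (hNE.comp (hzc.mono fun q hq => hq.1.1) fun q hq => hUm q hq.1.1 hq.1.2).congr
          fun q hq => ?_
        rw [E.apply_mk_symm hq.2]
        rfl
      · rintro q hq w rfl
        have hzw : ∀ v, v = w → E.symm (ι w) (E ⟨ι v, N v⟩).2 = N w := by
          rintro v rfl
          exact E.symm_apply_apply_mk hq.2 (N v)
        exact hzw _ (h.paramRetract_incl hinj hq.1.1)
    · refine ⟨(range ι)ᶜ, hι.isClosedEmbedding.isClosed_range.isOpen_compl.mem_nhds hp,
        fun _ => 0, (Bundle.contMDiff_zeroSection ℝ A).contMDiffOn, ?_⟩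
      rintro q hq w rfl
      exact absurd (mem_range_self w) hq

end Sections

/-! ### Parametrizations by integral curves -/

section Flow

variable {n : ℕ} {M : Type*} [TopologicalSpace M]
  [ChartedSpace (EuclideanQuadrant (n + 1)) M]
  {Y : Type*} [TopologicalSpace Y] [ChartedSpace (EuclideanQuadrant n) Y]

/-- The chain rule for a change of coordinates in a parametrization. -/
theorem BoundaryParam.paramDeriv_comp {ι : Y → M}
    {χ : OpenPartialHomeomorph Y (EuclideanQuadrant n)}
    {c : EuclideanSpace ℝ (Fin (n + 1))} {e e' : ℝ} {G : EuclideanSpace ℝ (Fin (n + 1)) → M}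
    {R : M → EuclideanSpace ℝ (Fin (n + 1))} {O : Set M} (h : BoundaryParam ι χ c e G R O)
    {S : EuclideanSpace ℝ (Fin (n + 1)) → EuclideanSpace ℝ (Fin (n + 1))}
    {x : EuclideanSpace ℝ (Fin (n + 1))} (hS : DifferentiableWithinAt ℝ S (openBox c e') x)
    (hSm : MapsTo S (openBox c e') (openBox c e)) (hx : x ∈ openBox c e')
    (v : EuclideanSpace ℝ (Fin (n + 1))) :
    paramDeriv (G ∘ S) c e' x v =
      paramDeriv G c e (S x) (fderivWithin ℝ S (openBox c e') x v) := by
  have hu : UniqueMDiffWithinAt 𝓘(ℝ, EuclideanSpace ℝ (Fin (n + 1))) (openBox c e') x :=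
    (uniqueDiffOn_openBox x hx).uniqueMDiffWithinAt
  have h1 := (h.mdifferentiableWithinAt (hSm hx)).hasMFDerivWithinAt.comp x
    hS.hasFDerivWithinAt.hasMFDerivWithinAt hSm
  exact DFunLike.congr_fun (h1.mfderivWithin hu) v

variable [IsManifold (cornerModel (n + 1)) ∞ M]
  {F : Type*} [NormedAddCommGroup F] [NormedSpace ℝ F]
  {A : M → Type*} [TopologicalSpace (Bundle.TotalSpace F A)] [∀ p, TopologicalSpace (A p)]
  [∀ p, AddCommGroup (A p)] [∀ p, Module ℝ (A p)] [FiberBundle F A]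

theorem IsLieManifoldWithBoundary.contMDiff_anchor_section
    {ϱ : ∀ p : M, A p →ₗ[ℝ] TangentSpace (cornerModel (n + 1)) p} {ι : Y → M}
    (hM : IsLieManifoldWithBoundary F ϱ ι) {s : ∀ p, A p} (hs : IsSmoothSection n F s) :
    ContMDiff (cornerModel (n + 1)) (cornerModel (n + 1)).tangent ∞
      (fun p => (⟨p, ϱ p (s p)⟩ : TangentBundle (cornerModel (n + 1)) M)) :=
  hM.contMDiff_anchor.comp hs

omit [IsManifold (cornerModel (n + 1)) ∞ M] in
theorem mfderiv_chartCoord {φ : OpenPartialHomeomorph M (EuclideanQuadrant (n + 1))}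
    {p : M} (hd : MDifferentiableAt (cornerModel (n + 1)) 𝓘(ℝ, EuclideanSpace ℝ (Fin (n + 1)))
      (φ.extend (cornerModel (n + 1))) p) (i : Fin (n + 1))
    (v : TangentSpace (cornerModel (n + 1)) p) :
    mfderiv (cornerModel (n + 1)) 𝓘(ℝ, ℝ) (chartCoord φ i) p v =
      coordDeriv (φ.extend (cornerModel (n + 1))) p v i := by
  have h1 : HasMFDerivAt 𝓘(ℝ, EuclideanSpace ℝ (Fin (n + 1))) 𝓘(ℝ, ℝ)
      (EuclideanSpace.proj (𝕜 := ℝ) i : EuclideanSpace ℝ (Fin (n + 1)) → ℝ)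
      (φ.extend (cornerModel (n + 1)) p) (EuclideanSpace.proj (𝕜 := ℝ) i) :=
    (EuclideanSpace.proj (𝕜 := ℝ) i).hasFDerivAt.hasMFDerivAt
  exact DFunLike.congr_fun (h1.comp p hd.hasMFDerivAt).mfderiv v

/-- Integral curves of `ϱ s`, for a section `s` pointing inwards at `Y`, are the `x₀`-lines of an
adapted parametrization, up to a change of speed. -/
theorem IsLieManifoldWithBoundary.exists_boundaryParam_flow [T2Space M] [CompactSpace M]
    [∀ p, IsTopologicalAddGroup (A p)] [∀ p, ContinuousConstSMul ℝ (A p)] [VectorBundle ℝ F A]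
    {ϱ : ∀ p : M, A p →ₗ[ℝ] TangentSpace (cornerModel (n + 1)) p} {ι : Y → M}
    (hM : IsLieManifoldWithBoundary F ϱ ι) {s : ∀ p, A p} (hs : IsSmoothSection n F s)
    (hin : ∀ φ ∈ IsManifold.maximalAtlas (cornerModel (n + 1)) ∞ M, ∀ i y,
      FaceInside (range ι) φ i (ι y) → (0 : ℝ) <
        mfderiv (cornerModel (n + 1)) 𝓘(ℝ, ℝ) (chartCoord φ i) (ι y) (ϱ (ι y) (s (ι y)))) (y : Y) :
    ∃ χ c e G R O, BoundaryParam ι χ c e G R O ∧ ι y ∈ O ∧ R (ι y) = c ∧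
      ∃ (s' : ∀ p, A p) (α : M → ℝ), IsSmoothSection n F s' ∧
        ContMDiffOn (cornerModel (n + 1)) 𝓘(ℝ, ℝ) ∞ α O ∧
        (∀ p ∈ O, 0 < α p ∧ s' p = α p • s p) ∧
        ∀ x ∈ openBox c e,
          paramDeriv G c e x (EuclideanSpace.single 0 1) = ϱ (G x) (s' (G x)) := by
  obtain ⟨φ, hφ, χ, c, e, O, h, hyO, hOφ, hc, hr⟩ := hM.hypersurface.exists_boundaryParam y
  set R : M → EuclideanSpace ℝ (Fin (n + 1)) := fun p => φ.extend (cornerModel (n + 1)) p with hR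
  set G : EuclideanSpace ℝ (Fin (n + 1)) → M :=
    fun x => (φ.extend (cornerModel (n + 1))).symm x with hG
  replace h : BoundaryParam ι χ c e G R O := h
  replace hc : R (ι y) = c := hc
  set W : ∀ p : M, TangentSpace (cornerModel (n + 1)) p := fun p => ϱ p (s p) with hW
  have hWs := h.contDiffOn_coordField (hM.contMDiff_anchor_section hs)
  set w₀ := coordField R G W with hw₀
  have hRφ : ∀ p i, R p i = chartCoord φ i p := fun _ _ => rfl
  have hcoord : ∀ p ∈ O, ∀ i, ∀ v : TangentSpace (cornerModel (n + 1)) p,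
      mfderiv (cornerModel (n + 1)) 𝓘(ℝ, ℝ) (chartCoord φ i) p v = coordDeriv R p v i :=
    fun p hp i v => mfderiv_chartCoord (h.mdifferentiableAt_inv hp) i v
  have hcb : c ∈ openBox c e := mem_openBox_self h.center_mem h.pos
  have hGc : G c = ι y := by rw [← hc]; exact h.right_inv _ hyO
  have hpos : 0 < w₀ c 0 := by
    have h1 := hin φ hφ 0 y ⟨hOφ hyO, (hr _ (hOφ hyO)).1 (mem_range_self _),
      (φ.open_source.eventually_mem (hOφ hyO)).mono fun q hq h0 => (hr q hq).2 h0⟩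
    rw [hcoord _ hyO] at h1
    have h2 : ∀ q, q = ι y → 0 < coordDeriv R q (W q) 0 := by rintro q rfl; exact h1
    exact h2 _ hGc
  -- Fields of `𝒱` are tangent to the faces other than `{x₀ = 0}`.
  have htan : ∀ x ∈ openBox c e, ∀ i : Fin n, x i.succ = 0 → w₀ x i.succ = 0 := by
    intro x hx i hxi
    have hp := h.mapsTo hx
    have hRx := h.left_inv x hx
    have := hM.tangent_singular φ hφ i.succ (G x) ⟨hOφ hp, ?_, fun hev => ?_⟩ (s (G x))
    · rw [hcoord _ hp] at this
      exact this
    · rw [← hRφ, hRx, hxi]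
    · -- otherwise the points of this face with larger `x₀` would belong to `Y`
      have hx0 := h.apply_zero_mem hx
      have hm : ∀ᶠ t in 𝓝[>] (x 0), setZero t x ∈ openBox c e := by
        filter_upwards [self_mem_nhdsWithin, mem_nhdsWithin_of_mem_nhds (Iio_mem_nhds hx0.2)]
          with t ht ht'
        exact h.setZero_mem hx ⟨hx0.1.trans (le_of_lt ht), ht'⟩
      have hlim : Tendsto (fun t => G (setZero t x)) (𝓝[>] (x 0)) (𝓝 (G x)) := by
        have h1 := (h.contMDiffOn.continuousOn x hx).tendsto
        refine h1.comp (tendsto_nhdsWithin_iff.2 ⟨?_, hm⟩)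
        have h2 := (hasDerivAt_setZero x (x 0)).continuousAt.tendsto
        rw [setZero_self] at h2
        exact h2.mono_left nhdsWithin_le_nhds
      obtain ⟨t, ht1, ht2, ht3⟩ :=
        ((hlim.eventually hev).and (hm.and self_mem_nhdsWithin)).exists
      have hRt := h.left_inv _ ht2
      have h3 := (hr _ (hOφ (h.mapsTo ht2))).1
        (ht1 (by rw [← hRφ, hRt, setZero_succ, hxi]))
      rw [← hRφ, hRt, setZero_zero] at h3
      have : x 0 < t := ht3
      linarith [hx0.1]
  have hw₀c : ContinuousOn (fun x => w₀ x 0) (openBox c e) :=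
    (EuclideanSpace.proj (𝕜 := ℝ) (0 : Fin (n + 1))).continuous.comp_continuousOn hWs.continuousOn
  have hw₀s : ContDiffOn ℝ ∞ (fun x => w₀ x 0) (openBox c e) :=
    (EuclideanSpace.proj (𝕜 := ℝ) (0 : Fin (n + 1))).contDiff.comp_contDiffOn hWs
  -- The multiple of `s` whose `x₀`-component is `1` near `ι y`.
  obtain ⟨s', hs', hse⟩ : ∃ s' : ∀ p, A p, IsSmoothSection n F s' ∧
      ∀ᶠ q in 𝓝 (ι y), s' q = (w₀ (R q) 0)⁻¹ • s q := by
    have hf : ContMDiffOn (cornerModel (n + 1)) 𝓘(ℝ, ℝ) ∞ (fun q => w₀ (R q) 0) O :=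
      hw₀s.contMDiffOn.comp h.contMDiffOn_inv h.mapsTo_inv
    obtain ⟨U, hU, hUe⟩ := continuousOn_iff'.1 hf.continuousOn (Ioi 0) isOpen_Ioi
    have hU' : ∀ q ∈ O, q ∈ U ↔ 0 < w₀ (R q) 0 := fun q hq => by
      have := Set.ext_iff.1 hUe q
      simp only [mem_inter_iff, hq, and_true, mem_preimage, mem_Ioi] at this
      exact this.symm
    refine exists_isSmoothSection_eventuallyEq (U := O ∩ U) ((h.isOpen.inter hU).mem_nhds
      ⟨hyO, (hU' _ hyO).2 (by rw [hc]; exact hpos)⟩) ?_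
    refine ContMDiffOn.smul_section ?_ hs.contMDiffOn
    intro q hq
    exact ((contDiffAt_inv ℝ ((hU' q hq.1).1 hq.2).ne').contMDiffAt).comp_contMDiffWithinAt q
      ((hf q hq.1).mono inter_subset_left)
  have hnear : ∀ᶠ x in 𝓝[quadrant (n + 1)] c, x ∈ openBox c e ∧ 0 < w₀ x 0 ∧
      s' (G x) = (w₀ x 0)⁻¹ • s (G x) := by
    have hb : openBox c e ∈ 𝓝[quadrant (n + 1)] c := by
      rw [openBox_eq]
      exact inter_mem self_mem_nhdsWithin
        (mem_nhdsWithin_of_mem_nhds ((isOpen_cube c e).mem_nhds fun i => by simpa using h.pos))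
    have h2 : ∀ᶠ x in 𝓝[openBox c e] c, 0 < w₀ x 0 :=
      (hw₀c c hcb).eventually (lt_mem_nhds hpos)
    have h3 : ∀ᶠ x in 𝓝[openBox c e] c, s' (G x) = (w₀ (R (G x)) 0)⁻¹ • s (G x) := by
      have h4 := (h.contMDiffOn.continuousOn c hcb).tendsto
      rw [hGc] at h4
      exact h4.eventually hse
    have hle : 𝓝[quadrant (n + 1)] c ≤ 𝓝[openBox c e] c := nhdsWithin_le_iff.2 hb
    filter_upwards [hb, hle h2, hle h3] with x hx1 hx2 hx3
    rw [h.left_inv x hx1] at hx3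
    exact ⟨hx1, hx2, hx3⟩
  obtain ⟨U, hU, hUs⟩ := mem_nhdsWithin_iff_exists_mem_nhds_inter.1 hnear
  have hUs' : ∀ x ∈ quadrant (n + 1) ∩ U, x ∈ openBox c e ∧ 0 < w₀ x 0 ∧
      s' (G x) = (w₀ x 0)⁻¹ • s (G x) := fun x hx => hUs ⟨hx.2, hx.1⟩
  obtain ⟨e', he', V, hV, hcV, S, T, hS, hT, hSm, hTm⟩ := exists_straightening h.center_mem
    h.center_zero hU (w := fun x => (w₀ x 0)⁻¹ • w₀ x)
    ((hw₀s.mono fun x hx => (hUs' x hx).1).inv (fun x hx => (hUs' x hx).2.1.ne') |>.smul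
      (hWs.mono fun x hx => (hUs' x hx).1))
    (fun x hx => by
      have := (hUs' x hx).2.1.ne'
      simp [this])
    (fun x hx i hi => by simp [htan x (hUs' x hx).1 i hi])
  have hSb : ∀ x ∈ openBox c e', S x ∈ openBox c e := fun x hx =>
    (hUs' _ ⟨(hSm x hx).1.1, (hSm x hx).2.1⟩).1
  have h' := h.comp he' hV hS hT
    (fun x hx => ⟨(hSm x hx).1.2, hSb x hx, (hSm x hx).2.2.1, (hSm x hx).2.2.2.2.1⟩)
    (fun x hx => ⟨(hTm x hx).1, (hTm x hx).2, fun hx0 => by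
      have := (hSm _ (hTm x hx).1).2.2.2.1
      rw [(hTm x hx).2, hx0] at this
      exact this.symm⟩)
  have hcb' := mem_openBox_self h.center_mem he'
  refine ⟨χ, c, e', G ∘ S, T ∘ R, _, h', ⟨hyO, ?_⟩, ?_, s', fun p => (w₀ (R p) 0)⁻¹, hs', ?_,
    fun p hp => ?_, fun x hx => ?_⟩
  · rw [mem_preimage, hc]; exact hcV
  · rw [Function.comp_apply, hc, ← (hSm c hcb').2.2.2.2.1 h.center_zero, (hSm c hcb').2.2.1,
      (hSm c hcb').2.2.2.2.1 h.center_zero]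
  · have h1 : ContDiffOn ℝ ∞ (fun x => (w₀ x 0)⁻¹) (quadrant (n + 1) ∩ U) :=
      (hw₀s.mono fun x hx => (hUs' x hx).1).inv fun x hx => (hUs' x hx).2.1.ne'
    refine h1.contMDiffOn.comp (h.contMDiffOn_inv.mono inter_subset_left) fun p hp => ?_
    have hTp := hTm (R p) ⟨openBox_subset (h.mapsTo_inv hp.1), hp.2⟩
    have h2 := (hSm _ hTp.1).2.1
    rw [hTp.2] at h2
    exact ⟨openBox_subset (h.mapsTo_inv hp.1), h2⟩
  · have hTp := hTm (R p) ⟨openBox_subset (h.mapsTo_inv hp.1), hp.2⟩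
    have h1 := (hSm _ hTp.1).2.1
    rw [hTp.2] at h1
    have h2 := hUs' (R p) ⟨openBox_subset (h.mapsTo_inv hp.1), h1⟩
    refine ⟨inv_pos.2 h2.2.1, ?_⟩
    have h3 := h2.2.2
    rw [h.right_inv p hp.1] at h3
    exact h3
  · have hx' := hUs' _ ⟨(hSm x hx).1.1, (hSm x hx).2.1⟩
    rw [h.paramDeriv_comp ((hS x hx).differentiableWithinAt (by simp)) hSb hx,
      (hSm x hx).2.2.2.2.2, map_smul]
    simp only [Function.comp_apply]
    rw [hx'.2.2, map_smul]
    congr 1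
    exact h.paramDeriv_coordDeriv (hSb x hx) (W (G (S x)))

end Flow

/-! ### Liouville's formula and the singular boundary -/

section Determinant

/-- Liouville's formula: the derivative of the determinant of a matrix whose rows solve a linear
system. -/
theorem hasDerivWithinAt_det_of_linear {m : ℕ} {Λ : ℝ → Matrix (Fin m) (Fin m) ℝ}
    {a : Matrix (Fin m) (Fin m) ℝ} {s : Set ℝ} {x : ℝ}
    (hΛ : ∀ k, HasDerivWithinAt (fun t => Λ t k) (∑ j, a k j • Λ x j) s x) :
    HasDerivWithinAt (fun t => (Λ t).det) (a.trace * (Λ x).det) s x := by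
  let D : ContinuousMultilinearMap ℝ (fun _ : Fin m => Fin m → ℝ) ℝ :=
    ⟨(Matrix.detRowAlternating (n := Fin m) (R := ℝ)).toMultilinearMap, by
      change Continuous fun A : Matrix (Fin m) (Fin m) ℝ => A.det
      exact continuous_id.matrix_det⟩
  have h1 := HasFDerivWithinAt.multilinear_comp (f := D) fun k => (hΛ k).hasFDerivWithinAt
  refine h1.hasDerivWithinAt.congr_deriv ?_
  simp only [FunLike.coe_sum, Finset.sum_apply, ContinuousLinearMap.comp_apply,
    ContinuousLinearMap.toSpanSingleton_apply, one_smul, Matrix.trace, Finset.sum_mul]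
  refine Finset.sum_congr rfl fun k _ => ?_
  exact Matrix.det_updateRow_sum (Λ x) k (a k)

end Determinant

section Interior

variable {n : ℕ}

/-- Near each point of a box there are points of the box with the same `x₀`-coordinate that lie on
no face of the quadrant other than `{x₀ = 0}`. -/
theorem exists_pos_tail_near {c x : EuclideanSpace ℝ (Fin (n + 1))} {e : ℝ}
    (hx : x ∈ openBox c e) {U : Set (EuclideanSpace ℝ (Fin (n + 1)))} (hU : U ∈ 𝓝 x) :
    ∃ x' ∈ U, x' ∈ openBox c e ∧ x' 0 = x 0 ∧ ∀ i : Fin n, 0 < x' i.succ := by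
  set v : EuclideanSpace ℝ (Fin (n + 1)) := consCoord (0, WithLp.toLp 2 fun _ => 1) with hv
  have hlim : Tendsto (fun t : ℝ => x + t • v) (𝓝[>] 0) (𝓝 x) := by
    have : Continuous fun t : ℝ => x + t • v := by fun_prop
    simpa using (this.tendsto 0).mono_left nhdsWithin_le_nhds
  have hx' := hx
  rw [openBox_eq] at hx'
  obtain ⟨t, ⟨h1, h2⟩, h3⟩ := (((hlim.eventually_mem hU).and (hlim.eventually_mem
    ((isOpen_cube c e).mem_nhds hx'.2))).and self_mem_nhdsWithin).exists
  have ht : 0 < t := h3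
  have hsucc : ∀ i : Fin n, 0 < (x + t • v) i.succ := fun i => by
    have := hx'.1 i.succ
    simp [hv]; positivity
  have h0 : (x + t • v) 0 = x 0 := by simp [hv]
  refine ⟨_, h1, ?_, h0, hsucc⟩
  rw [openBox_eq]
  refine ⟨fun i => ?_, h2⟩
  refine Fin.cases ?_ (fun i => (hsucc i).le) i
  rw [h0]; exact hx'.1 0

variable {M : Type*} [TopologicalSpace M]
  [ChartedSpace (EuclideanQuadrant (n + 1)) M]
  {Y : Type*} [TopologicalSpace Y] [ChartedSpace (EuclideanQuadrant n) Y]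

/-- In an adapted parametrization, an interior point of the quadrant is not on any boundary face
of a chart: at such a point a coordinate function would have a minimum, but its derivative does not
vanish. -/
theorem BoundaryParam.chartCoord_ne_zero {ι : Y → M}
    {χ : OpenPartialHomeomorph Y (EuclideanQuadrant n)}
    {c : EuclideanSpace ℝ (Fin (n + 1))} {e : ℝ} {G : EuclideanSpace ℝ (Fin (n + 1)) → M}
    {R : M → EuclideanSpace ℝ (Fin (n + 1))} {O : Set M} (h : BoundaryParam ι χ c e G R O)
    {φ : OpenPartialHomeomorph M (EuclideanQuadrant (n + 1))}
    (hφ : φ ∈ IsManifold.maximalAtlas (cornerModel (n + 1)) ∞ M)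
    {x : EuclideanSpace ℝ (Fin (n + 1))}
    (hx : x ∈ openBox c e) (hpos : ∀ i, 0 < x i) (hxφ : G x ∈ φ.source) (i : Fin (n + 1)) :
    chartCoord φ i (G x) ≠ 0 := by
  intro hi
  set I := cornerModel (n + 1) with hI
  set d := φ.extend I (G x) with hd
  have hdi : d i = 0 := hi
  -- the curve in the direction of the `i`-th coordinate of the chart `φ`
  set γ : ℝ → EuclideanSpace ℝ (Fin (n + 1)) := fun t => d + t • EuclideanSpace.single i 1 with hγ
  set K : ℝ → M := fun t => (φ.extend I).symm (γ t) with hK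
  have hγ0 : γ 0 = d := by simp [hγ]
  have hK0 : K 0 = G x := by
    simp only [hK, hγ0]
    exact (φ.extend I).left_inv (by rwa [φ.extend_source])
  set S : Set ℝ := Ici 0 ∩ γ ⁻¹' (φ.extend I).target with hS
  have hγQ : ∀ t ∈ Ici (0 : ℝ), γ t ∈ quadrant (n + 1) := by
    intro t ht j
    have h1 : 0 ≤ d j := by
      have : d ∈ quadrant (n + 1) := by rw [← range_cornerModel]; exact mem_range_self _
      exact this j
    have h2 : 0 ≤ (EuclideanSpace.single i (1 : ℝ)) j := by
      rw [PiLp.single_apply]; split_ifs <;> simp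
    have : γ t j = d j + t * (EuclideanSpace.single i (1 : ℝ)) j := by simp [hγ]
    rw [this]
    exact add_nonneg h1 (mul_nonneg ht h2)
  have hγc : Continuous γ := by fun_prop
  have htm : (φ.extend I).target ∈ 𝓝[quadrant (n + 1)] d := by
    rw [← range_cornerModel]
    exact φ.extend_target_mem_nhdsWithin hxφ
  have hSm : S ∈ 𝓝[≥] 0 := by
    have h1 : Tendsto γ (𝓝[≥] 0) (𝓝[quadrant (n + 1)] d) := by
      rw [← hγ0]
      exact hγc.continuousWithinAt.tendsto_nhdsWithin hγQ
    exact inter_mem self_mem_nhdsWithin (h1 htm)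
  have h0S : (0 : ℝ) ∈ S := mem_of_mem_nhdsWithin self_mem_Ici hSm
  have hKs : ContMDiffWithinAt 𝓘(ℝ, ℝ) I ∞ K S 0 := by
    have h1 := (contMDiffOn_extend_symm hφ).comp (f := γ) (s := S)
      ((by fun_prop : ContDiff ℝ ∞ γ).contMDiff.contMDiffOn) fun t ht => by
        have := ht.2
        rwa [mem_preimage, φ.extend_target'] at this
    exact h1 0 h0S
  have hRK : DifferentiableWithinAt ℝ (R ∘ K) S 0 := by
    have h1 : ContMDiffWithinAt 𝓘(ℝ, ℝ) 𝓘(ℝ, EuclideanSpace ℝ (Fin (n + 1))) ∞ (R ∘ K) S 0 := by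
      refine ContMDiffAt.comp_contMDiffWithinAt 0 ?_ hKs
      rw [hK0]
      exact (h.contMDiffOn_inv _ (h.mapsTo hx)).contMDiffAt (h.isOpen.mem_nhds (h.mapsTo hx))
    exact (h1.contDiffWithinAt).differentiableWithinAt (by simp)
  -- the coordinate function has a minimum at `x`
  have hbox : openBox c e ∈ 𝓝 x := by
    have hx' := hx
    rw [openBox_eq] at hx' ⊢
    refine inter_mem ?_ ((isOpen_cube c e).mem_nhds hx'.2)
    have h1 : ∀ j, ∀ᶠ y : EuclideanSpace ℝ (Fin (n + 1)) in 𝓝 x, 0 < y j := fun j =>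
      (EuclideanSpace.proj (𝕜 := ℝ) j).continuous.continuousAt.eventually (lt_mem_nhds (hpos j))
    filter_upwards [eventually_all.2 h1] with y hy j using (hy j).le
  set f : EuclideanSpace ℝ (Fin (n + 1)) → ℝ := fun y => φ.extend I (G y) i with hf
  have hfx : f x = 0 := hi
  have hmin : IsLocalMin f x := by
    refine Eventually.of_forall fun y => ?_
    rw [hfx]
    exact (φ (G y)).2 i
  have hfd : DifferentiableAt ℝ f x := by
    have h1 : ContMDiffAt 𝓘(ℝ, EuclideanSpace ℝ (Fin (n + 1)))
        𝓘(ℝ, EuclideanSpace ℝ (Fin (n + 1))) ∞ (fun y => φ.extend I (G y)) x :=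
      ContMDiffAt.comp x ((φ.contMDiffOn_extend hφ _ hxφ).contMDiffAt
        (φ.open_source.mem_nhds hxφ)) ((h.contMDiffOn x hx).contMDiffAt hbox)
    exact ((EuclideanSpace.proj (𝕜 := ℝ) i).differentiableAt.comp x
      (h1.contDiffAt.differentiableAt (by simp)))
  have hf0 := hmin.hasFDerivAt_eq_zero hfd.hasFDerivAt
  have hRK0 : (R ∘ K) 0 = x := by
    rw [Function.comp_apply, hK0, h.left_inv x hx]
  -- along the curve, the coordinate function has derivative `0` by the chain rule, but it is the
  -- parameter of the curve
  have hcomp : HasDerivWithinAt (f ∘ (R ∘ K)) 0 S 0 := by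
    have h1 := hfd.hasFDerivAt
    rw [hf0, ← hRK0] at h1
    exact h1.comp_hasDerivWithinAt 0 hRK.hasDerivWithinAt
  have hid : HasDerivWithinAt (f ∘ (R ∘ K)) 1 S 0 := by
    have h1 : K ⁻¹' O ∈ 𝓝[S] 0 := by
      have := hKs.continuousWithinAt.preimage_mem_nhdsWithin
        (t := O) (by rw [hK0]; exact h.isOpen.mem_nhds (h.mapsTo hx))
      exact this
    have h2 : ∀ t ∈ S, K t ∈ O → (f ∘ (R ∘ K)) t = t := by
      intro t ht htO
      simp only [hf, Function.comp_apply, h.right_inv _ htO]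
      rw [hK, (φ.extend I).right_inv ht.2]
      simp [hγ, hdi]
    refine (hasDerivWithinAt_id 0 S).congr_of_eventuallyEq ?_
      (h2 0 h0S (by rw [hK0]; exact h.mapsTo hx))
    filter_upwards [h1, self_mem_nhdsWithin] with t ht htS using h2 t htS ht
  have hu : UniqueDiffWithinAt ℝ S 0 :=
    ((uniqueDiffOn_Ici (0 : ℝ)) 0 self_mem_Ici).mono_nhds (by
      rw [← nhdsWithin_inter_of_mem hSm]
      exact nhdsWithin_mono _ inter_subset_left)
  have := hu.eq_deriv _ hcomp hid
  norm_num at this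

/-- In an adapted parametrization, points with positive coordinates `x₁, …, x_n` are off the
singular boundary. -/
theorem BoundaryParam.notMem_singularBoundary {ι : Y → M}
    {χ : OpenPartialHomeomorph Y (EuclideanQuadrant n)}
    {c : EuclideanSpace ℝ (Fin (n + 1))} {e : ℝ} {G : EuclideanSpace ℝ (Fin (n + 1)) → M}
    {R : M → EuclideanSpace ℝ (Fin (n + 1))} {O : Set M} (h : BoundaryParam ι χ c e G R O)
    {x : EuclideanSpace ℝ (Fin (n + 1))} (hx : x ∈ openBox c e) (hpos : ∀ i : Fin n, 0 < x i.succ) :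
    G x ∉ singularBoundary (n := n) (range ι) := by
  rintro ⟨φ, hφ, i, hxφ, -, hfr⟩
  refine hfr ?_
  have h1 : ContinuousAt R (G x) :=
    (h.contMDiffOn_inv.continuousOn.continuousAt (h.isOpen.mem_nhds (h.mapsTo hx)))
  have h2 : ∀ j : Fin n, ∀ᶠ q in 𝓝 (G x), 0 < R q j.succ := fun j => by
    refine ((EuclideanSpace.proj (𝕜 := ℝ) j.succ).continuous.continuousAt.comp h1).eventually
      (lt_mem_nhds ?_)
    simp only [Function.comp_apply, h.left_inv x hx]
    exact hpos j
  filter_upwards [h.isOpen.mem_nhds (h.mapsTo hx), φ.open_source.mem_nhds hxφ, eventually_all.2 h2]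
    with q hqO hqφ hq hq0
  have hRq := h.mapsTo_inv hqO
  rcases (h.apply_zero_mem hRq).1.eq_or_lt with h0 | h0
  · have := h.eq_incl _ hRq h0.symm
    rw [h.right_inv q hqO] at this
    exact this ▸ mem_range_self _
  · -- near `G x`, points off `Y` have only positive coordinates
    exfalso
    have h3 := h.right_inv q hqO
    refine h.chartCoord_ne_zero hφ hRq (Fin.cases h0 hq) (by rwa [h3]) i ?_
    rwa [h3]

end Interior

/-! ### Density of a frame along integral curves -/

section Volume

variable {n : ℕ} {M : Type*} [TopologicalSpace M]
  [ChartedSpace (EuclideanQuadrant (n + 1)) M]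
  {Y : Type*} [TopologicalSpace Y] [ChartedSpace (EuclideanQuadrant n) Y]
  {A : M → Type*} [∀ p, AddCommGroup (A p)] [∀ p, Module ℝ (A p)]

theorem LinearMap.inverseOrZero_apply {V W : Type*} [AddCommGroup V] [Module ℝ V]
    [AddCommGroup W] [Module ℝ W] {L : V →ₗ[ℝ] W} (h : Function.Bijective L) (v : V) :
    L.inverseOrZero (L v) = v := by
  rw [LinearMap.inverseOrZero, dif_pos h]
  exact (LinearEquiv.ofBijective L h).symm_apply_apply v

/-- The density `μ` on the tangent spaces of `M` in the coordinates of a parametrization. -/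
noncomputable def paramDensity
    (ϱ : ∀ p : M, A p →ₗ[ℝ] TangentSpace (cornerModel (n + 1)) p)
    (μ : ∀ p, OneDensity (n + 1) (A p)) (G : EuclideanSpace ℝ (Fin (n + 1)) → M)
    (c : EuclideanSpace ℝ (Fin (n + 1))) (e : ℝ) (x : EuclideanSpace ℝ (Fin (n + 1))) :
    OneDensity (n + 1) (EuclideanSpace ℝ (Fin (n + 1))) :=
  (tangentDensity ϱ μ (G x)).comap (paramDeriv G c e x).toLinearMap

/-- The coordinates of the vector fields `ϱ σ₀, …, ϱ σ_n` in a parametrization. -/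
noncomputable def frameMatrix
    (ϱ : ∀ p : M, A p →ₗ[ℝ] TangentSpace (cornerModel (n + 1)) p)
    (σ : Fin (n + 1) → ∀ p, A p) (R : M → EuclideanSpace ℝ (Fin (n + 1)))
    (G : EuclideanSpace ℝ (Fin (n + 1)) → M) (x : EuclideanSpace ℝ (Fin (n + 1))) :
    Matrix (Fin (n + 1)) (Fin (n + 1)) ℝ :=
  Matrix.of fun k => coordField R G (fun p => ϱ p (σ k p)) x

theorem EuclideanSpace.sum_apply_smul_single {m : ℕ} (x : EuclideanSpace ℝ (Fin m)) :
    ∑ i, x i • EuclideanSpace.single i (1 : ℝ) = x := by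
  ext j
  simp [Finset.sum_apply, Pi.single_apply]

namespace BoundaryParam

variable {ι : Y → M} {χ : OpenPartialHomeomorph Y (EuclideanQuadrant n)}
    {c : EuclideanSpace ℝ (Fin (n + 1))} {e : ℝ} {G : EuclideanSpace ℝ (Fin (n + 1)) → M}
    {R : M → EuclideanSpace ℝ (Fin (n + 1))} {O : Set M}
    {ϱ : ∀ p : M, A p →ₗ[ℝ] TangentSpace (cornerModel (n + 1)) p}
    {σ : Fin (n + 1) → ∀ p, A p}

/-- The anchor is bijective at a point iff it maps a frame to a basis of the tangent space. -/
theorem bijective_anchor_iff (h : BoundaryParam ι χ c e G R O)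
    {x : EuclideanSpace ℝ (Fin (n + 1))} (hx : x ∈ openBox c e)
    (B : Module.Basis (Fin (n + 1)) ℝ (A (G x))) (hB : ∀ k, B k = σ k (G x)) :
    Function.Bijective (ϱ (G x)) ↔ (frameMatrix ϱ σ R G x).det ≠ 0 := by
  have hQ : Function.Bijective (coordDeriv R (G x)) :=
    ⟨fun v w hvw => by rw [← h.paramDeriv_coordDeriv hx v, hvw, h.paramDeriv_coordDeriv hx w],
      fun v => ⟨_, h.coordDeriv_paramDeriv hx v⟩⟩
  let L : A (G x) →ₗ[ℝ] EuclideanSpace ℝ (Fin (n + 1)) :=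
    (coordDeriv R (G x)).toLinearMap ∘ₗ ϱ (G x)
  have hL : Function.Bijective (ϱ (G x)) ↔ Function.Bijective L :=
    (hQ.of_comp_iff' (ϱ (G x))).symm
  set E := (EuclideanSpace.basisFun (Fin (n + 1)) ℝ).toBasis with hE
  have hdet : E.det (fun k => L (B k)) = (frameMatrix ϱ σ R G x).det := by
    rw [Module.Basis.det_apply, ← Matrix.det_transpose]
    congr 1
    ext k i
    simp only [Matrix.transpose_apply, Module.Basis.toMatrix_apply, hB]
    simp [hE, L, frameMatrix, coordField]
  rw [hL, ← hdet, ← isUnit_iff_ne_zero, ← Module.Basis.is_basis_iff_det]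
  constructor
  · intro hb
    let B' := B.map (LinearEquiv.ofBijective L hb)
    have : (fun k => L (B k)) = B' := by ext k; simp [B']
    rw [this]
    exact ⟨B'.linearIndependent, B'.span_eq⟩
  · rintro ⟨h1, h2⟩
    let B' := Module.Basis.mk h1 h2.ge
    have : L = (B.equiv B' (Equiv.refl _)).toLinearMap := B.ext fun k => by simp [B']
    rw [this]
    exact (B.equiv B' (Equiv.refl _)).bijective

/-- The density of a frame, in terms of its coordinates. -/
theorem density_frame_eq (h : BoundaryParam ι χ c e G R O)
    {x : EuclideanSpace ℝ (Fin (n + 1))} (hx : x ∈ openBox c e)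
    (μ : ∀ p, OneDensity (n + 1) (A p)) (hb : Function.Bijective (ϱ (G x))) :
    μ (G x) (fun k => σ k (G x)) = |(frameMatrix ϱ σ R G x).det| *
      paramDensity ϱ μ G c e x (fun i => EuclideanSpace.single i 1) := by
  rw [← OneDensity.map_matrix']
  refine congrArg (μ (G x)) (funext fun k => ?_)
  have h1 : ∑ j, frameMatrix ϱ σ R G x k j • EuclideanSpace.single j (1 : ℝ) =
      coordDeriv R (G x) (ϱ (G x) (σ k (G x))) :=
    EuclideanSpace.sum_apply_smul_single _
  have h2 := h.paramDeriv_coordDeriv hx (ϱ (G x) (σ k (G x)))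
  refine (LinearMap.inverseOrZero_apply hb (σ k (G x))).symm.trans ?_
  refine congrArg (ϱ (G x)).inverseOrZero (h2.symm.trans ?_)
  exact congrArg (paramDeriv G c e x) h1.symm

end BoundaryParam

end Volume

section Transport

variable {n : ℕ} {M : Type*} [TopologicalSpace M]
  [ChartedSpace (EuclideanQuadrant (n + 1)) M] [IsManifold (cornerModel (n + 1)) ∞ M]
  {Y : Type*} [TopologicalSpace Y] [ChartedSpace (EuclideanQuadrant n) Y]
  {F : Type*} [NormedAddCommGroup F] [NormedSpace ℝ F]
  {A : M → Type*} [TopologicalSpace (Bundle.TotalSpace F A)] [∀ p, TopologicalSpace (A p)]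
  [∀ p, AddCommGroup (A p)] [∀ p, Module ℝ (A p)]
  [FiberBundle F A]

/-- The anchor is bijective at some points, so the rank of `A` is the dimension of `M`. -/
theorem IsLieManifoldWithBoundary.finrank_eq [Nonempty Y] [VectorBundle ℝ F A]
    {ϱ : ∀ p : M, A p →ₗ[ℝ] TangentSpace (cornerModel (n + 1)) p} {ι : Y → M}
    (hM : IsLieManifoldWithBoundary F ϱ ι) : Module.finrank ℝ F = n + 1 := by
  obtain ⟨y⟩ := ‹Nonempty Y›
  obtain ⟨φ, -, χ, c, e, O, h, -⟩ := hM.hypersurface.exists_boundaryParam y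
  obtain ⟨x, -, hx, -, hpos⟩ :=
    exists_pos_tail_near (mem_openBox_self h.center_mem h.pos) univ_mem
  have hb := hM.bijective_anchor _ (h.notMem_singularBoundary hx hpos)
  set p := (φ.extend (cornerModel (n + 1))).symm x
  have h1 := (LinearEquiv.ofBijective (ϱ p) hb).finrank_eq
  have h2 := ((trivializationAt F A p).continuousLinearEquivAt ℝ p
    (FiberBundle.mem_baseSet_trivializationAt' p)).toLinearEquiv.finrank_eq
  rw [← h2, h1]
  exact finrank_euclideanSpace_fin

/-- If the `x₀`-lines of a parametrization are integral curves of a field of `𝒱`, the determinant of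
the coordinates of a frame solves a linear differential equation with smooth coefficients along
these lines, as `𝒱` is closed under brackets. -/
theorem IsLieManifoldWithBoundary.det_frameMatrix_eq
    {ϱ : ∀ p : M, A p →ₗ[ℝ] TangentSpace (cornerModel (n + 1)) p} {ι : Y → M}
    (hM : IsLieManifoldWithBoundary F ϱ ι)
    {χ : OpenPartialHomeomorph Y (EuclideanQuadrant n)}
    {c : EuclideanSpace ℝ (Fin (n + 1))} {e : ℝ} {G : EuclideanSpace ℝ (Fin (n + 1)) → M}
    {R : M → EuclideanSpace ℝ (Fin (n + 1))} {O : Set M} (h : BoundaryParam ι χ c e G R O)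
    {s : ∀ p, A p}
    (hs : ContMDiff (cornerModel (n + 1)) ((cornerModel (n + 1)).prod 𝓘(ℝ, F)) ∞
      (fun p => (⟨p, s p⟩ : Bundle.TotalSpace F A)))
    (hflow : ∀ x ∈ openBox c e,
      paramDeriv G c e x (EuclideanSpace.single 0 1) = ϱ (G x) (s (G x)))
    {σ : Fin (n + 1) → ∀ p, A p}
    (hσ : ∀ k, ContMDiff (cornerModel (n + 1)) ((cornerModel (n + 1)).prod 𝓘(ℝ, F)) ∞
      (fun p => (⟨p, σ k p⟩ : Bundle.TotalSpace F A)))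
    (hframe : ∀ t : ∀ p, A p,
      ContMDiff (cornerModel (n + 1)) ((cornerModel (n + 1)).prod 𝓘(ℝ, F)) ∞
        (fun p => (⟨p, t p⟩ : Bundle.TotalSpace F A)) → ∃ a : Fin (n + 1) → M → ℝ,
        (∀ k, ContMDiffOn (cornerModel (n + 1)) 𝓘(ℝ, ℝ) ∞ (a k) O) ∧
        ∀ q ∈ O, t q = ∑ k, a k q • σ k q) {b : ℝ} (hb : 0 < b) (hbe : 2 * b < e) :
    ∃ Q : EuclideanSpace ℝ (Fin (n + 1)) → ℝ, ContDiffOn ℝ ∞ Q (quadrantBox c b) ∧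
      (∀ x, x 0 = 0 → Q x = 0) ∧ ∀ x ∈ quadrantBox c b,
        (frameMatrix ϱ σ R G x).det = (frameMatrix ϱ σ R G (setZero 0 x)).det * Real.exp (Q x) := by
  have hbox : quadrantBox c (2 * b) ⊆ openBox c e := quadrantBox_subset_openBox hbe
  have hbox1 : quadrantBox c b ⊆ openBox c e := quadrantBox_subset_openBox (by linarith)
  have hX : ∀ t : ∀ p, A p,
      ContMDiff (cornerModel (n + 1)) ((cornerModel (n + 1)).prod 𝓘(ℝ, F)) ∞
        (fun p => (⟨p, t p⟩ : Bundle.TotalSpace F A)) →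
      ContMDiff (cornerModel (n + 1)) (cornerModel (n + 1)).tangent ∞
      (fun p => (⟨p, ϱ p (t p)⟩ : TangentBundle (cornerModel (n + 1)) M)) :=
    fun t ht => hM.contMDiff_anchor.comp ht
  set X : Fin (n + 1) → EuclideanSpace ℝ (Fin (n + 1)) → EuclideanSpace ℝ (Fin (n + 1)) :=
    fun k => coordField R G (fun p => ϱ p (σ k p)) with hXdef
  have hXs : ∀ k, ContDiffOn ℝ ∞ (X k) (openBox c e) := fun k =>
    h.contDiffOn_coordField (hX _ (hσ k))
  have hconst : ∀ x ∈ openBox c e,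
      coordField R G (fun p => ϱ p (s p)) x = EuclideanSpace.single 0 1 := fun x hx => by
    have := h.coordDeriv_paramDeriv hx (EuclideanSpace.single 0 1)
    rw [hflow x hx] at this
    exact this
  -- the brackets with `ϱ s`, i.e. the derivatives in the direction of `x₀`, in terms of the frame
  have hbr : ∀ k, ∃ a : Fin (n + 1) → M → ℝ,
      (∀ j, ContMDiffOn (cornerModel (n + 1)) 𝓘(ℝ, ℝ) ∞ (a j) O) ∧
      ∀ x ∈ openBox c e, fderivWithin ℝ (X k) (openBox c e) x (EuclideanSpace.single 0 1) =
        ∑ j, a j (G x) • X j x := by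
    intro k
    obtain ⟨t, ht, hte⟩ := hM.lieBracket_mem _ ⟨s, hs, rfl⟩ _ ⟨σ k, hσ k, rfl⟩
    obtain ⟨a, ha, hae⟩ := hframe t ht
    refine ⟨a, ha, fun x hx => ?_⟩
    have h1 := h.coordField_mlieBracket (hX _ hs) (hX _ (hσ k)) hx
    rw [hte] at h1
    have h2 : coordField R G (fun p => ϱ p (t p)) x = ∑ j, a j (G x) • X j x := by
      simp only [hXdef, coordField]
      rw [hae _ (h.mapsTo hx)]
      simp only [map_sum, map_smul]
    have h3 : fderivWithin ℝ (coordField R G (fun p => ϱ p (s p))) (openBox c e) x = 0 := by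
      rw [fderivWithin_congr hconst (hconst x hx)]
      exact fderivWithin_const_apply ..
    rw [h2, VectorField.lieBracketWithin, h3, hconst x hx] at h1
    simpa using h1.symm
  choose a ha hae using hbr
  have htr : ContDiffOn ℝ ∞ (fun x => ∑ k, a k k (G x)) (quadrantBox c (2 * b)) := by
    refine ContDiffOn.sum fun k _ => ?_
    exact ((ha k k).comp h.contMDiffOn h.mapsTo).contDiffOn.mono hbox
  obtain ⟨Q, hQ, hQ0, hQd⟩ := exists_primitive h.center_mem h.center_zero hb htr
  refine ⟨Q, hQ, hQ0, fun x hx => ?_⟩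
  have hdet : ∀ x ∈ quadrantBox c b, HasDerivWithinAt
      (fun t => (frameMatrix ϱ σ R G (setZero t x)).det)
      ((∑ k, a k k (G x)) * (frameMatrix ϱ σ R G x).det) (Icc 0 b) (x 0) := by
    intro x hx
    have hrow : ∀ k, HasDerivWithinAt (fun t => frameMatrix ϱ σ R G (setZero t x) k)
        (∑ j, (Matrix.of fun k j => a k j (G x)) k j • frameMatrix ϱ σ R G (setZero (x 0) x) j)
        (Icc 0 b) (x 0) := by
      intro k
      have h1 : HasFDerivWithinAt (X k) (fderivWithin ℝ (X k) (openBox c e) x) (openBox c e)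
          (setZero (x 0) x) := by
        rw [setZero_self]
        exact ((hXs k x (hbox1 hx)).differentiableWithinAt (by simp)).hasFDerivWithinAt
      have hm : MapsTo (fun t => setZero t x) (Icc 0 b) (openBox c e) := fun t ht =>
        hbox1 (setZero_mem_quadrantBox h.center_zero hx ht)
      have h2 := h1.comp_hasDerivWithinAt (x 0) (hasDerivAt_setZero x (x 0)).hasDerivWithinAt hm
      rw [hae k x (hbox1 hx)] at h2
      have h3 := ((EuclideanSpace.equiv (Fin (n + 1)) ℝ).hasFDerivAt
        (x := (X k ∘ fun t => setZero t x) (x 0))).comp_hasDerivWithinAt (x 0) h2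
      refine h3.congr_deriv ?_
      rw [setZero_self]
      simp only [map_sum, map_smul, Matrix.of_apply]
      rfl
    have h4 := hasDerivWithinAt_det_of_linear hrow
    rw [setZero_self] at h4
    exact h4
  -- `det * exp (-Q)` is constant along the lines, where `Q` is the primitive of the trace
  have hz := eq_setZero_of_hasDerivWithinAt (b := b) (x := x)
    (f := fun x => (frameMatrix ϱ σ R G x).det * Real.exp (-Q x))
    (apply_zero_mem_Icc h.center_zero hx) (fun t ht => by
      have ht' := setZero_mem_quadrantBox h.center_zero hx ht
      have h1 := (hdet _ ht').mul ((hQd _ ht').neg.exp)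
      simp only [setZero_setZero, setZero_zero] at h1
      refine h1.congr_deriv ?_
      simp only [Pi.neg_apply]
      ring)
  simp only [hQ0 _ (setZero_zero 0 x), neg_zero, Real.exp_zero, mul_one] at hz
  rw [← hz, mul_assoc, ← Real.exp_add]
  simp

end Transport

/-! ### Transition maps and Gram determinants -/

section Transition

variable {n : ℕ}

/-- The effect on a density of a linear map which preserves the direction of the first coordinate
vector. -/
theorem OneDensity.map_single_of_eigenvector
    (δ : OneDensity (n + 1) (EuclideanSpace ℝ (Fin (n + 1))))
    (L : EuclideanSpace ℝ (Fin (n + 1)) →L[ℝ] EuclideanSpace ℝ (Fin (n + 1))) {a : ℝ}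
    (hL : L (EuclideanSpace.single 0 1) = a • EuclideanSpace.single 0 1) :
    δ (fun i => L (EuclideanSpace.single i 1)) =
      |a| * |(Matrix.of fun i j : Fin n => tailCoord (L (EuclideanSpace.single i.succ 1)) j).det| *
        δ (fun i => EuclideanSpace.single i 1) := by
  have h := δ.map_matrix' (Matrix.of fun i j => L (EuclideanSpace.single i 1) j)
    (fun i => EuclideanSpace.single i 1)
  simp only [Matrix.of_apply, EuclideanSpace.sum_apply_smul_single] at h
  refine h.trans ?_
  rw [Matrix.det_succ_row_zero, Fin.sum_univ_succ, Finset.sum_eq_zero, add_zero]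
  · have h0 : (Matrix.of fun i j => L (EuclideanSpace.single i 1) j) 0 0 = a := by simp [hL]
    rw [h0, ← abs_mul]
    simp only [Fin.val_zero, pow_zero, one_mul, Fin.succAbove_zero]
    rfl
  · intro j _
    simp [hL]

/-- A density is determined by its value at a basis. -/
theorem OneDensity.eq_of_single {δ δ' : OneDensity (n + 1) (EuclideanSpace ℝ (Fin (n + 1)))}
    (h : δ (fun i => EuclideanSpace.single i 1) = δ' (fun i => EuclideanSpace.single i 1))
    (v : Fin (n + 1) → EuclideanSpace ℝ (Fin (n + 1))) : δ v = δ' v := by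
  have h1 := δ.map_matrix' (Matrix.of fun i j => v i j) (fun i => EuclideanSpace.single i 1)
  have h2 := δ'.map_matrix' (Matrix.of fun i j => v i j) (fun i => EuclideanSpace.single i 1)
  simp only [Matrix.of_apply, EuclideanSpace.sum_apply_smul_single] at h1 h2
  rw [h1, h2, h]

variable {M : Type*} [TopologicalSpace M]
  [ChartedSpace (EuclideanQuadrant (n + 1)) M]
  {Y : Type*} [TopologicalSpace Y] [ChartedSpace (EuclideanQuadrant n) Y]
  {A : M → Type*} [∀ p, AddCommGroup (A p)] [∀ p, Module ℝ (A p)]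

namespace BoundaryParam

variable {ι : Y → M} {χ χ' : OpenPartialHomeomorph Y (EuclideanQuadrant n)}
    {c c' : EuclideanSpace ℝ (Fin (n + 1))} {e e' : ℝ} {G G' : EuclideanSpace ℝ (Fin (n + 1)) → M}
    {R R' : M → EuclideanSpace ℝ (Fin (n + 1))} {O O' : Set M}

theorem paramDeriv_restrict (h : BoundaryParam ι χ c e G R O) (hee : e' ≤ e)
    {x : EuclideanSpace ℝ (Fin (n + 1))} (hx : x ∈ openBox c e') :
    paramDeriv G c e' x = paramDeriv G c e x :=
  mfderivWithin_subset (openBox_mono hee) (uniqueDiffOn_openBox x hx).uniqueMDiffWithinAt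
    (h.mdifferentiableWithinAt (openBox_mono hee hx))

/-- The derivative of the transition map between two parametrizations. -/
noncomputable def _root_.transitionDeriv (R' : M → EuclideanSpace ℝ (Fin (n + 1)))
    (G : EuclideanSpace ℝ (Fin (n + 1)) → M) (c : EuclideanSpace ℝ (Fin (n + 1))) (e : ℝ)
    (x : EuclideanSpace ℝ (Fin (n + 1))) :
    EuclideanSpace ℝ (Fin (n + 1)) →L[ℝ] EuclideanSpace ℝ (Fin (n + 1)) :=
  (coordDeriv R' (G x)).comp (paramDeriv G c e x)

theorem hasFDerivWithinAt_transition (h : BoundaryParam ι χ c e G R O)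
    (h' : BoundaryParam ι χ' c' e' G' R' O') {x : EuclideanSpace ℝ (Fin (n + 1))}
    (hx : x ∈ openBox c e) (hxO : G x ∈ O') :
    HasFDerivWithinAt (fun x => R' (G x)) (transitionDeriv R' G c e x) (openBox c e) x :=
  ((h'.mdifferentiableAt_inv hxO).hasMFDerivAt.comp_hasMFDerivWithinAt x
    (h.mdifferentiableWithinAt hx).hasMFDerivWithinAt).hasFDerivWithinAt

theorem paramDeriv_transitionDeriv
    (h' : BoundaryParam ι χ' c' e' G' R' O') {x : EuclideanSpace ℝ (Fin (n + 1))}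
    (hxO : G x ∈ O') (v : EuclideanSpace ℝ (Fin (n + 1))) :
    (paramDeriv G' c' e' (R' (G x)) (transitionDeriv R' G c e x v) :
      EuclideanSpace ℝ (Fin (n + 1))) = paramDeriv G c e x v := by
  have h1 := h'.paramDeriv_coordDeriv (h'.mapsTo_inv hxO)
  have h2 : ∀ p, p = G x → ∀ w : EuclideanSpace ℝ (Fin (n + 1)),
      (coordDeriv R' p w : EuclideanSpace ℝ (Fin (n + 1))) = coordDeriv R' (G x) w := by
    rintro p rfl w; rfl
  refine Eq.trans ?_ (h1 (paramDeriv G c e x v : EuclideanSpace ℝ (Fin (n + 1))))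
  exact congrArg (paramDeriv G' c' e' (R' (G x)))
    (h2 _ (h'.right_inv _ hxO) (paramDeriv G c e x v)).symm

/-- The transformation rule of densities. -/
theorem paramDensity_transition
    (h' : BoundaryParam ι χ' c' e' G' R' O') {x : EuclideanSpace ℝ (Fin (n + 1))}
    (hxO : G x ∈ O') (ϱ : ∀ p : M, A p →ₗ[ℝ] TangentSpace (cornerModel (n + 1)) p)
    (μ : ∀ p, OneDensity (n + 1) (A p)) (v : Fin (n + 1) → EuclideanSpace ℝ (Fin (n + 1))) :
    paramDensity ϱ μ G c e x v =
      paramDensity ϱ μ G' c' e' (R' (G x)) (fun i => transitionDeriv R' G c e x (v i)) := by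
  have h2 : ∀ p, p = G x → ∀ w : Fin (n + 1) → EuclideanSpace ℝ (Fin (n + 1)),
      (tangentDensity ϱ μ p).toFun w = (tangentDensity ϱ μ (G x)).toFun w := by
    rintro p rfl w; rfl
  refine Eq.trans ?_ (h2 _ (h'.right_inv _ hxO) _).symm
  exact congrArg (tangentDensity ϱ μ (G x)).toFun
    (funext fun i => (h'.paramDeriv_transitionDeriv hxO (v i)).symm)

end BoundaryParam

end Transition

section Metric

variable {n : ℕ} {M : Type*} [TopologicalSpace M]
  [ChartedSpace (EuclideanQuadrant (n + 1)) M]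
  {F : Type*} [NormedAddCommGroup F] [NormedSpace ℝ F]
  {A : M → Type*} [TopologicalSpace (Bundle.TotalSpace F A)] [∀ p, TopologicalSpace (A p)]
  [∀ p, AddCommGroup (A p)] [∀ p, Module ℝ (A p)]
  [FiberBundle F A] [VectorBundle ℝ F A]

/-- The Gram determinant of linearly independent vectors is positive. -/
theorem gram_det_pos (g : Bundle.ContMDiffRiemannianMetric (cornerModel (n + 1)) ∞ F A)
    {p : M} {k : ℕ} {v : Fin k → A p} (hv : LinearIndependent ℝ v) :
    0 < (Matrix.of fun i j => g.inner p (v i) (v j)).det := by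
  refine Matrix.PosDef.det_pos (Matrix.PosDef.of_dotProduct_mulVec_pos ?_ fun x hx => ?_)
  · ext i j
    simp [g.symm p]
  · have h1 : ∑ i, x i • v i ≠ 0 := fun h0 =>
      hx (funext (Fintype.linearIndependent_iff.1 hv x h0))
    have h2 := g.pos p _ h1
    refine h2.trans_eq ?_
    simp only [map_sum, map_smul, sum_apply, smul_apply, smul_eq_mul, dotProduct, Matrix.mulVec,
      Matrix.of_apply, star_trivial, Finset.mul_sum]
    rw [Finset.sum_comm]
    refine Finset.sum_congr rfl fun i _ => Finset.sum_congr rfl fun j _ => ?_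
    ring

theorem contMDiff_gram_det (g : Bundle.ContMDiffRiemannianMetric (cornerModel (n + 1)) ∞ F A)
    {k : ℕ} {σ : Fin k → ∀ p, A p}
    (hσ : ∀ k, ContMDiff (cornerModel (n + 1)) ((cornerModel (n + 1)).prod 𝓘(ℝ, F)) ∞
      (fun p => (⟨p, σ k p⟩ : Bundle.TotalSpace F A))) :
    ContMDiff (cornerModel (n + 1)) 𝓘(ℝ, ℝ) ∞
      (fun p => (Matrix.of fun i j => g.inner p (σ i p) (σ j p)).det) := by
  have h1 : ∀ i j, ContMDiff (cornerModel (n + 1)) 𝓘(ℝ, ℝ) ∞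
      (fun p => g.inner p (σ i p) (σ j p)) := by
    intro i j
    have h2 := ContMDiff.clm_bundle_apply₂ (F₁ := F) (F₂ := F) (F₃ := ℝ) (E₁ := A) (E₂ := A)
      (E₃ := Bundle.Trivial M ℝ) g.contMDiff (hσ i) (hσ j)
    intro p
    have h3 := h2 p
    rw [Bundle.contMDiffAt_section] at h3
    exact h3
  simp only [Matrix.det_apply']
  exact contMDiff_finsetSum fun τ _ =>
    contMDiff_const.mul (contMDiff_finsetProd fun i _ => h1 _ _)

end Metric

/-! ### Normal forms -/

section Reparam

variable {n : ℕ} {M : Type*} [TopologicalSpace M]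
  [ChartedSpace (EuclideanQuadrant (n + 1)) M]
  {Y : Type*} [TopologicalSpace Y] [ChartedSpace (EuclideanQuadrant n) Y]
  {A : M → Type*} [∀ p, AddCommGroup (A p)] [∀ p, Module ℝ (A p)]

namespace BoundaryParam

variable {ι : Y → M} {χ χ' : OpenPartialHomeomorph Y (EuclideanQuadrant n)}
    {c c' : EuclideanSpace ℝ (Fin (n + 1))} {e e' : ℝ} {G G' : EuclideanSpace ℝ (Fin (n + 1)) → M}
    {R R' : M → EuclideanSpace ℝ (Fin (n + 1))} {O O' : Set M}

/-- The change of the first coordinate of a parametrization to a function `H` which increases along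
the `x₀`-lines and vanishes for `x₀ = 0`. -/
theorem exists_reparam (h : BoundaryParam ι χ c e G R O) {b : ℝ} (hb : 0 < b) (hbe : b < e)
    {f H : EuclideanSpace ℝ (Fin (n + 1)) → ℝ} (hf : ContinuousOn f (quadrantBox c b))
    (hpos : ∀ x ∈ quadrantBox c b, 0 < f x) (hH : ContDiffOn ℝ ∞ H (quadrantBox c b))
    (hH0 : ∀ x, x 0 = 0 → H x = 0) (hHd : ∀ x ∈ quadrantBox c b,
        HasDerivWithinAt (fun s => H (setZero s x)) (f x) (Icc 0 b) (x 0)) :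
    ∃ e' K O', BoundaryParam ι χ c e' (G ∘ K) ((fun x => setZero (H x) x) ∘ R) O' ∧ G c ∈ O' ∧
      O' ⊆ O ∧ ∀ y ∈ openBox c e', K y ∈ openBox c b ∧ setZero (H (K y)) (K y) = y ∧
        (y 0 = 0 → K y = y) := by
  obtain ⟨hH1, e', he', heb, K, hK, hKm, hKT⟩ :=
    exists_inverse_of_primitive h.center_mem h.center_zero hb hf hpos hH hH0 hHd
  set T : EuclideanSpace ℝ (Fin (n + 1)) → EuclideanSpace ℝ (Fin (n + 1)) :=
    fun x => setZero (H x) x with hT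
  have hbq : openBox c b ⊆ quadrantBox c b := openBox_subset_quadrantBox
  have hTs : ContDiffOn ℝ ∞ T (openBox c b) :=
    contDiff_setZero.comp_contDiffOn ((hH.mono hbq).prodMk contDiffOn_id)
  have hTQ : ∀ x ∈ openBox c b, T x ∈ quadrant (n + 1) := fun x hx i => by
    refine Fin.cases ?_ (fun i => ?_) i
    · simpa [hT] using (hH1 x (hbq hx)).1
    · simpa [hT] using (hx i.succ).1
  obtain ⟨V', hV', hVe⟩ := continuousOn_iff'.1 hTs.continuousOn _ (isOpen_cube c e')
  have hV : ∀ x, x ∈ quadrant (n + 1) ∩ (V' ∩ {x | ∀ i, x i ∈ Metric.ball (c i) b}) ↔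
      x ∈ openBox c b ∧ T x ∈ openBox c e' := by
    intro x
    have hx : x ∈ openBox c b → (x ∈ V' ↔ T x ∈ openBox c e') := by
      intro hx
      have h1 : x ∈ V' ↔ T x ∈ {x | ∀ i, x i ∈ Metric.ball (c i) e'} := by
        have := Set.ext_iff.1 hVe x
        simp only [mem_inter_iff, hx, and_true, mem_preimage] at this
        exact this.symm
      rw [h1, openBox_eq]
      simp [hTQ x hx]
    constructor
    · rintro ⟨h1, h2, h3⟩
      have h4 : x ∈ openBox c b := by rw [openBox_eq]; exact ⟨h1, h3⟩
      exact ⟨h4, (hx h4).1 h2⟩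
    · rintro ⟨h1, h2⟩
      have h3 := h1
      rw [openBox_eq] at h3
      exact ⟨h3.1, (hx h1).2 h2, h3.2⟩
  have hK0 : ∀ y ∈ openBox c e', y 0 = 0 → K y = y := by
    intro y hy h0
    obtain ⟨h1, h2⟩ := hKm y hy
    have h3 : H (K y) = 0 := by rw [← h0, ← h2, setZero_zero, h2]
    have h4 := (hH1 _ (hbq h1)).2 h3
    rwa [h3, setZero_of_eq h4] at h2
  have hKV : ∀ y ∈ openBox c e',
      K y ∈ quadrant (n + 1) ∩ (V' ∩ {x | ∀ i, x i ∈ Metric.ball (c i) b}) := fun y hy => by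
    refine (hV _).2 ⟨(hKm y hy).1, ?_⟩
    rw [show T (K y) = y from (hKm y hy).2]
    exact hy
  have hcb := mem_openBox_self h.center_mem he'
  refine ⟨e', K, _, h.comp he' (hV'.inter (isOpen_cube c b)) hK
    (hTs.mono fun x hx => ((hV x).1 hx).1) (fun y hy => ⟨(hKV y hy).2,
      openBox_mono hbe.le (hKm y hy).1, (hKm y hy).2, hK0 y hy⟩) (fun x hx =>
      ⟨((hV x).1 hx).2, hKT x (hbq ((hV x).1 hx).1) ((hV x).1 hx).2, fun h0 => by
        rw [setZero_zero, hH0 x h0]⟩), ?_, inter_subset_left,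
    fun y hy => ⟨(hKm y hy).1, (hKm y hy).2, hK0 y hy⟩⟩
  have hce := mem_openBox_self h.center_mem h.pos
  refine ⟨h.mapsTo hce, ?_⟩
  rw [mem_preimage, h.left_inv _ hce]
  have := hKV c hcb
  rw [hK0 c hcb h.center_zero] at this
  exact this.2

/-- The derivative of a change of the first coordinate to `H` is triangular: it multiplies the
direction of the `x₀`-lines by the derivative of `H` and does not affect the other coordinates. -/
theorem transitionDeriv_reparam (h : BoundaryParam ι χ c e G R O)
    {H : EuclideanSpace ℝ (Fin (n + 1)) → ℝ}
    (h' : BoundaryParam ι χ' c' e' G' ((fun x => setZero (H x) x) ∘ R) O')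
    {x : EuclideanSpace ℝ (Fin (n + 1))} (hx : x ∈ openBox c e) (hxO : G x ∈ O') {a b : ℝ}
    (hb : 0 < b) (hx0 : x 0 ∈ Icc 0 b) (hm : ∀ s ∈ Icc 0 b, setZero s x ∈ openBox c e)
    (hd : HasDerivWithinAt (fun s => H (setZero s x)) a (Icc 0 b) (x 0)) :
    transitionDeriv ((fun x => setZero (H x) x) ∘ R) G c e x (EuclideanSpace.single 0 1) =
        a • EuclideanSpace.single 0 1 ∧
      ∀ v, tailCoord (transitionDeriv ((fun x => setZero (H x) x) ∘ R) G c e x v) =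
        tailCoord v := by
  have hD := h.hasFDerivWithinAt_transition h' hx hxO
  have he : ∀ z ∈ openBox c e, ((fun x => setZero (H x) x) ∘ R) (G z) = setZero (H z) z :=
    fun z hz => by simp only [Function.comp_apply, h.left_inv z hz]
  constructor
  · have h1 := hD
    rw [← setZero_self x] at h1
    have h2 := h1.comp_hasDerivWithinAt (x 0) (hasDerivAt_setZero x (x 0)).hasDerivWithinAt hm
    have h3 : HasDerivWithinAt (fun s => setZero (H (setZero s x)) x)
        (a • EuclideanSpace.single 0 1) (Icc 0 b) (x 0) :=
      (hasDerivAt_setZero x _).scomp_hasDerivWithinAt (x 0) hd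
    have h4 := (uniqueDiffOn_Icc hb (x 0) hx0).eq_deriv _ h2 (h3.congr
      (fun s hs => by simp only [Function.comp_apply]; rw [h.left_inv _ (hm s hs), setZero_setZero])
      (by simp only [Function.comp_apply]; rw [h.left_inv _ (hm _ hx0), setZero_setZero]))
    rwa [setZero_self] at h4
  · intro v
    have h1 : HasFDerivWithinAt (fun z => tailCoord (((fun x => setZero (H x) x) ∘ R) (G z)))
        (tailCoord.comp (transitionDeriv ((fun x => setZero (H x) x) ∘ R) G c e x))
        (openBox c e) x := tailCoord.hasFDerivAt.comp_hasFDerivWithinAt x hD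
    have h2 : HasFDerivWithinAt (fun z => tailCoord (((fun x => setZero (H x) x) ∘ R) (G z)))
        tailCoord (openBox c e) x :=
      tailCoord.hasFDerivAt.hasFDerivWithinAt.congr (fun z hz => by rw [he z hz, tailCoord_setZero])
        (by rw [he x hx, tailCoord_setZero])
    exact DFunLike.congr_fun ((uniqueDiffOn_openBox x hx).eq h1 h2) v

end BoundaryParam

/-- A parametrization whose `x₀`-lines are the integral curves of `ϱ s`, up to a positive factor
that is `1` on `{x₀ = 0}`, and for which the density `μ` does not depend on `x₀`. -/
structure NormalParam (ϱ : ∀ p : M, A p →ₗ[ℝ] TangentSpace (cornerModel (n + 1)) p)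
    (μ : ∀ p, OneDensity (n + 1) (A p)) (s : ∀ p, A p) (ι : Y → M)
    (χ : OpenPartialHomeomorph Y (EuclideanQuadrant n))
    (c : EuclideanSpace ℝ (Fin (n + 1))) (e : ℝ) (G : EuclideanSpace ℝ (Fin (n + 1)) → M)
    (R : M → EuclideanSpace ℝ (Fin (n + 1))) (O : Set M) : Prop
    extends BoundaryParam ι χ c e G R O where
  direction : ∀ x ∈ openBox c e, ∃ a : ℝ, 0 < a ∧
    paramDeriv G c e x (EuclideanSpace.single 0 1) = a • ϱ (G x) (s (G x))
  direction_eq : ∀ x ∈ openBox c e, x 0 = 0 →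
    paramDeriv G c e x (EuclideanSpace.single 0 1) = ϱ (G x) (s (G x))
  density_eq : ∀ x ∈ openBox c e, Function.Bijective (ϱ (G (setZero 0 x))) →
    paramDensity ϱ μ G c e x (fun i => EuclideanSpace.single i 1) =
      paramDensity ϱ μ G c e (setZero 0 x) (fun i => EuclideanSpace.single i 1)
  density_ne_zero : ∀ x ∈ openBox c e, Function.Bijective (ϱ (G x)) →
    paramDensity ϱ μ G c e x (fun i => EuclideanSpace.single i 1) ≠ 0

end Reparam

section Normal

variable {n : ℕ} {M : Type*} [TopologicalSpace M] [T2Space M] [CompactSpace M]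
  [ChartedSpace (EuclideanQuadrant (n + 1)) M] [IsManifold (cornerModel (n + 1)) ∞ M]
  {Y : Type*} [TopologicalSpace Y] [ChartedSpace (EuclideanQuadrant n) Y]
  {F : Type*} [NormedAddCommGroup F] [NormedSpace ℝ F] [FiniteDimensional ℝ F]
  {A : M → Type*} [TopologicalSpace (Bundle.TotalSpace F A)] [∀ p, TopologicalSpace (A p)]
  [∀ p, AddCommGroup (A p)] [∀ p, Module ℝ (A p)]
  [∀ p, IsTopologicalAddGroup (A p)] [∀ p, ContinuousConstSMul ℝ (A p)]
  [FiberBundle F A] [VectorBundle ℝ F A] [ContMDiffVectorBundle ∞ F A (cornerModel (n + 1))]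

/-- Near each point of `Y` there is a parametrization in normal form: from one whose `x₀`-lines are
integral curves, it arises by a change of the parameter on these lines, whose derivative
compensates the change of the density. -/
theorem IsLieManifoldWithBoundary.exists_normalParam [Nonempty Y]
    {ϱ : ∀ p : M, A p →ₗ[ℝ] TangentSpace (cornerModel (n + 1)) p} {ι : Y → M}
    (hM : IsLieManifoldWithBoundary F ϱ ι)
    (g : Bundle.ContMDiffRiemannianMetric (cornerModel (n + 1)) ∞ F A)
    {s : ∀ p, A p} (hs : IsSmoothSection n F s)
    (hin : ∀ φ ∈ IsManifold.maximalAtlas (cornerModel (n + 1)) ∞ M, ∀ i y,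
      FaceInside (range ι) φ i (ι y) → (0 : ℝ) <
        mfderiv (cornerModel (n + 1)) 𝓘(ℝ, ℝ) (chartCoord φ i) (ι y) (ϱ (ι y) (s (ι y)))) (y : Y) :
    ∃ χ c e G R O, NormalParam ϱ (volumeDensity g) s ι χ c e G R O ∧ ι y ∈ O := by
  obtain ⟨χ, c, e, G, R, O, h, hyO, hyc, s', α, hs', hαs, hα, hflow⟩ :=
    hM.exists_boundaryParam_flow hs hin y
  obtain ⟨σ, U, hU, hyU, hσ, hbasis, hframe⟩ :=
    exists_frame (n := n) (A := A) (Module.finBasisOfFinrankEq ℝ F hM.finrank_eq) (ι y)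
  have hGc : G c = ι y := by rw [← hyc]; exact h.right_inv _ hyO
  -- a smaller parametrization, with image in the domain of the frame
  obtain ⟨e₁, he₁, hee, hGU⟩ : ∃ e₁ > 0, e₁ ≤ e ∧ ∀ x ∈ openBox c e₁, G x ∈ U := by
    have h1 : G ⁻¹' U ∈ 𝓝[openBox c e] c :=
      (h.contMDiffOn.continuousOn c (mem_openBox_self h.center_mem h.pos)).preimage_mem_nhdsWithin
        (hU.mem_nhds (by rwa [hGc]))
    obtain ⟨W, hW, hWs⟩ := mem_nhdsWithin_iff_exists_mem_nhds_inter.1 h1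
    obtain ⟨d, hd, hdW⟩ := exists_quadrantBox_subset hW
    refine ⟨min d e, lt_min hd h.pos, min_le_right _ _, fun x hx => hWs ⟨hdW ?_, ?_⟩⟩
    · exact openBox_subset_quadrantBox (openBox_mono (min_le_left _ _) hx)
    · exact openBox_mono (min_le_right _ _) hx
  have h₁ := h.restrict he₁ hee
  set O₁ := O ∩ R ⁻¹' {x | ∀ i, x i ∈ Metric.ball (c i) e₁} with hO₁
  change BoundaryParam ι χ c e₁ G R O₁ at h₁
  have hO₁U : O₁ ⊆ U := fun p hp => by
    rw [← h₁.right_inv p hp]; exact hGU _ (h₁.mapsTo_inv hp)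
  have hflow₁ : ∀ x ∈ openBox c e₁,
      paramDeriv G c e₁ x (EuclideanSpace.single 0 1) = ϱ (G x) (s' (G x)) := fun x hx => by
    rw [h.paramDeriv_restrict hee hx]
    exact hflow x (openBox_mono hee hx)
  -- `Q` is needed on the box of radius `2 * b`, so the fields have to be defined on that of
  -- radius `4 * b`
  set b := e₁ / 5 with hb
  have hb0 : 0 < b := by positivity
  obtain ⟨Q, hQ, hQ0, hQdet⟩ := hM.det_frameMatrix_eq h₁ hs' hflow₁ hσ
    (fun t ht => (hframe t ht).imp fun a ha => ⟨fun k => (ha.1 k).mono hO₁U,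
      fun q hq => ha.2 q (hO₁U hq)⟩) (b := 2 * b) (by positivity) (by rw [hb]; linarith)
  -- the density of the frame
  set m : M → ℝ := fun p => volumeDensity g p (fun k => σ k p) with hm
  have hmpos : ∀ p ∈ U, 0 < m p := fun p hp => by
    obtain ⟨B, hB⟩ := hbasis p hp
    have h1 : (fun k => σ k p) = B := funext fun k => (hB k).symm
    exact Real.sqrt_pos.2 (gram_det_pos g (h1 ▸ B.linearIndependent))
  have hms : ContMDiffOn (cornerModel (n + 1)) 𝓘(ℝ, ℝ) ∞ m U := fun p hp =>
    ((Real.contDiffAt_sqrt (Real.sqrt_pos.1 (hmpos p hp)).ne').contMDiffAt.comp p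
      (contMDiff_gram_det g hσ p)).contMDiffWithinAt
  have hmG : ContDiffOn ℝ ∞ (fun x => m (G x)) (openBox c e₁) :=
    (hms.comp (h₁.contMDiffOn) hGU).contDiffOn
  have hαG : ContDiffOn ℝ ∞ (fun x => α (G x)) (openBox c e₁) :=
    (hαs.comp (h.contMDiffOn.mono (openBox_mono hee))
      fun x hx => h.mapsTo (openBox_mono hee hx)).contDiffOn
  have hproj : ContDiff ℝ ∞ (setZero (n := n) 0) :=
    contDiff_setZero.comp (contDiff_const.prodMk contDiff_id)
  have hbox : quadrantBox c (2 * b) ⊆ openBox c e₁ :=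
    quadrantBox_subset_openBox (by rw [hb]; linarith)
  have hbox1 : quadrantBox c b ⊆ quadrantBox c (2 * b) := quadrantBox_mono (by linarith)
  have hz : ∀ x ∈ openBox c e₁, setZero 0 x ∈ openBox c e₁ := fun x hx => h₁.setZero_zero_mem hx
  -- The density `m` of the frame is `|det| * δ`, where `δ` is the density in the coordinates, and
  -- `det` grows by the factor `exp Q` along the lines. So from `x₀ = 0` to `x` the density `δ`
  -- grows by the second factor of `f x`, which is smooth and positive on the whole box. Division of
  -- the speed on the lines by this factor makes the density constant; `α` adjusts the speed at `Y`.
  set f : EuclideanSpace ℝ (Fin (n + 1)) → ℝ := fun x =>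
    α (G (setZero 0 x)) * (m (G x) / m (G (setZero 0 x)) * Real.exp (-Q x)) with hf
  have hfs : ContDiffOn ℝ ∞ f (quadrantBox c (2 * b)) := by
    refine ContDiffOn.mul (hαG.comp hproj.contDiffOn fun x hx => hz x (hbox hx)) ?_
    refine ContDiffOn.mul ?_ (hQ.neg.exp)
    exact (hmG.mono hbox).div (hmG.comp hproj.contDiffOn fun x hx => hz x (hbox hx))
      fun x hx => (hmpos _ (hGU _ (hz x (hbox hx)))).ne'
  have hfpos : ∀ x ∈ quadrantBox c b, 0 < f x := fun x hx => by
    have hx' := hbox (hbox1 hx)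
    have h1 := (hα _ (h.mapsTo (openBox_mono hee (hz x hx')))).1
    have h2 := hmpos _ (hGU _ hx')
    have h3 := hmpos _ (hGU _ (hz x hx'))
    positivity
  obtain ⟨H, hH, hH0, hHd⟩ := exists_primitive h.center_mem h.center_zero hb0 hfs
  obtain ⟨e', K, O', h', hcO', hOO', hK⟩ := h₁.exists_reparam hb0 (by rw [hb]; linarith)
    (hfs.continuousOn.mono hbox1) hfpos hH hH0 hHd
  set R' := (fun x => setZero (H x) x) ∘ R with hR'
  have hbx : openBox c b ⊆ openBox c e₁ := openBox_mono (by rw [hb]; linarith)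
  have hbq : openBox c b ⊆ quadrantBox c b := openBox_subset_quadrantBox
  set δ : EuclideanSpace ℝ (Fin (n + 1)) → ℝ := fun x =>
    paramDensity ϱ (volumeDensity g) G c e₁ x (fun i => EuclideanSpace.single i 1) with hδ
  set δ' : EuclideanSpace ℝ (Fin (n + 1)) → ℝ := fun x =>
    paramDensity ϱ (volumeDensity g) (G ∘ K) c e' x (fun i => EuclideanSpace.single i 1) with hδ'
  have hiff : ∀ x ∈ openBox c e₁,
      Function.Bijective (ϱ (G x)) ↔ (frameMatrix ϱ σ R G x).det ≠ 0 := fun x hx => by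
    obtain ⟨B, hB⟩ := hbasis _ (hGU x hx)
    exact h₁.bijective_anchor_iff hx B hB
  have hframeδ : ∀ x ∈ openBox c e₁, Function.Bijective (ϱ (G x)) →
      m (G x) = |(frameMatrix ϱ σ R G x).det| * δ x := fun x hx hbij =>
    h₁.density_frame_eq hx _ hbij
  have hbij : ∀ x ∈ openBox c b, Function.Bijective (ϱ (G (setZero 0 x))) →
      Function.Bijective (ϱ (G x)) := fun x hx h0 => by
    rw [hiff _ (hz x (hbx hx))] at h0
    rw [hiff _ (hbx hx), hQdet x (hbox1 (hbq hx))]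
    exact mul_ne_zero h0 (Real.exp_ne_zero _)
  -- the change of the density along the lines
  have hδx : ∀ x ∈ openBox c b, Function.Bijective (ϱ (G (setZero 0 x))) →
      δ x * α (G (setZero 0 x)) = δ (setZero 0 x) * f x := fun x hx h0 => by
    have h1 := hframeδ _ (hbx hx) (hbij x hx h0)
    have h2 := hframeδ _ (hz x (hbx hx)) h0
    have h3 := hmpos _ (hGU _ (hz x (hbx hx)))
    have h4 := (hiff _ (hz x (hbx hx))).1 h0
    rw [hQdet x (hbox1 (hbq hx)), abs_mul, abs_of_pos (Real.exp_pos _)] at h1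
    have h5 : 0 < |(frameMatrix ϱ σ R G (setZero 0 x)).det| := abs_pos.2 h4
    have h6 : δ (setZero 0 x) ≠ 0 := fun h0 => by rw [h0, mul_zero] at h2; exact h3.ne' h2
    have h7 : Real.exp (Q x) * Real.exp (-Q x) = 1 := by rw [← Real.exp_add]; simp
    simp only [hf]
    rw [h1, h2]
    field_simp
    linear_combination (-1 : ℝ) * δ x * α (G (setZero 0 x)) * h7
  -- the transition map to the new parametrization, and the effect on the density
  have htr : ∀ x ∈ openBox c b, G x ∈ O' → transitionDeriv R' G c e₁ x
      (EuclideanSpace.single 0 1) = f x • EuclideanSpace.single 0 1 ∧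
      δ x = f x * δ' (R' (G x)) := by
    intro x hx hxO
    obtain ⟨h1, h2⟩ := h₁.transitionDeriv_reparam h' (hbx hx) hxO hb0
      (apply_zero_mem_Icc h.center_zero (hbq hx)) (fun s hs => hbox (hbox1
        (setZero_mem_quadrantBox h.center_zero (hbq hx) hs))) (hHd x (hbq hx))
    refine ⟨h1, ?_⟩
    simp only [hδ, hδ']
    rw [h'.paramDensity_transition hxO,
      OneDensity.map_single_of_eigenvector _ _ h1, abs_of_pos (hfpos x (hbq hx))]
    simp only [h2]
    have h3 : (Matrix.of fun i j : Fin n =>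
        tailCoord (EuclideanSpace.single (𝕜 := ℝ) i.succ 1) j) = 1 := by
      ext i j
      simp [Matrix.one_apply, eq_comm]
    rw [h3]
    simp
  have hKx : ∀ y ∈ openBox c e', setZero 0 (K y) = setZero 0 y ∧
      K (setZero 0 y) = setZero 0 y ∧ R' (G (K y)) = y ∧ G (K y) ∈ O' := fun y hy =>
    ⟨by have := congrArg (setZero 0) (hK y hy).2.1; rwa [setZero_setZero] at this,
      (hK _ (h'.setZero_zero_mem hy)).2.2 (setZero_zero _ _), h'.left_inv y hy, h'.mapsTo hy⟩
  -- the derivative of the new parametrization along the `x₀`-lines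
  have hdir : ∀ y ∈ openBox c e', paramDeriv (G ∘ K) c e' y (EuclideanSpace.single 0 1) =
      ((f (K y))⁻¹ * α (G (K y))) • ϱ ((G ∘ K) y) (s ((G ∘ K) y)) := by
    intro y hy
    obtain ⟨-, -, h3, h4⟩ := hKx y hy
    have hx := (hK y hy).1
    have h5 := h'.paramDeriv_transitionDeriv h4 (c := c) (e := e₁) (EuclideanSpace.single 0 1)
    rw [h3, (htr _ hx h4).1, map_smul] at h5
    have h6 := hflow₁ _ (hbx hx)
    rw [(hα _ (hOO' h4).1).2, map_smul] at h6
    rw [mul_smul, eq_inv_smul_iff₀ (hfpos _ (hbq hx)).ne']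
    exact h5.trans h6
  refine ⟨χ, c, e', G ∘ K, R', O', ⟨h', fun y hy => ?_, fun y hy h0 => ?_, fun y hy hby => ?_,
    fun y hy hby => ?_⟩, hGc ▸ hcO'⟩
  · have hx := (hK y hy).1
    exact ⟨_, mul_pos (inv_pos.2 (hfpos _ (hbq hx)))
      (hα _ (hOO' (hKx y hy).2.2.2).1).1, hdir y hy⟩
  · have hx := (hK y hy).1
    rw [hdir y hy]
    have h1 := (hα _ (hOO' (hKx y hy).2.2.2).1).1
    have h2 := hmpos _ (hGU _ (hbx hx))
    have h3 : f (K y) = α (G (K y)) := by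
      have h4 : setZero 0 (K y) = K y := by
        rw [(hKx y hy).1, (hK y hy).2.2 h0, setZero_of_eq h0]
      simp only [hf]
      rw [h4, hQ0 (K y) (by rw [(hK y hy).2.2 h0, h0]), neg_zero, Real.exp_zero,
        div_self h2.ne']
      ring
    rw [h3, inv_mul_cancel₀ h1.ne', one_smul]
  · have hy0 := h'.setZero_zero_mem hy
    have hx := (hK y hy).1
    rw [Function.comp_apply, (hKx y hy).2.1] at hby
    have h1 := (htr _ hx (hKx y hy).2.2.2).2
    have h2 := (htr _ (hK _ hy0).1 (hKx _ hy0).2.2.2).2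
    have h3 := hδx _ hx (by rwa [(hKx y hy).1])
    have h4 := hfpos _ (hbq hx)
    rw [(hKx y hy).2.2.1] at h1
    rw [(hKx _ hy0).2.2.1, (hKx y hy).2.1] at h2
    have h5 : f (setZero 0 y) = α (G (setZero 0 y)) := by
      have h6 := hmpos _ (hGU _ (hz _ (hbx hx)))
      rw [(hKx y hy).1] at h6
      simp only [hf, setZero_setZero]
      rw [hQ0 _ (setZero_zero 0 y), neg_zero, Real.exp_zero, div_self h6.ne']
      ring
    have h7 : 0 < f (setZero 0 y) := by
      have := hfpos _ (hbq (hK _ hy0).1)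
      rwa [(hKx y hy).2.1] at this
    change δ' y = δ' (setZero 0 y)
    rw [(hKx y hy).1, h1, h2, ← h5] at h3
    have h8 : f (K y) * f (setZero 0 y) ≠ 0 := (mul_pos h4 h7).ne'
    exact mul_left_cancel₀ h8 (by linear_combination h3)
  · have hx := (hK y hy).1
    have h1 := (htr _ hx (hKx y hy).2.2.2).2
    rw [(hKx y hy).2.2.1] at h1
    have h2 := hframeδ _ (hbx hx) hby
    have h3 := hmpos _ (hGU _ (hbx hx))
    intro h0
    change δ' y = 0 at h0
    rw [h1, h0, mul_zero, mul_zero] at h2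
    exact h3.ne' h2

end Normal

/-! ### Agreement of normal forms -/

section Agreement

variable {n : ℕ} {M : Type*} [TopologicalSpace M]
  [ChartedSpace (EuclideanQuadrant (n + 1)) M] [IsManifold (cornerModel (n + 1)) ∞ M]
  {Y : Type*} [TopologicalSpace Y] [ChartedSpace (EuclideanQuadrant n) Y]
  {F : Type*} [NormedAddCommGroup F] [NormedSpace ℝ F]
  {A : M → Type*} [TopologicalSpace (Bundle.TotalSpace F A)] [∀ p, TopologicalSpace (A p)]
  [∀ p, AddCommGroup (A p)] [∀ p, Module ℝ (A p)] [FiberBundle F A]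

variable {ϱ : ∀ p : M, A p →ₗ[ℝ] TangentSpace (cornerModel (n + 1)) p}
    {μ : ∀ p, OneDensity (n + 1) (A p)} {s : ∀ p, A p} {ι : Y → M}
    {χ χ' : OpenPartialHomeomorph Y (EuclideanQuadrant n)}
    {c c' : EuclideanSpace ℝ (Fin (n + 1))} {e e' : ℝ} {G G' : EuclideanSpace ℝ (Fin (n + 1)) → M}
    {R R' : M → EuclideanSpace ℝ (Fin (n + 1))} {O O' : Set M}

omit [IsManifold (cornerModel (n + 1)) ∞ M] in
/-- The domain of the transition map between two parametrizations contains a box about each point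
of `Y`. -/
theorem BoundaryParam.exists_transition_box (h : BoundaryParam ι χ c e G R O)
    (h' : BoundaryParam ι χ' c' e' G' R' O') {z : Y} (hz : ι z ∈ O) (hz' : ι z ∈ O') :
    ∃ b > 0, ∀ x ∈ openBox (R (ι z)) b, x ∈ openBox c e ∧ G x ∈ O' := by
  have hx₀ := h.mapsTo_inv hz
  have h1 : ∀ᶠ x in 𝓝[openBox c e] R (ι z), G x ∈ O' := by
    refine (h.contMDiffOn.continuousOn _ hx₀).tendsto.eventually_mem (h'.isOpen.mem_nhds ?_)
    rwa [h.right_inv _ hz]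
  have h2 : 𝓝[openBox c e] R (ι z) = 𝓝[quadrant (n + 1)] R (ι z) := by
    rw [openBox_eq]
    rw [openBox_eq] at hx₀
    exact nhdsWithin_inter_of_mem' (mem_nhdsWithin_of_mem_nhds
      ((isOpen_cube c e).mem_nhds hx₀.2))
  have h3 := (h1.and self_mem_nhdsWithin : ∀ᶠ x in 𝓝[openBox c e] R (ι z), _)
  rw [h2] at h3
  obtain ⟨W, hW, hWs⟩ := mem_nhdsWithin_iff_exists_mem_nhds_inter.1 h3
  obtain ⟨b, hb, hbW⟩ := exists_quadrantBox_subset hW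
  refine ⟨b, hb, fun x hx => (hWs ⟨hbW (openBox_subset_quadrantBox hx), ?_⟩).symm⟩
  exact openBox_subset hx

omit [IsManifold (cornerModel (n + 1)) ∞ M] [∀ p, TopologicalSpace (A p)] in
/-- The transition map between two normal forms preserves the direction of the `x₀`-lines, as these
are integral curves of the same field. -/
theorem NormalParam.transitionDeriv_single (h : NormalParam ϱ μ s ι χ c e G R O)
    (h' : NormalParam ϱ μ s ι χ' c' e' G' R' O') {x : EuclideanSpace ℝ (Fin (n + 1))}
    (hx : x ∈ openBox c e) (hxO : G x ∈ O') :
    ∃ a : ℝ, 0 < a ∧ (x 0 = 0 → a = 1) ∧ transitionDeriv R' G c e x (EuclideanSpace.single 0 1) =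
      a • EuclideanSpace.single 0 1 := by
  have hx' := h'.mapsTo_inv hxO
  have hp := h'.right_inv _ hxO
  have key : ∀ a a' : ℝ, 0 < a' →
      paramDeriv G c e x (EuclideanSpace.single 0 1) = a • ϱ (G x) (s (G x)) →
      paramDeriv G' c' e' (R' (G x)) (EuclideanSpace.single 0 1) =
        a' • ϱ (G' (R' (G x))) (s (G' (R' (G x)))) →
      transitionDeriv R' G c e x (EuclideanSpace.single 0 1) =
        (a / a') • EuclideanSpace.single 0 1 := by
    intro a a' ha' h1 h2
    have h3 : ∀ p, p = G x → (ϱ p (s p) : EuclideanSpace ℝ (Fin (n + 1))) = ϱ (G x) (s (G x)) := by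
      rintro p rfl; rfl
    have h4 := h'.paramDeriv_transitionDeriv hxO (c := c) (e := e) (EuclideanSpace.single 0 1)
    have h5 : (paramDeriv G' c' e' (R' (G x))
        ((a / a') • EuclideanSpace.single 0 1) : EuclideanSpace ℝ (Fin (n + 1))) =
        paramDeriv G c e x (EuclideanSpace.single 0 1) := by
      rw [map_smul, h2, h1, smul_smul, div_mul_cancel₀ _ ha'.ne']
      exact congrArg (a • ·) (h3 _ hp)
    rw [← h'.coordDeriv_paramDeriv hx' (transitionDeriv R' G c e x (EuclideanSpace.single 0 1)),
      ← h'.coordDeriv_paramDeriv hx' ((a / a') • EuclideanSpace.single 0 1)]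
    exact congrArg (coordDeriv R' (G' (R' (G x)))) (h4.trans h5.symm)
  by_cases h0 : x 0 = 0
  · have h0' : R' (G x) 0 = 0 := by
      have h1 := h.eq_incl x hx h0
      rw [h1] at hxO ⊢
      exact h'.inv_apply_zero _ hxO
    refine ⟨1, one_pos, fun _ => rfl, ?_⟩
    have := key 1 1 one_pos (by rw [one_smul]; exact h.direction_eq x hx h0)
      (by rw [one_smul]; exact h'.direction_eq _ hx' h0')
    rwa [div_one] at this
  · obtain ⟨a, ha, h1⟩ := h.direction x hx
    obtain ⟨a', ha', h2⟩ := h'.direction _ hx'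
    exact ⟨a / a', div_pos ha ha', fun h => absurd h h0, key a a' ha' h1 h2⟩

/-- The projection to `{x₀ = 0}` is linear. -/
theorem hasFDerivAt_setZero_zero (x : EuclideanSpace ℝ (Fin (n + 1))) :
    HasFDerivAt (setZero (n := n) 0)
      (consCoord.comp ((0 : EuclideanSpace ℝ (Fin (n + 1)) →L[ℝ] ℝ).prod tailCoord)) x := by
  have h1 : (setZero (n := n) 0) =
      consCoord.comp ((0 : EuclideanSpace ℝ (Fin (n + 1)) →L[ℝ] ℝ).prod tailCoord) := by
    ext1 x
    rw [← consCoord_tailCoord_eq_setZero]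
    rfl
  rw [h1]
  exact ContinuousLinearMap.hasFDerivAt _

/-- Transition maps between normal forms preserve `x₀`-lines. Since both densities are constant on
these lines, the derivative of the transition map in the direction of the lines is constant, hence
`1`, off the singular boundary; by density they preserve `x₀`. -/
theorem NormalParam.transition_eq (hM : IsLieManifoldWithBoundary F ϱ ι)
    (h : NormalParam ϱ μ s ι χ c e G R O) (h' : NormalParam ϱ μ s ι χ' c' e' G' R' O') {z : Y}
    (hz : ι z ∈ O) (hz' : ι z ∈ O') :
    ∃ b > 0, ∀ x ∈ openBox (R (ι z)) b, x ∈ openBox c e ∧ G x ∈ O' ∧ R' (G x) 0 = x 0 ∧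
      setZero 0 (R' (G x)) = R' (G (setZero 0 x)) := by
  obtain ⟨b₀, hb₀, hbox⟩ := h.exists_transition_box h'.toBoundaryParam hz hz'
  set x₀ := R (ι z) with hx₀
  have hx₀0 : x₀ 0 = 0 := h.inv_apply_zero z hz
  have hx₀Q : x₀ ∈ quadrant (n + 1) := openBox_subset (h.mapsTo_inv hz)
  set b := b₀ / 2 with hb
  have hb0 : 0 < b := by positivity
  have hqb : quadrantBox x₀ b ⊆ openBox x₀ b₀ := quadrantBox_subset_openBox (by linarith)
  set ξ : EuclideanSpace ℝ (Fin (n + 1)) → EuclideanSpace ℝ (Fin (n + 1)) :=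
    fun x => R' (G x) with hξ
  have hξ0 : ∀ x ∈ openBox x₀ b₀, x 0 = 0 → ξ x 0 = 0 := fun x hx h0 => by
    have h1 := h.eq_incl x (hbox x hx).1 h0
    have h2 := (hbox x hx).2
    simp only [hξ]
    rw [h1] at h2 ⊢
    exact h'.inv_apply_zero _ h2
  have hD : ∀ x ∈ openBox x₀ b₀,
      HasFDerivWithinAt ξ (transitionDeriv R' G c e x) (openBox x₀ b₀) x := fun x hx =>
    (h.hasFDerivWithinAt_transition h'.toBoundaryParam (hbox x hx).1 (hbox x hx).2).mono
      fun y hy => (hbox y hy).1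
  have hline : ∀ x ∈ quadrantBox x₀ b, ∀ t ∈ Icc 0 b, HasDerivWithinAt (fun t => ξ (setZero t x))
      (transitionDeriv R' G c e (setZero t x) (EuclideanSpace.single 0 1)) (Icc 0 b) t :=
    fun x hx t ht => HasFDerivWithinAt.comp_hasDerivWithinAt (f := fun t => setZero t x) t
      (hD (setZero t x) (hqb (setZero_mem_quadrantBox hx₀0 hx ht)))
      (hasDerivAt_setZero x t).hasDerivWithinAt fun r hr =>
        hqb (setZero_mem_quadrantBox hx₀0 hx hr)
  have hz0 : ∀ x ∈ quadrantBox x₀ b, setZero 0 x ∈ quadrantBox x₀ b := fun x hx =>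
    setZero_mem_quadrantBox hx₀0 hx ⟨le_rfl, hb0.le⟩
  -- `x₀`-lines are mapped to `x₀`-lines
  have htail : ∀ x ∈ quadrantBox x₀ b, tailCoord (ξ x) = tailCoord (ξ (setZero 0 x)) := by
    intro x hx
    refine eq_setZero_of_hasDerivWithinAt (f := fun x => tailCoord (ξ x))
      (apply_zero_mem_Icc hx₀0 hx) fun t ht => ?_
    have hxt := hbox _ (hqb (setZero_mem_quadrantBox hx₀0 hx ht))
    obtain ⟨a, -, -, ha⟩ := h.transitionDeriv_single h' hxt.1 hxt.2
    refine (tailCoord.hasFDerivAt.comp_hasDerivWithinAt t (hline x hx t ht)).congr_deriv ?_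
    rw [ha, map_smul]
    ext i
    simp
  have hξz : ∀ x ∈ quadrantBox x₀ b, setZero 0 (ξ x) = ξ (setZero 0 x) := fun x hx => by
    rw [← consCoord_tailCoord_eq_setZero, htail x hx, consCoord_tailCoord_eq_setZero,
      setZero_of_eq (hξ0 _ (hqb (hz0 x hx)) (setZero_zero _ _))]
  have hbq : openBox x₀ b ⊆ quadrantBox x₀ b := openBox_subset_quadrantBox
  -- hence the derivatives transversal to the lines are constant on them
  have htail' : ∀ x ∈ openBox x₀ b, ∀ i : Fin n,
      tailCoord (transitionDeriv R' G c e x (EuclideanSpace.single i.succ 1)) =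
        tailCoord (transitionDeriv R' G c e (setZero 0 x) (EuclideanSpace.single i.succ 1)) := by
    intro x hx i
    have h1 := tailCoord.hasFDerivAt.comp_hasFDerivWithinAt x
      ((hD x (hqb (hbq hx))).mono (hbq.trans hqb))
    have h2 : HasFDerivWithinAt (fun x => tailCoord (ξ (setZero 0 x))) _ (openBox x₀ b) x :=
      tailCoord.hasFDerivAt.comp_hasFDerivWithinAt x
        ((hD _ (hqb (hz0 x (hbq hx)))).comp x (hasFDerivAt_setZero_zero x).hasFDerivWithinAt
          fun y hy => hqb (hz0 y (hbq hy)))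
    have h3 := h2.congr (fun y hy => htail y (hbq hy)) (htail x (hbq hx))
    have h4 := DFunLike.congr_fun ((uniqueDiffOn_openBox x hx).eq h1 h3)
      (EuclideanSpace.single i.succ 1)
    refine h4.trans ?_
    have h5 : consCoord ((0 : ℝ), tailCoord (EuclideanSpace.single (𝕜 := ℝ) i.succ 1)) =
        EuclideanSpace.single i.succ 1 := by
      rw [consCoord_tailCoord_eq_setZero, setZero_of_eq (by simp)]
    change tailCoord (transitionDeriv R' G c e (setZero 0 x) (consCoord ((0 : ℝ),
      tailCoord (EuclideanSpace.single (𝕜 := ℝ) i.succ 1)))) = _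
    rw [h5]
  -- off the singular boundary the lines are parametrized in the same way
  have hgood : ∀ x ∈ openBox x₀ b, Function.Bijective (ϱ (G (setZero 0 x))) →
      transitionDeriv R' G c e x (EuclideanSpace.single 0 1) = EuclideanSpace.single 0 1 := by
    intro x hx hbij
    have hx1 := hbox x (hqb (hbq hx))
    have hx2 := hbox _ (hqb (hz0 x (hbq hx)))
    obtain ⟨a, ha0, -, ha⟩ := h.transitionDeriv_single h' hx1.1 hx1.2
    obtain ⟨a', -, ha1, ha'⟩ := h.transitionDeriv_single h' hx2.1 hx2.2
    have e1 := h'.paramDensity_transition hx1.2 ϱ μ (c := c) (e := e)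
      (fun i => EuclideanSpace.single i 1)
    have e2 := h'.paramDensity_transition hx2.2 ϱ μ (c := c) (e := e)
      (fun i => EuclideanSpace.single i 1)
    rw [OneDensity.map_single_of_eigenvector _ _ ha] at e1
    rw [OneDensity.map_single_of_eigenvector _ _ ha', ha1 (setZero_zero _ _), abs_one,
      one_mul] at e2
    have hG' : G' (setZero 0 (ξ x)) = G (setZero 0 x) := by
      rw [hξz x (hbq hx)]
      exact h'.right_inv _ hx2.2
    have e3 := h.density_eq x hx1.1 hbij
    have e4 := h'.density_eq (ξ x) (h'.mapsTo_inv hx1.2) (by rwa [hG'])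
    rw [hξz x (hbq hx)] at e4
    have e5 := h.density_ne_zero _ hx2.1 hbij
    simp only [htail' x hx] at e1
    change _ = _ * paramDensity ϱ μ G' c' e' (ξ x) _ at e1
    change _ = _ * paramDensity ϱ μ G' c' e' (ξ (setZero 0 x)) _ at e2
    rw [e4, mul_assoc, ← e2, e3, abs_of_pos ha0] at e1
    have : a = 1 := by
      have e6 : (a - 1) * paramDensity ϱ μ G c e (setZero 0 x)
          (fun i => EuclideanSpace.single i 1) = 0 := by linear_combination - e1
      exact sub_eq_zero.1 ((mul_eq_zero.1 e6).resolve_right e5)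
    rw [ha, this, one_smul]
  -- and `x₀` is preserved there
  have hgood' : ∀ x ∈ openBox x₀ b, Function.Bijective (ϱ (G (setZero 0 x))) → ξ x 0 = x 0 := by
    intro x hx hbij
    have hx0 := apply_zero_mem_Icc hx₀0 (hbq hx)
    have hxm : ∀ t ∈ Icc 0 (x 0), setZero t x ∈ openBox x₀ b := by
      intro t ht i
      refine Fin.cases ?_ (fun i => ?_) i
      · have := (hx 0).2
        rw [hx₀0, sub_zero] at this ⊢
        rw [setZero_zero, abs_of_nonneg ht.1]
        exact ⟨ht.1, ht.2.trans_lt ((le_abs_self _).trans_lt this)⟩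
      · rw [setZero_succ]; exact hx _
    have := eq_setZero_of_hasDerivWithinAt (f := fun x => ξ x 0 - x 0) (b := x 0) (x := x)
      ⟨hx0.1, le_rfl⟩ fun t ht => by
        have h1 := (hline x (hbq hx) t ⟨ht.1, ht.2.trans hx0.2⟩).mono (Icc_subset_Icc_right hx0.2)
        rw [hgood _ (hxm t ht) (by rwa [setZero_setZero])] at h1
        have h2 := (EuclideanSpace.proj (𝕜 := ℝ) (0 : Fin (n + 1))).hasFDerivAt
          |>.comp_hasDerivWithinAt t h1
        refine (h2.sub (hasDerivWithinAt_id t _)).congr_deriv ?_ |>.congr_of_eventuallyEq ?_ ?_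
        · simp
        · exact Eventually.of_forall fun r => by simp
        · simp
    simp only [setZero_zero, hξ0 _ (hqb (hz0 x (hbq hx))) (setZero_zero _ _)] at this
    linarith
  refine ⟨b, hb0, fun x hx => ⟨(hbox x (hqb (hbq hx))).1, (hbox x (hqb (hbq hx))).2, ?_,
    hξz x (hbq hx)⟩⟩
  -- by continuity `x₀` is preserved on the whole box
  by_contra hne
  have hc1 : ∀ᶠ y in 𝓝[openBox x₀ b₀] x, ξ y 0 - y 0 ≠ 0 := by
    have h1 : ContinuousWithinAt (fun y => ξ y 0 - y 0) (openBox x₀ b₀) x :=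
      ((EuclideanSpace.proj (𝕜 := ℝ)
        (0 : Fin (n + 1))).continuous.continuousAt.comp_continuousWithinAt
          (hD x (hqb (hbq hx))).continuousWithinAt).sub
        (EuclideanSpace.proj (𝕜 := ℝ) (0 : Fin (n + 1))).continuous.continuousWithinAt
    exact h1.eventually_ne (sub_ne_zero.2 hne)
  obtain ⟨W, hW, hWs⟩ := mem_nhdsWithin_iff_exists_mem_nhds_inter.1 hc1
  obtain ⟨x', hx'W, hx'b, hx'0, hpos⟩ := exists_pos_tail_near hx hW
  refine hWs ⟨hx'W, hqb (hbq hx'b)⟩ (sub_eq_zero.2 (hgood' x' hx'b (hM.bijective_anchor _ ?_)))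
  exact h.notMem_singularBoundary (hbox _ (hqb (hz0 x' (hbq hx'b)))).1 fun i => by
    simpa using hpos i

/-- The collar coordinates of two normal forms agree near common points of `Y`. -/
theorem NormalParam.eventually_eq (hM : IsLieManifoldWithBoundary F ϱ ι)
    (h : NormalParam ϱ μ s ι χ c e G R O) (h' : NormalParam ϱ μ s ι χ' c' e' G' R' O') {z : Y}
    (hz : ι z ∈ O) (hz' : ι z ∈ O') :
    ∀ᶠ p in 𝓝 (ι z), R' p 0 = R p 0 ∧ paramRetract χ' R' p = paramRetract χ R p := by
  obtain ⟨b, hb, hbox⟩ := h.transition_eq hM h' hz hz'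
  have hinj := hM.hypersurface.isClosedEmbedding.injective
  have hRc : ContinuousAt R (ι z) :=
    h.contMDiffOn_inv.continuousOn.continuousAt (h.isOpen.mem_nhds hz)
  filter_upwards [h.isOpen.mem_nhds hz, hRc.eventually_mem ((isOpen_cube (R (ι z)) b).mem_nhds
    fun i => Metric.mem_ball_self hb)] with p hpO hpb
  have hx : R p ∈ openBox (R (ι z)) b := by
    rw [openBox_eq]
    exact ⟨openBox_subset (h.mapsTo_inv hpO), hpb⟩
  obtain ⟨hxe, -, h1, h2⟩ := hbox _ hx
  have hp := h.right_inv p hpO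
  refine ⟨by rw [← h1, hp], ?_⟩
  have h3 : setZero 0 (R p) ∈ openBox (R (ι z)) b := by
    intro i
    refine Fin.cases ?_ (fun i => ?_) i
    · rw [setZero_zero, h.inv_apply_zero z hz]; simpa using hb
    · rw [setZero_succ]; exact hx _
  obtain ⟨h4, h5, -⟩ := hbox _ h3
  have h6 := h.eq_incl _ h4 (setZero_zero _ _)
  have h7 : paramRetract χ' R' p = paramRetract χ' R' (G (setZero 0 (R p))) := by
    rw [hp] at h2
    simp only [paramRetract]
    rw [← h2, tailCoord_setZero]
  rw [h7]
  rw [h6] at h5 ⊢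
  rw [h'.paramRetract_incl hinj h5, tailCoord_setZero, paramRetract]

end Agreement

/-! ### Gluing and collar coordinates -/

section Gluing

/-- Maps defined near the points of a compact set glue to a map near this set if their germs agree
at the points of the set. -/
theorem IsCompact.exists_glue {X Z J : Type*} [TopologicalSpace X] [RegularSpace X] [Nonempty Z]
    {K : Set X} (hK : IsCompact K) {O : J → Set X} {f : J → X → Z} (hO : ∀ j, IsOpen (O j))
    (hcover : ∀ x ∈ K, ∃ j, x ∈ O j)
    (hf : ∀ i j, ∀ x ∈ K, x ∈ O i → x ∈ O j → ∀ᶠ p in 𝓝 x, f i p = f j p) :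
    ∃ F : X → Z, ∀ x ∈ K, ∃ j, x ∈ O j ∧ ∀ᶠ p in 𝓝 x, F p = f j p := by
  classical
  rcases K.eq_empty_or_nonempty with rfl | ⟨x₁, hx₁⟩
  · exact ⟨fun _ => Classical.arbitrary Z, fun x hx => absurd hx (notMem_empty x)⟩
  have : Nonempty J := ⟨(hcover x₁ hx₁).choose⟩
  have hreg : ∀ x ∈ K, ∃ j, ∃ V ∈ 𝓝 x, IsClosed V ∧ V ⊆ O j := fun x hx => by
    obtain ⟨j, hj⟩ := hcover x hx
    obtain ⟨V, hV, hVc, hVO⟩ := exists_mem_nhds_isClosed_subset ((hO j).mem_nhds hj)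
    exact ⟨j, V, hV, hVc, hVO⟩
  choose! j V hV hVc hVO using hreg
  obtain ⟨t, htK, ht⟩ := hK.elim_nhds_subcover (fun x => interior (V x))
    fun x hx => interior_mem_nhds.2 (hV x hx)
  let F : X → Z := fun p =>
    if h : ∃ x ∈ t, p ∈ V x then f (j h.choose) p else Classical.arbitrary Z
  refine ⟨F, fun z hz => ?_⟩
  -- for `p` near `z`, only sets `V x` containing `z` matter, as these sets are closed
  have hev : ∀ x ∈ t, ∀ᶠ p in 𝓝 z, p ∈ V x → z ∈ V x := fun x hx => by
    by_cases hzx : z ∈ V x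
    · exact Eventually.of_forall fun _ _ => hzx
    · filter_upwards [(hVc x (htK x hx)).isOpen_compl.mem_nhds hzx] with p hp hp'
      exact absurd hp' hp
  obtain ⟨j₀, hj₀⟩ := hcover z hz
  have hag : ∀ x ∈ t, ∀ᶠ p in 𝓝 z, p ∈ V x → f (j x) p = f j₀ p := fun x hx => by
    by_cases hzx : z ∈ V x
    · exact (hf _ _ z hz (hVO x (htK x hx) hzx) hj₀).mono fun p hp _ => hp
    · exact (hev x hx).mono fun p hp hp' => absurd (hp hp') hzx
  have hcov : ∀ᶠ p in 𝓝 z, ∃ x ∈ t, p ∈ V x := by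
    obtain ⟨x, hx, hzx⟩ := mem_iUnion₂.1 (ht hz)
    filter_upwards [mem_interior_iff_mem_nhds.1 hzx] with p hp using ⟨x, hx, hp⟩
  refine ⟨j₀, hj₀, ?_⟩
  filter_upwards [hcov, (Filter.eventually_all_finset t).2 hag] with p hp1 hp2
  simp only [F, dif_pos hp1]
  exact hp2 _ hp1.choose_spec.1 hp1.choose_spec.2

end Gluing

section Collar

variable {n : ℕ} {M : Type*} [TopologicalSpace M]
  [ChartedSpace (EuclideanQuadrant (n + 1)) M]
  {Y : Type*} [TopologicalSpace Y] [ChartedSpace (EuclideanQuadrant n) Y]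

/-- The collar coordinates of an adapted parametrization. -/
noncomputable def collarMap (χ : OpenPartialHomeomorph Y (EuclideanQuadrant n))
    (R : M → EuclideanSpace ℝ (Fin (n + 1))) (p : M) : ℝ × Y :=
  (R p 0, paramRetract χ R p)

/-- The coordinates on `ℝ × Y` of a chart of `Y`. -/
noncomputable def collarChart (χ : OpenPartialHomeomorph Y (EuclideanQuadrant n)) (q : ℝ × Y) :
    EuclideanSpace ℝ (Fin (n + 1)) :=
  consCoord (q.1, χ.extend (cornerModel n) q.2)

theorem contMDiffOn_collarChart {χ : OpenPartialHomeomorph Y (EuclideanQuadrant n)}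
    (hχ : χ ∈ IsManifold.maximalAtlas (cornerModel n) ∞ Y) :
    ContMDiffOn (𝓘(ℝ, ℝ).prod (cornerModel n)) 𝓘(ℝ, EuclideanSpace ℝ (Fin (n + 1))) ∞
      (collarChart χ) (univ ×ˢ χ.source) :=
  consCoord.contDiff.contMDiff.comp_contMDiffOn (contMDiff_fst.contMDiffOn.prodMk_space
    ((χ.contMDiffOn_extend hχ).comp contMDiff_snd.contMDiffOn fun _ hq => hq.2))

theorem hasMFDerivAt_collarChart {χ : OpenPartialHomeomorph Y (EuclideanQuadrant n)}
    (hχ : χ ∈ IsManifold.maximalAtlas (cornerModel n) ∞ Y) {q : ℝ × Y} (hq : q.2 ∈ χ.source) :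
    HasMFDerivAt (𝓘(ℝ, ℝ).prod (cornerModel n)) 𝓘(ℝ, EuclideanSpace ℝ (Fin (n + 1)))
      (collarChart χ) q (consCoord.comp (ContinuousLinearMap.prodMap (ContinuousLinearMap.id ℝ ℝ)
        (mfderiv (cornerModel n) 𝓘(ℝ, EuclideanSpace ℝ (Fin n))
          (χ.extend (cornerModel n)) q.2))) := by
  have h1 : HasMFDerivAt (cornerModel n) 𝓘(ℝ, EuclideanSpace ℝ (Fin n))
      (χ.extend (cornerModel n)) q.2 _ :=
    (((χ.contMDiffOn_extend hχ _ hq).contMDiffAt (χ.open_source.mem_nhds hq)).mdifferentiableAt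
      (by simp)).hasMFDerivAt
  have h2 := h1.comp q (hasMFDerivAt_snd (I := 𝓘(ℝ, ℝ)) (I' := cornerModel n) q)
  have h3 := (hasMFDerivAt_fst (I := 𝓘(ℝ, ℝ)) (I' := cornerModel n) q)
  have h4 := ((consCoord.comp (ContinuousLinearMap.inl ℝ ℝ
    (EuclideanSpace ℝ (Fin n)))).hasMFDerivAt (x := q.1)).comp q h3
  have h5 := ((consCoord.comp (ContinuousLinearMap.inr ℝ ℝ
    (EuclideanSpace ℝ (Fin n)))).hasMFDerivAt (x := χ.extend (cornerModel n) q.2)).comp q h2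
  refine HasMFDerivAt.congr_of_eventuallyEq (f := ?_) ?_ ?_
  rotate_left
  · refine (h4.add h5).congr_mfderiv ?_
    ext1 v
    exact (map_add consCoord _ _).symm.trans
      (congrArg consCoord (Prod.ext (add_zero _) (zero_add _)))
  · refine Eventually.of_forall fun q => ?_
    exact (congrArg consCoord (Prod.ext (add_zero _).symm (zero_add _).symm)).trans
      (map_add consCoord _ _)

namespace BoundaryParam

variable {ι : Y → M} {χ : OpenPartialHomeomorph Y (EuclideanQuadrant n)}
    {c : EuclideanSpace ℝ (Fin (n + 1))} {e : ℝ} {G : EuclideanSpace ℝ (Fin (n + 1)) → M}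
    {R : M → EuclideanSpace ℝ (Fin (n + 1))} {O : Set M}

theorem contMDiffOn_collarMap (h : BoundaryParam ι χ c e G R O) :
    ContMDiffOn (cornerModel (n + 1)) (𝓘(ℝ, ℝ).prod (cornerModel n)) ∞ (collarMap χ R) O :=
  ((EuclideanSpace.proj (𝕜 := ℝ) (0 : Fin (n + 1))).contDiff.contMDiff.comp_contMDiffOn
    h.contMDiffOn_inv).prodMk h.contMDiffOn_paramRetract

theorem collarChart_collarMap (h : BoundaryParam ι χ c e G R O) {p : M} (hp : p ∈ O) :
    (collarMap χ R p).2 ∈ χ.source ∧ collarChart χ (collarMap χ R p) = R p := by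
  have ht := h.tail_mem _ (h.mapsTo_inv hp)
  refine ⟨?_, ?_⟩
  · have := (χ.extend (cornerModel n)).map_target ht
    rwa [χ.extend_source] at this
  · rw [collarChart, collarMap, paramRetract, (χ.extend (cornerModel n)).right_inv ht,
      consCoord_tailCoord]

theorem collarMap_apply_collarChart (h : BoundaryParam ι χ c e G R O) {q : ℝ × Y}
    (hq : q.2 ∈ χ.source) (hqe : collarChart χ q ∈ openBox c e) :
    collarMap χ R (G (collarChart χ q)) = q := by
  have h1 := h.left_inv _ hqe
  rw [collarMap, paramRetract, h1]
  simp only [collarChart, consCoord_zero, tailCoord_consCoord]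
  rw [χ.extend_left_inv hq]

theorem injOn_collarMap (h : BoundaryParam ι χ c e G R O) : InjOn (collarMap χ R) O := by
  intro p hp p' hp' hpp
  rw [← h.right_inv p hp, ← h.right_inv p' hp', ← (h.collarChart_collarMap hp).2, hpp,
    (h.collarChart_collarMap hp').2]

/-- The points of `[0, ∞) × Y` covered by a parametrization form a relatively open set. -/
theorem eventually_collarChart_mem (h : BoundaryParam ι χ c e G R O) {q : ℝ × Y}
    (hq : q.2 ∈ χ.source) (hqe : collarChart χ q ∈ openBox c e) :
    ∀ᶠ q' in 𝓝[Ici 0 ×ˢ univ] q, q'.2 ∈ χ.source ∧ collarChart χ q' ∈ openBox c e := by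
  have h1 : ContinuousAt (collarChart χ) q :=
    ((contMDiffOn_collarChart h.chart_mem).continuousOn).continuousAt
      ((isOpen_univ.prod χ.open_source).mem_nhds ⟨mem_univ _, hq⟩)
  rw [openBox_eq] at hqe ⊢
  filter_upwards [self_mem_nhdsWithin, mem_nhdsWithin_of_mem_nhds
    (h1.eventually_mem ((isOpen_cube c e).mem_nhds hqe.2)), mem_nhdsWithin_of_mem_nhds
    ((isOpen_univ.prod χ.open_source).mem_nhds ⟨mem_univ _, hq⟩)] with q' h2 h3 h4
  refine ⟨h4.2, fun i => ?_, h3⟩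
  refine Fin.cases h2.1 (fun i => ?_) i
  exact (χ q'.2).2 i

theorem contMDiffWithinAt_collarInv (h : BoundaryParam ι χ c e G R O) {q : ℝ × Y} {s : Set (ℝ × Y)}
    (hs : s ⊆ Ici 0 ×ˢ univ) (hq : q.2 ∈ χ.source) (hqe : collarChart χ q ∈ openBox c e) :
    ContMDiffWithinAt (𝓘(ℝ, ℝ).prod (cornerModel n)) (cornerModel (n + 1)) ∞
      (fun q => G (collarChart χ q)) s q := by
  have h1 : ContMDiffAt (𝓘(ℝ, ℝ).prod (cornerModel n)) 𝓘(ℝ, EuclideanSpace ℝ (Fin (n + 1))) ∞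
      (collarChart χ) q :=
    (contMDiffOn_collarChart h.chart_mem).contMDiffAt
      ((isOpen_univ.prod χ.open_source).mem_nhds ⟨mem_univ _, hq⟩)
  have h2 := h.eventually_collarChart_mem hq hqe
  have h3 := (h.contMDiffOn _ hqe).comp (t := openBox c e)
    (s := {q' | q'.2 ∈ χ.source ∧ collarChart χ q' ∈ openBox c e})
    q h1.contMDiffWithinAt fun q' hq' => hq'.2
  exact h3.mono_of_mem_nhdsWithin (nhdsWithin_mono _ hs h2)

/-- The derivative of the inverse of the collar coordinates. -/
theorem mfderivWithin_collarInv (h : BoundaryParam ι χ c e G R O) {q : ℝ × Y} {s : Set (ℝ × Y)}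
    (hs : s ⊆ Ici 0 ×ˢ univ) (hu : UniqueMDiffWithinAt (𝓘(ℝ, ℝ).prod (cornerModel n)) s q)
    (hq : q.2 ∈ χ.source) (hqe : collarChart χ q ∈ openBox c e)
    (v : ℝ × TangentSpace (cornerModel n) q.2) :
    mfderivWithin (𝓘(ℝ, ℝ).prod (cornerModel n)) (cornerModel (n + 1))
      (fun q => G (collarChart χ q)) s q v = paramDeriv G c e (collarChart χ q) (consCoord
        (v.1, mfderiv (cornerModel n) 𝓘(ℝ, EuclideanSpace ℝ (Fin n))
          (χ.extend (cornerModel n)) q.2 v.2)) := by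
  have h1 := (h.mdifferentiableWithinAt hqe).hasMFDerivWithinAt.comp
    (s := {q' | q'.2 ∈ χ.source ∧ collarChart χ q' ∈ openBox c e}) q
    (hasMFDerivAt_collarChart h.chart_mem hq).hasMFDerivWithinAt fun q' hq' => hq'.2
  have h2 := h1.mono_of_mem_nhdsWithin
    (nhdsWithin_mono _ hs (h.eventually_collarChart_mem hq hqe))
  exact DFunLike.congr_fun (h2.mfderivWithin hu) v

/-- The tangent map of the hypersurface in a parametrization. -/
theorem tangentIncl_eq (h : BoundaryParam ι χ c e G R O) (hι : Function.Injective ι)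
    (hιc : Continuous ι) {z : Y} (hz : ι z ∈ O) (w : TangentSpace (cornerModel n) z) :
    (tangentIncl (n := n) ι z w : EuclideanSpace ℝ (Fin (n + 1))) =
      paramDeriv G c e (R (ι z)) (consCoord (0, mfderiv (cornerModel n)
        𝓘(ℝ, EuclideanSpace ℝ (Fin n)) (χ.extend (cornerModel n)) z w)) := by
  obtain ⟨hzχ, hRz⟩ := h.inv_incl hι hz
  have hx := h.mapsTo_inv hz
  have h1 : HasMFDerivAt (cornerModel n) 𝓘(ℝ, EuclideanSpace ℝ (Fin n))
      (χ.extend (cornerModel n)) z _ :=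
    (((χ.contMDiffOn_extend h.chart_mem _ hzχ).contMDiffAt
      (χ.open_source.mem_nhds hzχ)).mdifferentiableAt (by simp)).hasMFDerivAt
  have h2 := ((consCoord.comp (ContinuousLinearMap.inr ℝ ℝ
    (EuclideanSpace ℝ (Fin n)))).hasMFDerivAt (x := χ.extend (cornerModel n) z)).comp z h1
  have hRi : ∀ w, ι w ∈ O → R (ι w) = consCoord (0, χ.extend (cornerModel n) w) := fun w hw =>
    (h.inv_incl hι hw).2
  have hev : ∀ᶠ w in 𝓝 z, ι w ∈ O := hιc.continuousAt.eventually_mem (h.isOpen.mem_nhds hz)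
  rw [hRz] at hx ⊢
  have h3 := (h.mdifferentiableWithinAt hx).hasMFDerivWithinAt.comp (s := {w | ι w ∈ O}) z
    h2.hasMFDerivWithinAt fun w hw => by
      have := h.mapsTo_inv hw
      rw [hRi w hw] at this
      exact this
  have h4 := (h3.hasMFDerivAt hev).congr_of_eventuallyEq (f₁ := ι) (hev.mono fun w hw => by
    have := h.right_inv _ hw
    rw [hRi w hw] at this
    exact this.symm)
  exact DFunLike.congr_fun h4.mfderiv w

end BoundaryParam

end Collar

/-! ### Tangent vectors and densities in collar coordinates -/

section Hypersurface

variable {n : ℕ} {M : Type*} [TopologicalSpace M]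
  [ChartedSpace (EuclideanQuadrant (n + 1)) M]
  {Y : Type*} [TopologicalSpace Y] [ChartedSpace (EuclideanQuadrant n) Y]

/-- Charts have surjective derivatives. -/
theorem mfderiv_extend_surjective {χ : OpenPartialHomeomorph Y (EuclideanQuadrant n)}
    (hχ : χ ∈ IsManifold.maximalAtlas (cornerModel n) ∞ Y) {z : Y} (hz : z ∈ χ.source)
    (w : EuclideanSpace ℝ (Fin n)) :
    ∃ v : TangentSpace (cornerModel n) z, mfderiv (cornerModel n) 𝓘(ℝ, EuclideanSpace ℝ (Fin n))
      (χ.extend (cornerModel n)) z v = w := by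
  set J := cornerModel n with hJ
  set a := χ.extend J z with ha
  have hza : (χ.extend J).symm a = z := χ.extend_left_inv hz
  have ham : a ∈ (χ.extend J).target := (χ.extend J).map_source (by rwa [χ.extend_source])
  have h1 : HasMFDerivAt J 𝓘(ℝ, EuclideanSpace ℝ (Fin n)) (χ.extend J) z _ :=
    (((χ.contMDiffOn_extend hχ _ hz).contMDiffAt
      (χ.open_source.mem_nhds hz)).mdifferentiableAt (by simp)).hasMFDerivAt
  have hsymm := contMDiffOn_extend_symm hχ
  rw [← χ.extend_target'] at hsymm
  have h2 := ((hsymm a ham).mdifferentiableWithinAt (by simp)).hasMFDerivWithinAt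
  rw [← hza] at h1
  have h3 := h1.comp_hasMFDerivWithinAt a h2
  have h4 : HasMFDerivWithinAt 𝓘(ℝ, EuclideanSpace ℝ (Fin n)) 𝓘(ℝ, EuclideanSpace ℝ (Fin n))
      (χ.extend J ∘ (χ.extend J).symm) (χ.extend J).target a
      (ContinuousLinearMap.id ℝ (EuclideanSpace ℝ (Fin n))) :=
    (hasMFDerivWithinAt_id (χ.extend J).target a).congr_of_eventuallyEq
      (eventuallyEq_of_mem self_mem_nhdsWithin fun y hy => (χ.extend J).right_inv hy)
      ((χ.extend J).right_inv ham)
  have hu : UniqueMDiffWithinAt 𝓘(ℝ, EuclideanSpace ℝ (Fin n)) (χ.extend J).target a := by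
    refine UniqueDiffWithinAt.uniqueMDiffWithinAt ?_
    have h4 : (χ.extend J).target ∈ 𝓝[range J] a := χ.extend_target_mem_nhdsWithin hz
    have h5 : UniqueDiffWithinAt ℝ (range J) a := J.uniqueDiffOn a (mem_range_self _)
    exact h5.mono_nhds (nhdsWithin_le_iff.2 h4)
  have h5 := DFunLike.congr_fun (hu.eq h3 h4) w
  have h6 : ∀ z', z' = z → ∀ v : EuclideanSpace ℝ (Fin n),
      (mfderiv J 𝓘(ℝ, EuclideanSpace ℝ (Fin n)) (χ.extend J) z' v : EuclideanSpace ℝ (Fin n)) =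
      mfderiv J 𝓘(ℝ, EuclideanSpace ℝ (Fin n)) (χ.extend J) z v := by
    rintro _ rfl v; rfl
  exact ⟨_, (h6 _ hza _).symm.trans h5⟩

namespace BoundaryParam

variable {ι : Y → M} {χ : OpenPartialHomeomorph Y (EuclideanQuadrant n)}
    {c : EuclideanSpace ℝ (Fin (n + 1))} {e : ℝ} {G : EuclideanSpace ℝ (Fin (n + 1)) → M}
    {R : M → EuclideanSpace ℝ (Fin (n + 1))} {O : Set M}

theorem paramDeriv_inv_coordDeriv (h : BoundaryParam ι χ c e G R O) {p : M} (hp : p ∈ O)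
    (v : TangentSpace (cornerModel (n + 1)) p) :
    (paramDeriv G c e (R p) (coordDeriv R p v) : EuclideanSpace ℝ (Fin (n + 1))) = v := by
  have h1 := h.paramDeriv_coordDeriv (h.mapsTo_inv hp)
  have h2 : ∀ q, q = p → ∀ w : EuclideanSpace ℝ (Fin (n + 1)),
      (coordDeriv R q w : EuclideanSpace ℝ (Fin (n + 1))) = coordDeriv R p w := by
    rintro q rfl w; rfl
  refine Eq.trans ?_ (h1 (v : EuclideanSpace ℝ (Fin (n + 1))))
  exact congrArg (paramDeriv G c e (R p)) (h2 _ (h.right_inv _ hp) v).symm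

/-- A tangent vector of `M` that is annihilated by `dx₀` is tangent to the hypersurface. -/
theorem mem_range_tangentIncl (h : BoundaryParam ι χ c e G R O) (hι : Function.Injective ι)
    (hιc : Continuous ι) {z : Y} (hz : ι z ∈ O) {v : TangentSpace (cornerModel (n + 1)) (ι z)}
    (hv : coordDeriv R (ι z) v 0 = 0) : v ∈ LinearMap.range (tangentIncl (n := n) ι z) := by
  obtain ⟨w, hw⟩ := mfderiv_extend_surjective h.chart_mem (h.inv_incl hι hz).1
    (tailCoord (coordDeriv R (ι z) v))
  refine ⟨w, (h.tangentIncl_eq hι hιc hz w).trans ?_⟩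
  rw [hw]
  refine Eq.trans ?_ (h.paramDeriv_inv_coordDeriv hz v)
  refine congrArg (paramDeriv G c e (R (ι z))) ?_
  have := consCoord_tailCoord (coordDeriv R (ι z) v)
  rwa [hv] at this

theorem collarChart_incl (h : BoundaryParam ι χ c e G R O) (hι : Function.Injective ι)
    {z : Y} (hz : ι z ∈ O) : collarChart χ (0, z) = R (ι z) :=
  (h.inv_incl hι hz).2.symm

/-- The derivative of the collar coordinates maps the derivative in the direction of the `x₀`-lines
to `∂_u`. -/
theorem mfderiv_collarMap (h : BoundaryParam ι χ c e G R O) (hι : Function.Injective ι)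
    {z : Y} (hz : ι z ∈ O) {v : TangentSpace (cornerModel (n + 1)) (ι z)}
    (hv : (paramDeriv G c e (R (ι z)) (EuclideanSpace.single 0 1) :
      EuclideanSpace ℝ (Fin (n + 1))) = v) :
    mfderiv (cornerModel (n + 1)) (𝓘(ℝ, ℝ).prod (cornerModel n)) (collarMap χ R) (ι z) v =
      ((1 : ℝ), (0 : EuclideanSpace ℝ (Fin n))) := by
  have hzχ := (h.inv_incl hι hz).1
  have hcc := h.collarChart_incl hι hz
  set S : Set (ℝ × Y) := Ici 0 ×ˢ univ with hS
  have hq : collarChart χ ((0 : ℝ), z) ∈ openBox c e := by rw [hcc]; exact h.mapsTo_inv hz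
  have hu : UniqueMDiffWithinAt (𝓘(ℝ, ℝ).prod (cornerModel n)) S ((0 : ℝ), z) :=
    ((uniqueDiffOn_Ici (0 : ℝ)).uniqueMDiffOn.prod uniqueMDiffOn_univ) _
      ⟨self_mem_Ici, mem_univ _⟩
  have hGz : G (collarChart χ ((0 : ℝ), z)) = ι z := by rw [hcc]; exact h.right_inv _ hz
  have h1 := ((h.contMDiffWithinAt_collarInv (s := S) subset_rfl hzχ
    hq).mdifferentiableWithinAt (by simp)).hasMFDerivWithinAt
  have h2 : HasMFDerivAt (cornerModel (n + 1)) (𝓘(ℝ, ℝ).prod (cornerModel n)) (collarMap χ R)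
      (G (collarChart χ ((0 : ℝ), z))) _ :=
    (((h.contMDiffOn_collarMap _ (h.mapsTo hq)).contMDiffAt
      (h.isOpen.mem_nhds (h.mapsTo hq))).mdifferentiableAt (by simp)).hasMFDerivAt
  have h3 := h2.comp_hasMFDerivWithinAt ((0 : ℝ), z) h1
  have h4 : HasMFDerivWithinAt (𝓘(ℝ, ℝ).prod (cornerModel n)) (𝓘(ℝ, ℝ).prod (cornerModel n))
      (collarMap χ R ∘ fun q => G (collarChart χ q)) S ((0 : ℝ), z)
      (ContinuousLinearMap.id ℝ (ℝ × EuclideanSpace ℝ (Fin n))) :=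
    (hasMFDerivWithinAt_id S ((0 : ℝ), z)).congr_of_eventuallyEq
      ((h.eventually_collarChart_mem hzχ hq).mono fun q' hq' =>
        h.collarMap_apply_collarChart hq'.1 hq'.2)
      (h.collarMap_apply_collarChart hzχ hq)
  have h5 := DFunLike.congr_fun (hu.eq h3 h4) ((1 : ℝ), (0 : EuclideanSpace ℝ (Fin n)))
  have h6 : ∀ p, p = ι z → ∀ w : EuclideanSpace ℝ (Fin (n + 1)),
      (mfderiv (cornerModel (n + 1)) (𝓘(ℝ, ℝ).prod (cornerModel n)) (collarMap χ R) p w :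
        ℝ × EuclideanSpace ℝ (Fin n)) =
      mfderiv (cornerModel (n + 1)) (𝓘(ℝ, ℝ).prod (cornerModel n)) (collarMap χ R) (ι z) w := by
    rintro _ rfl w; rfl
  refine Eq.trans ?_ ((h6 _ hGz _).symm.trans h5)
  refine congrArg (mfderiv (cornerModel (n + 1)) (𝓘(ℝ, ℝ).prod (cornerModel n))
    (collarMap χ R) (ι z)) ?_
  refine hv.symm.trans ((h.mfderivWithin_collarInv subset_rfl hu hzχ hq _).trans ?_).symm
  rw [hcc]
  refine congrArg (paramDeriv G c e (R (ι z))) ?_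
  ext i
  refine Fin.cases ?_ (fun i => ?_) i
  · simp
  · simp only [consCoord_succ]
    refine (congrArg (fun v : EuclideanSpace ℝ (Fin n) => v i) (map_zero _)).trans ?_
    simp

end BoundaryParam

end Hypersurface

section Density

variable {n : ℕ} {M : Type*} [TopologicalSpace M]
  [ChartedSpace (EuclideanQuadrant (n + 1)) M]
  {Y : Type*} [TopologicalSpace Y] [ChartedSpace (EuclideanQuadrant n) Y]
  {F : Type*} [NormedAddCommGroup F] [NormedSpace ℝ F]
  {A : M → Type*} [TopologicalSpace (Bundle.TotalSpace F A)] [∀ p, TopologicalSpace (A p)]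
  [∀ p, AddCommGroup (A p)] [∀ p, Module ℝ (A p)]
  [FiberBundle F A] [VectorBundle ℝ F A]

/-- Splitting off a unit normal vector from the volume density. -/
theorem gramDensity_cons_of_orthogonal
    (g : Bundle.ContMDiffRiemannianMetric (cornerModel (n + 1)) ∞ F A) {p : M} {k : ℕ}
    {N : A p} (hN : g.inner p N N = 1) {b : Fin k → A p} (hb : ∀ i, g.inner p N (b i) = 0)
    (a : ℝ) : gramDensity g (k + 1) p (Fin.cons (a • N) b) = |a| * gramDensity g k p b := by
  have h1 : (Matrix.of fun i j => g.inner p ((Fin.cons (a • N) b : Fin (k + 1) → A p) i)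
      ((Fin.cons (a • N) b : Fin (k + 1) → A p) j)).det =
      a ^ 2 * (Matrix.of fun i j => g.inner p (b i) (b j)).det := by
    rw [Matrix.det_succ_row_zero, Fin.sum_univ_succ, Finset.sum_eq_zero, add_zero]
    · simp only [Fin.val_zero, pow_zero, one_mul, Matrix.of_apply, Fin.cons_zero, map_smul,
        smul_apply, smul_eq_mul, hN, mul_one, Fin.succAbove_zero, sq]
      rfl
    · intro j _
      simp [hb]
  change √(Matrix.det _) = _ * √(Matrix.det _)
  rw [h1, Real.sqrt_mul (sq_nonneg _), Real.sqrt_sq_eq_abs]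

/-- In a normal form, the density of `M` is the product of Lebesgue measure on the `x₀`-lines with
the induced density of `Y`. -/
theorem NormalParam.tangentDensity_cons
    {ϱ : ∀ p : M, A p →ₗ[ℝ] TangentSpace (cornerModel (n + 1)) p} {ι : Y → M}
    {g : Bundle.ContMDiffRiemannianMetric (cornerModel (n + 1)) ∞ F A} {s : ∀ p, A p}
    {χ : OpenPartialHomeomorph Y (EuclideanQuadrant n)}
    {c : EuclideanSpace ℝ (Fin (n + 1))} {e : ℝ} {G : EuclideanSpace ℝ (Fin (n + 1)) → M}
    {R : M → EuclideanSpace ℝ (Fin (n + 1))} {O : Set M}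
    (h : NormalParam ϱ (volumeDensity g) s ι χ c e G R O) (hι : Function.Injective ι)
    (hιc : Continuous ι)
    {q : ℝ × Y} (hq : q.2 ∈ χ.source) (hqe : collarChart χ q ∈ openBox c e)
    (hbij : Function.Bijective (ϱ (ι q.2))) (hunit : g.inner (ι q.2) (s (ι q.2)) (s (ι q.2)) = 1)
    (horth : ∀ b ∈ boundaryAlgebroid ϱ ι q.2, g.inner (ι q.2) (s (ι q.2)) b = 0)
    (a : ℝ) (w : Fin n → TangentSpace (cornerModel n) q.2) :
    tangentDensity ϱ (volumeDensity g) (G (collarChart χ q)) (Fin.cons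
        (paramDeriv G c e (collarChart χ q) (consCoord (a, 0)))
        fun i => paramDeriv G c e (collarChart χ q) (consCoord (0, mfderiv (cornerModel n)
          𝓘(ℝ, EuclideanSpace ℝ (Fin n)) (χ.extend (cornerModel n)) q.2 (w i)))) =
      |a| * boundaryTangentDensity ϱ ι (inducedDensity ϱ ι g) q.2 w := by
  obtain ⟨t, z⟩ := q
  dsimp only at hq hbij hunit horth w ⊢
  set x := collarChart χ (t, z) with hx
  set v : Fin (n + 1) → EuclideanSpace ℝ (Fin (n + 1)) := Fin.cons (consCoord (a, 0))
    fun i => consCoord (0, mfderiv (cornerModel n)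
          𝓘(ℝ, EuclideanSpace ℝ (Fin n)) (χ.extend (cornerModel n)) z (w i)) with hv
  have hx0 := h.setZero_zero_mem hqe
  have hGz : G (setZero 0 x) = ι z := by
    rw [h.eq_incl _ hx0 (setZero_zero _ _), tailCoord_setZero, hx, collarChart,
      tailCoord_consCoord]
    exact congrArg ι (χ.extend_left_inv hq)
  have hzO : ι z ∈ O := hGz ▸ h.mapsTo hx0
  have hRz : R (ι z) = setZero 0 x := by rw [← hGz]; exact h.left_inv _ hx0
  have h1 : tangentDensity ϱ (volumeDensity g) (G x) (Fin.cons
        (paramDeriv G c e x (consCoord (a, 0)))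
        fun i => paramDeriv G c e x (consCoord (0, mfderiv (cornerModel n)
          𝓘(ℝ, EuclideanSpace ℝ (Fin n)) (χ.extend (cornerModel n)) z (w i)))) =
      paramDensity ϱ (volumeDensity g) G c e x v := by
    refine congrArg (tangentDensity ϱ (volumeDensity g) (G x)).toFun (funext fun i => ?_)
    refine Fin.cases rfl (fun i => rfl) i
  have h2 : paramDensity ϱ (volumeDensity g) G c e x v =
      paramDensity ϱ (volumeDensity g) G c e (setZero 0 x) v :=
    OneDensity.eq_of_single (h.density_eq x hqe (by rwa [hGz])) v
  have h3 : ∀ p, p = ι z → ∀ w : Fin (n + 1) → EuclideanSpace ℝ (Fin (n + 1)),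
      (tangentDensity ϱ (volumeDensity g) p).toFun w =
        (tangentDensity ϱ (volumeDensity g) (ι z)).toFun w := by
    rintro _ rfl w; rfl
  have h4 : ∀ p, p = ι z → (ϱ p (s p) : EuclideanSpace ℝ (Fin (n + 1))) = ϱ (ι z) (s (ι z)) := by
    rintro _ rfl; rfl
  -- on `{x₀ = 0}` the coordinate vectors are the normal vector and vectors tangent to `Y`
  have h5 : (fun i => (paramDeriv G c e (setZero 0 x) (v i) : EuclideanSpace ℝ (Fin (n + 1)))) =
      (Fin.cons (ϱ (ι z) (a • s (ι z))) fun i => tangentIncl (n := n) ι z (w i) :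
        Fin (n + 1) → TangentSpace (cornerModel (n + 1)) (ι z)) := by
    funext i
    refine Fin.cases ?_ (fun i => ?_) i
    · have h6 : consCoord (a, (0 : EuclideanSpace ℝ (Fin n))) =
          a • EuclideanSpace.single (0 : Fin (n + 1)) (1 : ℝ) := by
        ext j
        refine Fin.cases ?_ (fun j => ?_) j <;> simp
      have h7 := h.direction_eq _ hx0 (setZero_zero _ _)
      simp only [hv, Fin.cons_zero]
      rw [h6, map_smul, map_smul, h7]
      exact congrArg (a • ·) (h4 _ hGz)
    · simp only [hv, Fin.cons_succ]
      refine Eq.trans ?_ (h.tangentIncl_eq hι hιc hzO (w i)).symm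
      rw [hRz]
  refine (h1.trans h2).trans ((h3 _ hGz _).trans
    ((congrArg (tangentDensity ϱ (volumeDensity g) (ι z)).toFun h5).trans ?_))
  have h8 : (fun i => (ϱ (ι z)).inverseOrZero
      ((Fin.cons (ϱ (ι z) (a • s (ι z))) fun i => tangentIncl (n := n) ι z (w i) :
        Fin (n + 1) → TangentSpace (cornerModel (n + 1)) (ι z)) i)) =
      Fin.cons (a • s (ι z)) fun i => (boundaryAnchorInv ϱ ι z (w i) : A (ι z)) := by
    funext i
    refine Fin.cases ?_ (fun i => ?_) i
    · exact LinearMap.inverseOrZero_apply hbij _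
    · rfl
  refine (congrArg (gramDensity g (n + 1) (ι z)).toFun h8).trans ?_
  exact gramDensity_cons_of_orthogonal g hunit
    (fun i => horth _ (boundaryAnchorInv ϱ ι z (w i)).2) a

end Density

/-! ### Existence of a collar -/

section Collar

variable {n : ℕ} {M : Type*} [TopologicalSpace M] [T2Space M] [CompactSpace M]
  [ChartedSpace (EuclideanQuadrant (n + 1)) M] [IsManifold (cornerModel (n + 1)) ∞ M]
  {Y : Type*} [TopologicalSpace Y] [Nonempty Y] [ChartedSpace (EuclideanQuadrant n) Y]

/-- Adapted parametrizations whose collar coordinates have the same germs at common points of `Y`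
give a collar. -/
theorem IsBoundaryHypersurface.exists_collar {ι : Y → M}
    (hι : IsBoundaryHypersurface (n := n) ι) {J : Type*}
    {χ : J → OpenPartialHomeomorph Y (EuclideanQuadrant n)}
    {c : J → EuclideanSpace ℝ (Fin (n + 1))} {e : J → ℝ}
    {G : J → EuclideanSpace ℝ (Fin (n + 1)) → M} {R : J → M → EuclideanSpace ℝ (Fin (n + 1))}
    {O : J → Set M} (h : ∀ j, BoundaryParam ι (χ j) (c j) (e j) (G j) (R j) (O j))
    (hcover : ∀ z, ∃ j, ι z ∈ O j)
    (hag : ∀ i j z, ι z ∈ O i → ι z ∈ O j →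
      ∀ᶠ p in 𝓝 (ι z), collarMap (χ i) (R i) p = collarMap (χ j) (R j) p) :
    ∃ (r : ℝ) (Φ : PartialEquiv M (ℝ × Y)) (u : M → ℝ), 0 < r ∧ IsCollarDiffeo (n := n) ι r Φ ∧
      ContMDiff (cornerModel (n + 1)) 𝓘(ℝ, ℝ) ∞ u ∧ (∀ p, u p = 0 ↔ p ∈ range ι) ∧
      (∀ p ∈ Φ.source, (Φ p).1 = u p) ∧
      (∀ p ∈ Φ.source, ∃ j, p ∈ O j ∧ ∀ᶠ p' in 𝓝 p, Φ p' = collarMap (χ j) (R j) p') ∧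
      ∀ q ∈ Φ.target, ∃ j, q.2 ∈ (χ j).source ∧ collarChart (χ j) q ∈ openBox (c j) (e j) ∧
        Φ.symm q = G j (collarChart (χ j) q) ∧
        ∀ᶠ q' in 𝓝[Φ.target] q, Φ.symm q' = G j (collarChart (χ j) q') := by
  have hinj := hι.isClosedEmbedding.injective
  have hKc : IsClosed (range ι) := hι.isClosedEmbedding.isClosed_range
  have : T2Space Y := hι.isClosedEmbedding.isEmbedding.t2Space
  have : CompactSpace Y := hι.isClosedEmbedding.compactSpace
  obtain ⟨f, hf⟩ := hKc.isCompact.exists_glue (f := fun j => collarMap (χ j) (R j))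
    (fun j => (h j).isOpen) (by rintro _ ⟨z, rfl⟩; exact hcover z)
    (by rintro i j _ ⟨z, rfl⟩ hi hj; exact hag i j z hi hj)
  set U₀ : Set M := {p | ∃ j, p ∈ O j ∧ ∀ᶠ p' in 𝓝 p, f p' = collarMap (χ j) (R j) p'} with hU₀
  have hU₀o : IsOpen U₀ := by
    have : U₀ = ⋃ j, O j ∩ {p | ∀ᶠ p' in 𝓝 p, f p' = collarMap (χ j) (R j) p'} := by
      ext p; simp [hU₀]
    rw [this]
    exact isOpen_iUnion fun j => (h j).isOpen.inter isOpen_setOfPred_eventually_nhds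
  have hKU₀ : range ι ⊆ U₀ := fun p hp => hf p hp
  have hfs : ∀ p ∈ U₀, ContMDiffAt (cornerModel (n + 1)) (𝓘(ℝ, ℝ).prod (cornerModel n)) ∞ f p := by
    rintro p ⟨j, hpO, hp⟩
    exact (((h j).contMDiffOn_collarMap p hpO).contMDiffAt
      ((h j).isOpen.mem_nhds hpO)).congr_of_eventuallyEq hp
  have hfι : ∀ z, f (ι z) = (0, z) := fun z => by
    obtain ⟨j, hj, hz⟩ := hf (ι z) (mem_range_self z)
    rw [hz.self_of_nhds, collarMap, (h j).inv_apply_zero z hj, (h j).paramRetract_incl hinj hj]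
  have hf0 : ∀ p ∈ U₀, 0 ≤ (f p).1 ∧ ((f p).1 = 0 → p ∈ range ι) := by
    rintro p ⟨j, hpO, hp⟩
    rw [hp.self_of_nhds]
    have hx := (h j).mapsTo_inv hpO
    refine ⟨((h j).apply_zero_mem hx).1, fun h0 => ?_⟩
    rw [← (h j).right_inv p hpO, (h j).eq_incl _ hx h0]
    exact mem_range_self _
  -- `f` is injective near `Y`
  obtain ⟨t, ht, hft⟩ := InjOn.exists_mem_nhdsSet (f := f) (s := range ι)
    (by
      rintro _ ⟨z, rfl⟩ _ ⟨z', rfl⟩ hzz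
      rw [hfι, hfι] at hzz
      rw [(Prod.mk.inj hzz).2]) hKc.isCompact
    (fun p hp => (hfs p (hKU₀ hp)).continuousAt)
    (fun p hp => by
      obtain ⟨j, hpO, hpj⟩ := hKU₀ hp
      refine ⟨O j ∩ {p' | f p' = collarMap (χ j) (R j) p'},
        inter_mem ((h j).isOpen.mem_nhds hpO) hpj, fun a ha b hb hab => ?_⟩
      exact (h j).injOn_collarMap ha.1 hb.1 (by rw [← ha.2, ← hb.2, hab]))
  set U₁ := U₀ ∩ interior t with hU₁
  have hU₁o : IsOpen U₁ := hU₀o.inter isOpen_interior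
  have hKU₁ : range ι ⊆ U₁ := subset_inter hKU₀ (subset_interior_iff_mem_nhdsSet.2 ht)
  -- the boundary defining function
  obtain ⟨V, hVo, hKV, hVU⟩ := normal_exists_closure_subset hKc hU₁o hKU₁
  obtain ⟨ψ, hψ1, hψ0, hψI⟩ := exists_contMDiffMap_one_nhds_of_subset_interior (n := (⊤ : ℕ∞))
    (cornerModel (n + 1)) hKc (t := closure V)
    (hKV.trans (hVo.subset_interior_closure))
  set u : M → ℝ := fun p => ψ p * (f p).1 + (1 - ψ p) with hu
  have hus : ContMDiff (cornerModel (n + 1)) 𝓘(ℝ, ℝ) ∞ u := by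
    intro p
    by_cases hp : p ∈ closure V
    · have h1 : ContMDiffAt (cornerModel (n + 1)) 𝓘(ℝ, ℝ) ∞ (fun p => (f p).1) p :=
        contMDiff_fst.contMDiffAt.comp p (hfs p (hVU hp).1)
      exact ((ψ.contMDiff p).mul h1).add (contMDiffAt_const.sub (ψ.contMDiff p))
    · have h1 : ∀ᶠ p' in 𝓝 p, u p' = 1 := by
        filter_upwards [isClosed_closure.isOpen_compl.mem_nhds hp] with p' hp'
        simp [hu, hψ0 p' hp']
      exact contMDiffAt_const.congr_of_eventuallyEq h1
  have hψK : ∀ p ∈ range ι, ∀ᶠ p' in 𝓝 p, ψ p' = 1 := eventually_nhdsSet_iff_forall.1 hψ1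
  have hu0 : ∀ p, u p = 0 ↔ p ∈ range ι := by
    intro p
    constructor
    · intro hp
      have hI := hψI p
      by_cases hpV : p ∈ closure V
      · have h1 := hf0 p (hVU hpV).1
        have h2 : ψ p = 1 := by nlinarith [mul_nonneg hI.1 h1.1, hI.2]
        rw [hu] at hp
        simp only [h2, one_mul, sub_self, add_zero] at hp
        exact h1.2 hp
      · simp [hu, hψ0 p hpV] at hp
    · rintro ⟨z, rfl⟩
      have h1 := (hψK _ (mem_range_self z)).self_of_nhds
      simp [hu, h1, hfι]
  set U₂ := U₁ ∩ {p | ∀ᶠ p' in 𝓝 p, ψ p' = 1} with hU₂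
  have hU₂o : IsOpen U₂ := hU₁o.inter isOpen_setOfPred_eventually_nhds
  have hKU₂ : range ι ⊆ U₂ := subset_inter hKU₁ hψK
  have hinjU : InjOn f U₂ := hft.mono fun p hp => interior_subset hp.1.2
  have hU₂₀ : U₂ ⊆ U₀ := fun p hp => hp.1.1
  -- local inverses
  have hloc : ∀ p ∈ U₂, ∃ j, (f p).2 ∈ (χ j).source ∧
      collarChart (χ j) (f p) ∈ openBox (c j) (e j) ∧ G j (collarChart (χ j) (f p)) = p ∧
      ∀ᶠ q in 𝓝[Ici 0 ×ˢ univ] f p, G j (collarChart (χ j) q) ∈ U₂ ∧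
        f (G j (collarChart (χ j) q)) = q := by
    intro p hp
    obtain ⟨j, hpO, hpj⟩ := hU₂₀ hp
    obtain ⟨h1, h2⟩ := (h j).collarChart_collarMap hpO
    rw [← hpj.self_of_nhds] at h1 h2
    have h3 : collarChart (χ j) (f p) ∈ openBox (c j) (e j) := by
      rw [h2]; exact (h j).mapsTo_inv hpO
    have h4 : G j (collarChart (χ j) (f p)) = p := by rw [h2]; exact (h j).right_inv p hpO
    refine ⟨j, h1, h3, h4, ?_⟩
    have h5 := ((h j).contMDiffWithinAt_collarInv subset_rfl h1 h3).continuousWithinAt.tendsto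
    rw [h4] at h5
    filter_upwards [h5.eventually_mem (hU₂o.mem_nhds hp), h5.eventually hpj,
      (h j).eventually_collarChart_mem h1 h3] with q hq1 hq2 hq3
    exact ⟨hq1, hq2.trans ((h j).collarMap_apply_collarChart hq3.1 hq3.2)⟩
  -- the width of the collar
  obtain ⟨r, hr, hrs⟩ : ∃ r > 0, ∀ t : ℝ, dist t 0 < r → ∀ y ∈ (univ : Set Y), 0 ≤ t →
      ∃ p ∈ U₂, f p = (t, y) := by
    refine Metric.eventually_nhds_iff.1 (isCompact_univ.eventually_forall_of_forall_eventually
      (P := fun t y => 0 ≤ t → ∃ p ∈ U₂, f p = (t, y)) fun y _ => ?_)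
    obtain ⟨j, -, -, -, hj⟩ := hloc (ι y) (hKU₂ (mem_range_self y))
    rw [hfι, eventually_nhdsWithin_iff] at hj
    filter_upwards [hj] with q hq hq0
    exact ⟨_, (hq ⟨hq0, mem_univ _⟩).1, (hq ⟨hq0, mem_univ _⟩).2⟩
  have himg : ∀ q ∈ Ico 0 r ×ˢ (univ : Set Y), ∃ p ∈ U₂, f p = q := fun q hq =>
    hrs q.1 (by rw [Real.dist_eq, sub_zero, abs_of_nonneg hq.1.1]; exact hq.1.2) q.2
      (mem_univ _) hq.1.1
  have : Nonempty M := (inferInstance : Nonempty Y).map ι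
  let Φ : PartialEquiv M (ℝ × Y) :=
    { toFun := f
      invFun := Function.invFunOn f U₂
      source := U₂ ∩ f ⁻¹' (Iio r ×ˢ univ)
      target := Ico 0 r ×ˢ univ
      map_source' := fun p hp => ⟨⟨(hf0 p (hU₂₀ hp.1)).1, hp.2.1⟩, mem_univ _⟩
      map_target' := fun q hq => ⟨Function.invFunOn_mem (himg q hq), by
        rw [mem_preimage, Function.invFunOn_eq (himg q hq)]
        exact ⟨hq.1.2, mem_univ _⟩⟩
      left_inv' := fun p hp => hinjU.leftInvOn_invFunOn hp.1
      right_inv' := fun q hq => Function.invFunOn_eq (himg q hq) }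
  have hsymm : ∀ q ∈ Φ.target, ∃ j, q.2 ∈ (χ j).source ∧
      collarChart (χ j) q ∈ openBox (c j) (e j) ∧ Φ.symm q = G j (collarChart (χ j) q) ∧
      ∀ᶠ q' in 𝓝[Φ.target] q, Φ.symm q' = G j (collarChart (χ j) q') := by
    intro q hq
    have hp := Φ.map_target hq
    have hpq : f (Φ.symm q) = q := Φ.right_inv hq
    obtain ⟨j, h1, h2, h3, h4⟩ := hloc _ hp.1
    rw [hpq] at h1 h2 h3 h4
    refine ⟨j, h1, h2, h3.symm, ?_⟩
    have hle : 𝓝[Φ.target] q ≤ 𝓝[Ici 0 ×ˢ univ] q :=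
      nhdsWithin_mono _ (prod_mono Ico_subset_Ici_self subset_rfl)
    filter_upwards [hle h4, self_mem_nhdsWithin] with q' hq' hq't
    refine hinjU (Φ.map_target hq't).1 hq'.1 ?_
    rw [hq'.2]
    exact Φ.right_inv hq't
  refine ⟨r, Φ, u, hr, ⟨?_, ?_, rfl, ?_, ?_⟩, hus, hu0, ?_, ?_, hsymm⟩
  · exact ContinuousOn.isOpen_inter_preimage
      (fun p hp => (hfs p (hU₂₀ hp)).continuousAt.continuousWithinAt) hU₂o
      (isOpen_Iio.prod isOpen_univ)
  · rintro _ ⟨z, rfl⟩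
    refine ⟨hKU₂ (mem_range_self z), ?_⟩
    rw [mem_preimage, hfι]
    exact ⟨hr, mem_univ _⟩
  · exact fun p hp => (hfs p (hU₂₀ hp.1)).contMDiffWithinAt
  · intro q hq
    obtain ⟨j, h1, h2, h3, h4⟩ := hsymm q hq
    exact ((h j).contMDiffWithinAt_collarInv (prod_mono Ico_subset_Ici_self subset_rfl)
      h1 h2).congr_of_eventuallyEq h4 h3
  · intro p hp
    have h1 : ψ p = 1 := hp.1.2.self_of_nhds
    simp [hu, h1, Φ]
  · exact fun p hp => hU₂₀ hp.1

end Collar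

/-! ### Collars adapted to a density -/

section Derivative

variable {n : ℕ} {M : Type*} [TopologicalSpace M]
  [ChartedSpace (EuclideanQuadrant (n + 1)) M]
  {Y : Type*} [TopologicalSpace Y] [ChartedSpace (EuclideanQuadrant n) Y]
  {ι : Y → M} {χ : OpenPartialHomeomorph Y (EuclideanQuadrant n)}
  {c : EuclideanSpace ℝ (Fin (n + 1))} {e : ℝ} {G : EuclideanSpace ℝ (Fin (n + 1)) → M}
  {R : M → EuclideanSpace ℝ (Fin (n + 1))} {O : Set M}

theorem BoundaryParam.mfderiv_apply_zero (h : BoundaryParam ι χ c e G R O) {p : M} (hp : p ∈ O)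
    (v : TangentSpace (cornerModel (n + 1)) p) :
    mfderiv (cornerModel (n + 1)) 𝓘(ℝ, ℝ) (fun p => R p 0) p v = coordDeriv R p v 0 := by
  have h1 : HasMFDerivAt 𝓘(ℝ, EuclideanSpace ℝ (Fin (n + 1))) 𝓘(ℝ, ℝ)
      (EuclideanSpace.proj (𝕜 := ℝ) 0 : EuclideanSpace ℝ (Fin (n + 1)) → ℝ)
      (R p) (EuclideanSpace.proj (𝕜 := ℝ) 0) :=
    (EuclideanSpace.proj (𝕜 := ℝ) (0 : Fin (n + 1))).hasFDerivAt.hasMFDerivAt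
  exact DFunLike.congr_fun (h1.comp p (h.mdifferentiableAt_inv hp).hasMFDerivAt).mfderiv v

/-- `coordDeriv` inverts `paramDeriv`, for vectors at a given point of `M`. -/
theorem BoundaryParam.coordDeriv_eq (h : BoundaryParam ι χ c e G R O) {p : M} (hp : p ∈ O)
    {v : TangentSpace (cornerModel (n + 1)) p} {w : EuclideanSpace ℝ (Fin (n + 1))}
    (hv : (paramDeriv G c e (R p) w : EuclideanSpace ℝ (Fin (n + 1))) = v) :
    coordDeriv R p v = w := by
  have hx := h.mapsTo_inv hp
  rw [← h.coordDeriv_paramDeriv hx (coordDeriv R p v), ← h.coordDeriv_paramDeriv hx w]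
  exact congrArg (coordDeriv R (G (R p))) ((h.paramDeriv_inv_coordDeriv hp v).trans hv.symm)

/-- At `Y`, the coordinate field in the direction of the `x₀`-lines is the field `ϱ s`. -/
theorem NormalParam.paramDeriv_incl {A : M → Type*} [∀ p, AddCommGroup (A p)]
    [∀ p, Module ℝ (A p)] {ϱ : ∀ p : M, A p →ₗ[ℝ] TangentSpace (cornerModel (n + 1)) p}
    {μ : ∀ p, OneDensity (n + 1) (A p)} {s : ∀ p, A p} (h : NormalParam ϱ μ s ι χ c e G R O)
    {z : Y} (hz : ι z ∈ O) :
    (paramDeriv G c e (R (ι z)) (EuclideanSpace.single 0 1) : EuclideanSpace ℝ (Fin (n + 1))) =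
      ϱ (ι z) (s (ι z)) := by
  have h1 : ∀ p, p = ι z → (ϱ p (s p) : EuclideanSpace ℝ (Fin (n + 1))) = ϱ (ι z) (s (ι z)) := by
    rintro _ rfl; rfl
  exact (h.direction_eq _ (h.mapsTo_inv hz) (h.inv_apply_zero z hz)).trans
    (h1 _ (h.right_inv _ hz))

end Derivative

theorem mainTheorem7 {n : ℕ}
    {M : Type*} [TopologicalSpace M] [T2Space M] [CompactSpace M]
    [ChartedSpace (EuclideanQuadrant (n + 1)) M] [IsManifold (cornerModel (n + 1)) ∞ M]
    {Y : Type*} [TopologicalSpace Y] [Nonempty Y]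
    [ChartedSpace (EuclideanQuadrant n) Y] [IsManifold (cornerModel n) ∞ Y]
    {F : Type*} [NormedAddCommGroup F] [NormedSpace ℝ F] [FiniteDimensional ℝ F]
    {A : M → Type*} [TopologicalSpace (Bundle.TotalSpace F A)] [∀ p, TopologicalSpace (A p)]
    [∀ p, AddCommGroup (A p)] [∀ p, Module ℝ (A p)]
    [∀ p, IsTopologicalAddGroup (A p)] [∀ p, ContinuousConstSMul ℝ (A p)]
    [FiberBundle F A] [VectorBundle ℝ F A] [ContMDiffVectorBundle ∞ F A (cornerModel (n + 1))]
    (ϱ : ∀ p : M, A p →ₗ[ℝ] TangentSpace (cornerModel (n + 1)) p) (ι : Y → M)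
    (hM : IsLieManifoldWithBoundary F ϱ ι)
    -- the measure `μ = μ_g`, for an `A`-metric `g`, and the induced measure `ν` on `Y`
    (g : Bundle.ContMDiffRiemannianMetric (cornerModel (n + 1)) ∞ F A)
    (μ : ∀ p, OneDensity (n + 1) (A p)) (hμ : ∀ p, μ p = volumeDensity g p)
    (ν : ∀ y, OneDensity n (boundaryAlgebroid ϱ ι y)) (hν : ∀ y, ν y = inducedDensity ϱ ι g y)
    -- the normal vector field `N` and the accompanying one-form `τ`
    (N : ∀ y, A (ι y)) (hN : IsInwardUnitNormal ϱ ι g N)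
    (τ : ∀ y, A (ι y) →ₗ[ℝ] ℝ) (hτN : ∀ y, τ y (N y) = 1)
    (hτB : ∀ y, ∀ b ∈ boundaryAlgebroid ϱ ι y, τ y b = 0) :
    ∃ (r : ℝ) (Φ : PartialEquiv M (ℝ × Y)) (u : M → ℝ) (ψ : M → Y),
      0 < r ∧ IsCollarDiffeo (n := n) ι r Φ ∧ (∀ p ∈ Φ.source, Φ p = (u p, ψ p)) ∧
      -- i) `u` is a boundary defining function of `Y`
      IsBoundaryDefiningFunction (n := n) ι u ∧
      -- ii) `Φ` is the identity on `Y`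
      (∀ y, Φ (ι y) = (0, y)) ∧
      -- iii) `dΦ(N) = ∂_u` along `Y`
      (∀ y, mfderiv (cornerModel (n + 1)) (𝓘(ℝ, ℝ).prod (cornerModel n)) Φ (ι y)
        (ϱ (ι y) (N y)) = ((1 : ℝ), (0 : EuclideanSpace ℝ (Fin n)))) ∧
      -- iv) `τ = du` along `Y`
      (∀ y, ∀ a : A (ι y),
        mfderiv (cornerModel (n + 1)) 𝓘(ℝ, ℝ) u (ι y) (ϱ (ι y) a) = τ y a) ∧
      -- v) `Φ_* μ = |du| ⊗ ν` on `[0, r) × Y`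
      (∀ q ∈ Φ.target, ι q.2 ∉ singularBoundary (n := n) (range ι) →
        (pushforwardDensity Φ (tangentDensity ϱ μ) q).IsLebesgueTensor
          (boundaryTangentDensity ϱ ι ν q.2)) := by
  obtain rfl : μ = volumeDensity g := funext hμ
  obtain rfl : ν = inducedDensity ϱ ι g := funext hν
  have hinj := hM.hypersurface.isClosedEmbedding.injective
  have hιc := hM.hypersurface.isClosedEmbedding.continuous
  obtain ⟨s, hs, hsN⟩ := hM.hypersurface.exists_isSmoothSection_eq hN.contMDiff
  -- normal forms for an extension `s` of `N`, and the collar they fit together to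
  choose χ c e G R O h hO using fun y => hM.exists_normalParam g hs
    (fun φ hφ i y hy => by rw [hsN]; exact hN.inward φ hφ i y hy) y
  obtain ⟨r, Φ, u, hr, hΦ, hus, hu0, hΦu, hΦloc, hsymm⟩ := hM.hypersurface.exists_collar
    (fun j => (h j).toBoundaryParam) (fun z => ⟨z, hO z⟩) fun i j z hi hj =>
      ((h j).eventually_eq hM (h i) hj hi).mono fun p hp => Prod.ext hp.1 hp.2
  -- the derivatives of `Φ` and `u` along `Y`
  have hder : ∀ y, mfderiv (cornerModel (n + 1)) (𝓘(ℝ, ℝ).prod (cornerModel n)) Φ (ι y)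
        (ϱ (ι y) (N y)) = ((1 : ℝ), (0 : EuclideanSpace ℝ (Fin n))) ∧
      mfderiv (cornerModel (n + 1)) 𝓘(ℝ, ℝ) u (ι y) (ϱ (ι y) (N y)) = (1 : ℝ) ∧
      ∀ v, mfderiv (cornerModel (n + 1)) 𝓘(ℝ, ℝ) u (ι y) v = (0 : ℝ) →
        v ∈ LinearMap.range (tangentIncl (n := n) ι y) := by
    intro y
    have hy := hΦ.subset_source (mem_range_self y)
    obtain ⟨j, hj, hev⟩ := hΦloc _ hy
    have hev' : (Φ : M → ℝ × Y) =ᶠ[𝓝 (ι y)] collarMap (χ j) (R j) := hev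
    have h1 := (h j).paramDeriv_incl hj
    rw [hsN] at h1
    have h2 : u =ᶠ[𝓝 (ι y)] fun p => R j p 0 := by
      filter_upwards [hev, hΦ.isOpen_source.mem_nhds hy] with p hp hps
      rw [← hΦu p hps, hp]
      rfl
    have h3 : ∀ v : TangentSpace (cornerModel (n + 1)) (ι y),
        (mfderiv (cornerModel (n + 1)) 𝓘(ℝ, ℝ) u (ι y) v : ℝ) = coordDeriv (R j) (ι y) v 0 :=
      fun v => (DFunLike.congr_fun h2.mfderiv_eq v).trans ((h j).mfderiv_apply_zero hj v)
    refine ⟨?_, ?_, fun v hv => ?_⟩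
    · exact (DFunLike.congr_fun hev'.mfderiv_eq (ϱ (ι y) (N y))).trans
        ((h j).mfderiv_collarMap hinj hj h1)
    · refine (h3 _).trans ?_
      rw [(h j).coordDeriv_eq hj h1]
      have h4 : (EuclideanSpace.single 0 1 : EuclideanSpace ℝ (Fin (n + 1))) 0 = 1 := by simp
      exact h4
    · rw [h3] at hv
      exact (h j).mem_range_tangentIncl hinj hιc hj hv
  have hΦι : ∀ y, Φ (ι y) = (0, y) := fun y => by
    obtain ⟨j, hj, hev⟩ := hΦloc _ (hΦ.subset_source (mem_range_self y))
    rw [hev.self_of_nhds, collarMap, (h j).inv_apply_zero y hj, (h j).paramRetract_incl hinj hj]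
  refine ⟨r, Φ, u, fun p => (Φ p).2, hr, hΦ, fun p hp => Prod.ext (hΦu p hp) rfl,
    ⟨hus, hu0, fun y h0 => ?_⟩, hΦι, fun y => (hder y).1, fun y a => ?_, ?_⟩
  · have := (hder y).2.1
    rw [h0] at this
    exact zero_ne_one (α := ℝ) this
  · -- `a - du(ϱ a) N` is annihilated by `du ∘ ϱ`, so it belongs to `B`
    set l : ℝ := mfderiv (cornerModel (n + 1)) 𝓘(ℝ, ℝ) u (ι y) (ϱ (ι y) a) with hl
    have h1 : a - l • N y ∈ boundaryAlgebroid ϱ ι y := by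
      refine (hder y).2.2 _ ?_
      rw [map_sub, map_smul, map_sub, map_smul, (hder y).2.1]
      exact sub_eq_zero.2 (mul_one l).symm
    have h2 := hτB y _ h1
    rw [map_sub, map_smul, hτN, smul_eq_mul, mul_one, sub_eq_zero] at h2
    exact h2.symm
  · -- `Φ⁻¹` is locally a normal form, in which the density does not depend on `x₀`
    intro q hq hgood a w
    obtain ⟨j, hj1, hj2, hj3, hj4⟩ := hsymm q hq
    have hj4' : (Φ.symm : ℝ × Y → M) =ᶠ[𝓝[Φ.target] q]
        fun q' => G j (collarChart (χ j) q') := hj4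
    have hu : UniqueMDiffWithinAt (𝓘(ℝ, ℝ).prod (cornerModel n)) Φ.target q := by
      rw [hΦ.target_eq] at hq ⊢
      exact ((uniqueDiffOn_Ico (0 : ℝ) r).uniqueMDiffOn.prod uniqueMDiffOn_univ) q hq
    have hsub : Φ.target ⊆ Ici 0 ×ˢ univ := by
      rw [hΦ.target_eq]
      exact prod_mono Ico_subset_Ici_self subset_rfl
    have h1 : ∀ p, p = G j (collarChart (χ j) q) →
        ∀ v : Fin (n + 1) → EuclideanSpace ℝ (Fin (n + 1)),
        (tangentDensity ϱ (volumeDensity g) p).toFun v =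
          (tangentDensity ϱ (volumeDensity g) (G j (collarChart (χ j) q))).toFun v := by
      rintro _ rfl v; rfl
    have h2 : ∀ v : ℝ × TangentSpace (cornerModel n) q.2,
        (mfderivWithin (𝓘(ℝ, ℝ).prod (cornerModel n)) (cornerModel (n + 1)) Φ.symm Φ.target q v :
          EuclideanSpace ℝ (Fin (n + 1))) = paramDeriv (G j) (c j) (e j) (collarChart (χ j) q)
            (consCoord (v.1, mfderiv (cornerModel n) 𝓘(ℝ, EuclideanSpace ℝ (Fin n))
              ((χ j).extend (cornerModel n)) q.2 v.2)) := fun v =>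
      (DFunLike.congr_fun (hj4'.mfderivWithin_eq (I := 𝓘(ℝ, ℝ).prod (cornerModel n))
        (I' := cornerModel (n + 1)) hj3) v).trans
        ((h j).mfderivWithin_collarInv hsub hu hj1 hj2 v)
    refine Eq.trans ?_ ((h j).tangentDensity_cons hinj hιc hj1 hj2 (hM.bijective_anchor _ hgood)
      (by rw [hsN]; exact hN.unit _) (fun b hb => by rw [hsN]; exact hN.orthogonal _ b hb) a w)
    refine (h1 _ hj3 _).trans (congrArg (tangentDensity ϱ (volumeDensity g)
      (G j (collarChart (χ j) q))).toFun (funext fun i => ?_))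
    refine Fin.cases ?_ (fun i => ?_) i
    · refine (h2 (a, 0)).trans ?_
      exact congrArg (fun v => paramDeriv (G j) (c j) (e j) (collarChart (χ j) q)
        (consCoord (a, v))) (map_zero _)
    · exact h2 (0, w i)
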